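/- **Notation.** Words and sequences are over $\{0,1\}$; $\prec,\preccurlyeq$ is the lexicographic order, $\sigma$ the left shift, $\mathbf w^\infty$ the periodic sequence with block $\mathbf w$. For a word $\mathbf w$ ending in $0$ (resp. $1$), $\mathbf w^+$ (resp. $\mathbf w^-$) is obtained by changing its last digit to $1$ (resp. $0$); $\mathbb L(\mathbf w)$ is the largest cyclic permutation of $\mathbf w$. A word is *Lyndon* if it is aperiodic and the smallest of its cyclic permutations. With $F_0=(0,1)$, let $F_{n+1}$ arise from the list $F_n$ by inserting the concatenation $\mathbf u\mathbf v$ between any two neighbours $\mathbf u,\mathbf v$; $F^*$ is the set of all words of length at least $2$ in $\bigcup_n F_n$ (Farey words). For $1<\beta\le 2$ let $\pi_\beta((d_i))=\sum_{i\ge1}d_i\beta^{-i}$; let $b(t,\beta)$ be the lexicographically largest $d\in\{0,1\}^{\mathbb N}$ with $\pi_\beta(d)=t$ (greedy expansion, $0\le t\le 1$), and $\alpha(\beta)=\alpha_1\alpha_2\dots$ the lexicographically largest $d$ with $\pi_\beta(d)=1$ not ending in $0^\infty$ (quasi-greedy expansion of $1$). Let $T_\beta(x)=\beta x \bmod 1$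 on $[0,1)$, $K_\beta(t)=\{x\in[0,1):T_\beta^n(x)\ge t\ \forall n\ge0\}$, $\tau(\beta)=\min\{t>0:\dim_H K_\beta(t)=0\}$, and $$\widetilde{\mathcal K}_\beta(t)=\{\mathbf z\in\{0,1\}^{\mathbb N}: b(t,\beta)\preccurlyeq\sigma^n(\mathbf z)\preccurlyeq\alpha(\beta)\ \forall n\ge0\}.$$ For a subshift $\mathcal X$, let $\mathcal L(\mathcal X)$ be the set of finite words occurring in sequences of $\mathcal X$ and $\mathcal B_n(\mathcal X)$ the set of those of length $n$. $\mathcal X$ is *transitive* if for all $\mathbf u\in\mathcal L(\mathcal X)$ and $\mathbf z\in\mathcal X$ there is a word $\mathbf v$ with $\mathbf u\mathbf v\mathbf z\in\mathcal X$; its *entropy* is $\lim_{n\to\infty}\frac1n\log\#\mathcal B_n(\mathcal X)$. A Lyndon word $\mathbf w$ is *$\beta$-Lyndon* if $\mathbf w^\infty=b(t,\beta)$ for some $t\in[0,1)$, and then $[\pi_\beta(\mathbf w0^\infty),\pi_\beta(\mathbf w^\infty)]$ is a *$\beta$-Lyndon interval*. For a Lyndon word $\mathbf v$, $\mathbf v^*$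 denotes the smallest $\beta$-Lyndon word with $(\mathbf v^*)^\infty\succcurlyeq\mathbf v^\infty$. **Theorem.** Let $\mathbf S\in F^*$, let $\beta_\ell,\beta_*\in(1,2]$ be given by $\alpha(\beta_\ell)=\mathbb L(\mathbf S)^\infty$ and $\alpha(\beta_*)=\mathbb L(\mathbf S)^+\mathbf S^-\mathbb L(\mathbf S)^\infty$, and let $\beta\in(\beta_\ell,\beta_*)$. Let $c=c_1c_2\dots$ be $\alpha(\beta)$ if $\alpha(\beta)$ is not (purely) periodic, and the greedy expansion $b(1,\beta)$ of $1$ if $\alpha(\beta)$ is periodic. Define a finite or infinite, possibly empty, collection $\mathcal I=\{I_1,I_2,\dots\}$ of intervals inductively as follows. Put $j_1=|\mathbf S|$. Given $j_k$, stop if $\sigma^{j_k}(c)=0^\infty$ or if $\sigma^{j_k+n}(c)\succ\sigma^{j_k}(c)$ for all $n\ge1$. Otherwise let $n_k=\min\{n\ge1:\sigma^{j_k+n}(c)\preccurlyeq\sigma^{j_k}(c)\}$, $\mathbf v_k=c_{j_k+1}\dots c_{j_k+n_k}$, and let $I_k=[\underline t_k,\overline t_k)$, where $$b(\underline t_k,\beta)=\mathbf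 v_k^-(c_1\dots c_{j_k}^-)^\infty,\qquad b(\overline t_k,\beta)=(\mathbf v_k^*)^\infty,$$ except that $I_k=[\underline t_k,\overline t_k]$ if $\mathbf v_k$ is $\beta$-Lyndon and $\sigma^{j_k}(c)=\mathbf v_k^\infty$; then put $j_{k+1}=j_k+n_k$ and continue. Then for every $\beta$-Lyndon interval $[t_L,t_R]\subseteq[0,\tau(\beta)]$, the subshift $\widetilde{\mathcal K}_\beta(t_R)$ is transitive if and only if $t_R\notin\bigcup_{I\in\mathcal I}I$. Furthermore, for each $I\in\mathcal I$, the entropy of $\widetilde{\mathcal K}_\beta(t)$ is constant for $t\in I$. -/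

import Mathlib

namespace BetaHole

/-! ### Words and sequences over `{0,1}` (`false` is the digit `0`, `true` the digit `1`) -/

/-- Finite words. -/
abbrev Word := List Bool

/-- Infinite sequences; the digit `d₁` of the usual notation is `d 0`. -/
abbrev Seq := ℕ → Bool

/-- Lexicographic order on sequences. -/
def seqLE (x y : Seq) : Prop := toLex x ≤ toLex y

/-- `x` is the lexicographically largest element of `A`. -/
def IsLexGreatest (A : Set Seq) (x : Seq) : Prop := x ∈ A ∧ ∀ y ∈ A, seqLE y x

/-- The `n`-th iterate of the left shift. -/
def shiftBy (n : ℕ) (x : Seq) : Seq := fun i => x (n + i)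

/-- The constant sequence `0^∞`. -/
def zeroSeq : Seq := fun _ => false

/-- The word `x_{j+1} … x_{j+n}`. -/
def block (x : Seq) (j n : ℕ) : Word := (List.range n).map fun i => x (j + i)

/-- The sequence obtained by writing the word `w` in front of the sequence `x`. -/
def wordAppend (w : Word) (x : Seq) : Seq :=
  fun i => if i < w.length then w.getD i false else x (i - w.length)

/-- The periodic sequence `w^∞` (for a nonempty word `w`). -/
def wordPow (w : Word) : Seq := fun i => w.getD (i % w.length) false

/-- `w⁺`: the last digit (a `0`) is replaced by `1`. -/
def wordPlus (w : Word) : Word := w.dropLast ++ [true]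

/-- `w⁻`: the last digit (a `1`) is replaced by `0`. -/
def wordMinus (w : Word) : Word := w.dropLast ++ [false]

/-- The lexicographically largest cyclic permutation of `w`. -/
def largestRotation (w : Word) : Word := w.cyclicPermutations.foldr max w

/-- Purely periodic sequences. -/
def IsPurelyPeriodic (x : Seq) : Prop := ∃ m : ℕ, 1 ≤ m ∧ shiftBy m x = x

/-- A Lyndon word: aperiodic (not a proper power) and smallest among its cyclic permutations,
i.e. strictly smaller than each of its proper rotations. -/
def IsLyndon (w : Word) : Prop := w ≠ [] ∧ ∀ i, 0 < i → i < w.length → w < w.rotate i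

/-! ### Farey words -/

/-- Insert between any two neighbouring words of a list their concatenation. -/
def fareyInsert : List Word → List Word
  | [] => []
  | [a] => [a]
  | a :: b :: l => a :: (a ++ b) :: fareyInsert (b :: l)

/-- The lists `F₀ = (0, 1)`, `F₁ = (0, 01, 1)`, `F₂ = (0, 001, 01, 011, 1)`, … -/
def fareyList : ℕ → List Word
  | 0 => [[false], [true]]
  | n + 1 => fareyInsert (fareyList n)

/-- Farey words of length at least two. -/
def IsFarey (s : Word) : Prop := (∃ n, s ∈ fareyList n) ∧ 2 ≤ s.length

/-! ### Expansions in base `β` -/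

/-- `π_β(d) = ∑_{i ≥ 1} d_i β^{-i}`. -/
noncomputable def proj (β : ℝ) (d : Seq) : ℝ := ∑' i : ℕ, ((d i).toNat : ℝ) / β ^ (i + 1)

/-- The greedy expansion `b(t, β)`: the lexicographically largest expansion of `t` in base `β`
(it exists for `1 < β ≤ 2` and `0 ≤ t ≤ 1`). -/
noncomputable def greedy (β t : ℝ) : Seq :=
  Classical.epsilon (IsLexGreatest {d | proj β d = t})

/-- The quasi-greedy expansion `α(β)` of `1`: the lexicographically largest expansion of `1` in
base `β` that does not end in `0^∞` (it exists for `1 < β ≤ 2`). -/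
noncomputable def quasiGreedy (β : ℝ) : Seq :=
  Classical.epsilon (IsLexGreatest {d | proj β d = 1 ∧ ∀ n, shiftBy n d ≠ zeroSeq})

/-- The endpoints of the basic interval `[β_ℓ, β_*]` generated by the word `S`:
`α(β_ℓ) = L(S)^∞` and `α(β_*) = L(S)⁺ S⁻ L(S)^∞`, where `L(S)` is the largest rotation of `S`. -/
def IsBasicInterval (S : Word) (βl βs : ℝ) : Prop :=
  βl ∈ Set.Ioc (1 : ℝ) 2 ∧ βs ∈ Set.Ioc (1 : ℝ) 2 ∧
  quasiGreedy βl = wordPow (largestRotation S) ∧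
  quasiGreedy βs =
    wordAppend (wordPlus (largestRotation S) ++ wordMinus S) (wordPow (largestRotation S))

/-! ### The survivor set, the critical value and the subshifts -/

/-- The map `x ↦ β x mod 1`. -/
noncomputable def betaMap (β x : ℝ) : ℝ := Int.fract (β * x)

/-- `K_β(t)`: the points of `[0,1)` whose orbit stays in `[t,1)`. -/
def survivorSet (β t : ℝ) : Set ℝ :=
  {x | x ∈ Set.Ico (0 : ℝ) 1 ∧ ∀ n : ℕ, t ≤ (betaMap β)^[n] x}

/-- The critical value `τ(β)`: the least `t > 0` for which `K_β(t)` has Hausdorff dimension `0`. -/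
noncomputable def criticalValue (β : ℝ) : ℝ := sInf {t : ℝ | 0 < t ∧ dimH (survivorSet β t) = 0}

/-- The subshift of all `z` with `b(t,β) ≼ σⁿ(z) ≼ α(β)` for all `n ≥ 0`. -/
def survivorShift (β t : ℝ) : Set Seq :=
  {z | ∀ n : ℕ, seqLE (greedy β t) (shiftBy n z) ∧ seqLE (shiftBy n z) (quasiGreedy β)}

/-- The finite words occurring in some sequence of `X`. -/
def language (X : Set Seq) : Set Word := {w | ∃ x ∈ X, ∃ j, block x j w.length = w}

/-- Transitivity: any word of the language can be joined to any sequence of `X` inside `X`. -/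
def IsTransitive (X : Set Seq) : Prop :=
  ∀ u ∈ language X, ∀ z ∈ X, ∃ v : Word, wordAppend (u ++ v) z ∈ X

/-- The topological entropy of `X`, i.e. the limit of `(1/n) log #B_n(X)` with `B_n(X)` the set of
words of length `n` in the language of `X`, exists and is equal to `h`. -/
def HasEntropy (X : Set Seq) (h : ℝ) : Prop :=
  Filter.Tendsto (fun n : ℕ => Real.log (({w ∈ language X | w.length = n}).ncard : ℝ) / (n : ℝ))
    Filter.atTop (nhds h)

/-! ### `β`-Lyndon words and intervals -/

/-- `w` is Lyndon and `w^∞` is the greedy expansion of a point of `[0,1)`. -/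
def IsBetaLyndon (β : ℝ) (w : Word) : Prop :=
  IsLyndon w ∧ ∃ t ∈ Set.Ico (0 : ℝ) 1, greedy β t = wordPow w

/-- `[tL, tR] = [π_β(w 0^∞), π_β(w^∞)]` for some `β`-Lyndon word `w`. -/
def IsBetaLyndonInterval (β tL tR : ℝ) : Prop :=
  ∃ w, IsBetaLyndon β w ∧ tL = proj β (wordAppend w zeroSeq) ∧ tR = proj β (wordPow w)

/-- `u = v^*`: the smallest `β`-Lyndon word `u` with `u^∞ ≽ v^∞`. -/
def IsStar (β : ℝ) (v u : Word) : Prop :=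
  (IsBetaLyndon β u ∧ seqLE (wordPow v) (wordPow u)) ∧
  ∀ u', IsBetaLyndon β u' → seqLE (wordPow v) (wordPow u') → seqLE (wordPow u) (wordPow u')

/-! ### The collection of intervals -/

open Classical in
/-- The sequence used in the construction: `α(β)` if it is not periodic, and otherwise the greedy
expansion of `1`, which is `α₁ … α_{m-1} 1 0^∞` if `α(β) = (α₁ … α_m)^∞` with `m` minimal. -/
noncomputable def baseSeq (β : ℝ) : Seq :=
  if IsPurelyPeriodic (quasiGreedy β) then greedy β 1 else quasiGreedy β

/-- `n` is the smallest `n ≥ 1` with `σ^{j+n}(c) ≼ σ^j(c)`. There is no such `n` if the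
construction stops at `j`, which it also does if `σ^j(c) = 0^∞`. -/
def IsReturn (c : Seq) (j n : ℕ) : Prop :=
  shiftBy j c ≠ zeroSeq ∧
  IsLeast {n : ℕ | 1 ≤ n ∧ seqLE (shiftBy (j + n) c) (shiftBy j c)} n

/-- `IsCut c j₁ k j` says that `j` is the number `j_k`, where `j_{k+1} = j_k + n_k` and `n_k` is
the return time at `j_k`. -/
inductive IsCut (c : Seq) (j₁ : ℕ) : ℕ → ℕ → Prop
  | first : IsCut c j₁ 1 j₁
  | next {k j n : ℕ} : IsCut c j₁ k j → IsReturn c j n → IsCut c j₁ (k + 1) (j + n)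

open Classical in
/-- The interval belonging to the position `j`, the word `v = c_{j+1} … c_{j+n}` and the word
`u = v^*`. Its endpoints have the greedy expansions `v⁻ (c₁ … c_j⁻)^∞` and `u^∞`. It is half-open,
except if `v` is `β`-Lyndon and `σ^j(c) = v^∞`, when it is closed. -/
noncomputable def window (β : ℝ) (c : Seq) (j : ℕ) (v u : Word) : Set ℝ :=
  if IsBetaLyndon β v ∧ shiftBy j c = wordPow v then
    Set.Icc (proj β (wordAppend (wordMinus v) (wordPow (wordMinus (block c 0 j)))))
      (proj β (wordPow u))
  else
    Set.Ico (proj β (wordAppend (wordMinus v) (wordPow (wordMinus (block c 0 j)))))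
      (proj β (wordPow u))

/-- The collection of the intervals `I₁, I₂, …` constructed for `β` in the interior of the basic
interval generated by `S`, with `j₁ = |S|`. -/
def windows (S : Word) (β : ℝ) : Set (Set ℝ) :=
  {I | ∃ k j n u, IsCut (baseSeq β) S.length k j ∧ IsReturn (baseSeq β) j n ∧
    IsStar β (block (baseSeq β) j n) u ∧
    I = window β (baseSeq β) j (block (baseSeq β) j n) u}

end BetaHole

open BetaHole

/-! Notation: S = 0P1, A = L(S) = 1P0 and a = α(β). For a cut j, write c₁…c_j = C1 (the word C
followed by the digit 1) and let v1 be the return word, so that lowering the last digits gives C0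
and v0. Put D = σ^j(c), and let X = v0(C0)^∞ be the left endpoint of the window. The projection is
strictly increasing on admissible sequences, so everything becomes a statement about sequences whose
shifts all lie between W = b(t,β) and a.

Why a window destroys transitivity. Let W ≽ X. A survivor ≼ D begins with v0 followed by a tail ≽
(C0)^∞, or with v1 followed by a tail ≼ D. A survivor ≽ (C0)^∞ begins with C0 followed by a tail ≽
(C0)^∞, or with C1 followed by a tail ≼ D (`split_low`, `split_high`). These two regions form a
trap, while the orbit of S^∞ stays between S^∞ ≻ D and A^∞ ≼ (C0)^∞. If W = w^∞ lies in the window,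
then C1w^∞ survives, so C1 belongs to the language; but whatever follows C1 is trapped and cannot
end in S^∞ (`not_isTransitive`).

Why nothing else does. If W lies in no window and W ≺ D, then W ≺ X strictly. This leaves room to
replace (C0)^∞ by a long power of C0 followed by an exit found at the preceding cut; descending
through the cuts leads to A^∞ (`exists_good_below`). So every word of the language can be continued
into A^∞, and from A^∞ every survivor can be entered when W ≼ S⁻A^∞ (`exists_bridge`). This last
condition comes from t_R ≤ τ(β): the survivors above S⁻A^∞ are eventually periodic, hence countable,
so τ(β) is at most the value of S⁻A^∞ (`criticalValue_le`).

Why the entropy is constant. A survivor above X spends some time in the middle subshift Z, whose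
shifts lie between v1^∞ and (C0)^∞, and is trapped afterwards. Trapped words of length m number at
most a constant times ξ^(-m), where ξ^j + ξ^n = 1 and n is the length of v1 (`cnt_upper`). But Z
contains all concatenations of two words whose lengths are at most j and n in some order
(`exists_free_pair`), so its entropy is at least -log ξ and the trap adds nothing (`growth_le`).
Finally Z lies above (v1)^* (`surv_subset_star`), so both ends of the window have the entropy of Z.
This needs X to lie below all earlier left endpoints; otherwise the window sits inside an earlier
one and induction applies (`exists_growth`). -/

namespace BetaHole

/-! ### The lexicographic order -/

/-- Strict lexicographic order on sequences. -/
def seqLT (x y : Seq) : Prop := toLex x < toLex y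

infix:50 "≼" => seqLE
infix:50 "≺" => seqLT
infixr:67 "⊹" => wordAppend

section order
variable {x y z : Seq}

theorem seqLT_iff : x ≺ y ↔ ∃ n, (∀ i < n, x i = y i) ∧ x n = false ∧ y n = true := by
  constructor
  · rintro ⟨n, h1, h2⟩
    exact ⟨n, h1, Bool.lt_iff.1 h2⟩
  · rintro ⟨n, h1, h2⟩
    exact ⟨n, h1, Bool.lt_iff.2 h2⟩

theorem seqLE.rfl : x ≼ x := le_refl (toLex x)
theorem seqLE.trans (h : x ≼ y) (h' : y ≼ z) : x ≼ z := le_trans (α := Lex Seq) h h'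
theorem seqLT.trans (h : x ≺ y) (h' : y ≺ z) : x ≺ z := lt_trans (α := Lex Seq) h h'
theorem seqLT.trans_le (h : x ≺ y) (h' : y ≼ z) : x ≺ z := lt_of_lt_of_le (α := Lex Seq) h h'
theorem seqLE.trans_lt (h : x ≼ y) (h' : y ≺ z) : x ≺ z := lt_of_le_of_lt (α := Lex Seq) h h'
theorem seqLT.le (h : x ≺ y) : x ≼ y := le_of_lt (α := Lex Seq) h
theorem seq_not_le : ¬ x ≼ y ↔ y ≺ x := not_le (α := Lex Seq)
theorem seq_not_lt : ¬ x ≺ y ↔ y ≼ x := not_lt (α := Lex Seq)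
theorem seq_le_or_lt (x y : Seq) : x ≼ y ∨ y ≺ x := le_or_gt (α := Lex Seq) x y
theorem seq_le_total (x y : Seq) : x ≼ y ∨ y ≼ x := le_total (α := Lex Seq) x y
theorem seqLE.lt_or_eq (h : x ≼ y) : x ≺ y ∨ x = y := lt_or_eq_of_le (α := Lex Seq) h
theorem seqLE.antisymm (h : x ≼ y) (h' : y ≼ x) : x = y := le_antisymm (α := Lex Seq) h h'
theorem seqLT.irrefl (x : Seq) : ¬ x ≺ x := lt_irrefl (α := Lex Seq) x
theorem seqLT.ne (h : x ≺ y) : x ≠ y := fun e => seqLT.irrefl y (e ▸ h)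
theorem seqLE.not_lt (h : x ≼ y) : ¬ y ≺ x := seq_not_lt.2 h
theorem seqLT.not_le (h : x ≺ y) : ¬ y ≼ x := seq_not_le.2 h

theorem zeroSeq_le (x : Seq) : zeroSeq ≼ x := by
  rw [← seq_not_lt, seqLT_iff]
  rintro ⟨n, -, -, h⟩
  cases h

theorem seqLE.lt_of_ne (h : x ≼ y) (h' : x ≠ y) : x ≺ y := h.lt_or_eq.resolve_right h'

end order

/-! ### Shifts and concatenation -/

section words
variable {x y z a b : Seq} {u v w p q : Word}

theorem nil_wordAppend (x : Seq) : [] ⊹ x = x := by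
  funext i; simp [wordAppend]

theorem wordAppend_lt {i : ℕ} (h : i < u.length) : (u ⊹ x) i = u.getD i false := by
  simp [wordAppend, h]

theorem wordAppend_lt_congr {i : ℕ} (h : i < u.length) : (u ⊹ x) i = (u ⊹ y) i := by
  simp [wordAppend, h]

theorem wordAppend_ge {i : ℕ} (h : u.length ≤ i) : (u ⊹ x) i = x (i - u.length) := by
  simp [wordAppend, Nat.not_lt.2 h]

theorem wordAppend_add (i : ℕ) : (u ⊹ x) (u.length + i) = x i := by
  rw [wordAppend_ge (by omega)]; congr 1; omega

theorem append_wordAppend (u v : Word) (x : Seq) : (u ++ v) ⊹ x = u ⊹ v ⊹ x := by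
  funext i
  simp only [wordAppend, List.length_append]
  by_cases h : i < u.length
  · have h2 : i < u.length + v.length := by omega
    simp only [h, h2, if_true, List.getD_append u v false i h]
  · by_cases h2 : i < u.length + v.length
    · have h3 : i - u.length < v.length := by omega
      simp only [h, h2, h3, if_true, if_false]
      exact List.getD_append_right u v false i (by omega)
    · have h3 : ¬ i - u.length < v.length := by omega
      simp only [h, h2, h3, if_false]
      congr 1; omega

@[simp] theorem shiftBy_zero (x : Seq) : shiftBy 0 x = x := by
  funext i; simp [shiftBy]

theorem shiftBy_shiftBy (m n : ℕ) (x : Seq) : shiftBy m (shiftBy n x) = shiftBy (n + m) x := by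
  funext i; simp only [shiftBy]; congr 1; omega

theorem shiftBy_append_of_le {n : ℕ} (h : n ≤ u.length) :
    shiftBy n (u ⊹ x) = u.drop n ⊹ x := by
  conv_lhs => rw [← List.take_append_drop n u, append_wordAppend]
  funext i
  have hl : (u.take n).length = n := by simp [h]
  have := wordAppend_add (u := u.take n) (x := u.drop n ⊹ x) i
  rw [hl] at this
  exact this

theorem shiftBy_append_of_ge {n : ℕ} (h : u.length ≤ n) :
    shiftBy n (u ⊹ x) = shiftBy (n - u.length) x := by
  funext i
  rw [shiftBy, wordAppend_ge (by omega), shiftBy]; congr 1; omega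

@[simp] theorem shiftBy_length_append : shiftBy u.length (u ⊹ x) = x := by
  rw [shiftBy_append_of_ge le_rfl]; simp

theorem shiftBy_append_append (p u : Word) (x : Seq) :
    shiftBy p.length ((p ++ u) ⊹ x) = u ⊹ x := by
  rw [append_wordAppend, shiftBy_length_append]

/-- A property of all shifts of `u ⊹ x` splits into one of the suffixes of `u` and one of the
shifts of `x`. -/
theorem forall_shift_append {K : Seq → Prop} (h1 : ∀ p y, u = p ++ y → y ≠ [] → K (y ⊹ x))
    (h2 : ∀ n, K (shiftBy n x)) (n : ℕ) : K (shiftBy n (u ⊹ x)) := by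
  rcases lt_or_ge n u.length with h | h
  · rw [shiftBy_append_of_le h.le]
    refine h1 (u.take n) _ (List.take_append_drop n u).symm ?_
    intro e
    have := congrArg List.length e
    simp at this; omega
  · rw [shiftBy_append_of_ge h]; exact h2 _

@[simp] theorem length_block (x : Seq) (j n : ℕ) : (block x j n).length = n := by simp [block]

theorem block_eq_block_shiftBy (x : Seq) (j n : ℕ) : block x j n = block (shiftBy j x) 0 n := by
  simp [block, shiftBy]

theorem block_append_shiftBy (x : Seq) (n : ℕ) : block x 0 n ⊹ shiftBy n x = x := by
  funext i
  by_cases h : i < n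
  · rw [wordAppend_lt (by simpa using h)]
    simp [block, List.getD, h]
  · rw [wordAppend_ge (by simpa using h)]
    simp only [length_block, shiftBy]; congr 1; omega

theorem block_append_shiftBy' (x : Seq) (j n : ℕ) :
    block x j n ⊹ shiftBy (j + n) x = shiftBy j x := by
  rw [block_eq_block_shiftBy, ← shiftBy_shiftBy, block_append_shiftBy]

theorem wordAppend_inj (h : u.length = v.length) (e : u ⊹ x = v ⊹ y) : u = v ∧ x = y := by
  constructor
  · apply List.ext_getElem h
    intro i h1 h2
    have := congrFun e i
    rw [wordAppend_lt h1, wordAppend_lt h2] at this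
    simpa [List.getD, h1, h2] using this
  · funext i
    have := congrFun e (u.length + i)
    rwa [wordAppend_add, h, wordAppend_add] at this

theorem block_wordAppend (u : Word) (x : Seq) : block (u ⊹ x) 0 u.length = u := by
  have := block_append_shiftBy (u ⊹ x) u.length
  exact (wordAppend_inj (by simp) this).1

theorem block_add (x : Seq) (j m n : ℕ) : block x j (m + n) = block x j m ++ block x (j + m) n := by
  simp only [block, List.range_add, List.map_append, List.map_map]
  congr 1
  apply List.map_congr_left
  intro i _
  simp only [Function.comp]; congr 1; omega

theorem block_congr {n : ℕ} (h : ∀ i < n, x i = y i) : block x 0 n = block y 0 n := by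
  unfold block
  apply List.map_congr_left
  intro i hi
  simpa using h i (by simpa using hi)

theorem eq_of_block_eq {n : ℕ} (h : block x 0 n = block y 0 n) : ∀ i < n, x i = y i := by
  intro i hi
  have h1 := block_append_shiftBy x n
  have h2 := block_append_shiftBy y n
  rw [← h1, ← h2, h, wordAppend_lt_congr (by simpa using hi)]

theorem exists_eq_append (x : Seq) (n : ℕ) : ∃ u x', u.length = n ∧ x = u ⊹ x' :=
  ⟨block x 0 n, shiftBy n x, by simp, (block_append_shiftBy x n).symm⟩

theorem append_lt_append_iff : u ⊹ x ≺ u ⊹ y ↔ x ≺ y := by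
  rw [seqLT_iff, seqLT_iff]
  constructor
  · rintro ⟨n, h1, h2, h3⟩
    have hn : u.length ≤ n := by
      by_contra h
      rw [wordAppend_lt (by omega)] at h2 h3
      rw [h2] at h3; cases h3
    refine ⟨n - u.length, fun i hi => ?_, ?_, ?_⟩
    · have := h1 (u.length + i) (by omega)
      rwa [wordAppend_add, wordAppend_add] at this
    · rwa [wordAppend_ge hn] at h2
    · rwa [wordAppend_ge hn] at h3
  · rintro ⟨n, h1, h2, h3⟩
    refine ⟨u.length + n, fun i hi => ?_, by rwa [wordAppend_add], by rwa [wordAppend_add]⟩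
    by_cases h : i < u.length
    · exact wordAppend_lt_congr h
    · rw [wordAppend_ge (by omega), wordAppend_ge (by omega)]
      exact h1 _ (by omega)

theorem append_le_append_iff : u ⊹ x ≼ u ⊹ y ↔ x ≼ y := by
  rw [← seq_not_lt, append_lt_append_iff, seq_not_lt]

/-- `u` is smaller than `v` and not a prefix of it. -/
def Below (u v : Word) : Prop := ∀ a b : Seq, u ⊹ a ≺ v ⊹ b

theorem Below.trans (h : Below u v) (h' : Below v w) : Below u w :=
  fun a b => (h a zeroSeq).trans (h' zeroSeq b)

theorem Below.append (h : Below u v) (p q : Word) : Below (u ++ p) (v ++ q) := fun a b => by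
  rw [append_wordAppend, append_wordAppend]; exact h _ _

theorem Below.append_left (h : Below u v) (p : Word) : Below (p ++ u) (p ++ v) := fun a b => by
  rw [append_wordAppend, append_wordAppend, append_lt_append_iff]; exact h _ _

theorem Below.irrefl (u : Word) : ¬ Below u u := fun h => seqLT.irrefl _ (h zeroSeq zeroSeq)

theorem Below.asymm (h : Below u v) (h' : Below v u) : False := Below.irrefl _ (h.trans h')

theorem below_concat (p : Word) : Below (p ++ [false]) (p ++ [true]) := by
  apply Below.append_left
  intro a b
  rw [seqLT_iff]
  exact ⟨0, fun i hi => absurd hi (by omega), by simp [wordAppend], by simp [wordAppend]⟩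

theorem below_cons (u v : Word) : Below (false :: u) (true :: v) := by
  have := (below_concat []).append u v
  simpa using this

/-- The basic case split of the file: a comparison is decided inside the two prefixes, and then for
every continuation, or else it is left to the tails. -/
theorem below_of_lt (h : u.length = v.length) (hl : u ⊹ a ≺ v ⊹ b) :
    Below u v ∨ (u = v ∧ a ≺ b) := by
  obtain ⟨n, h1, h2, h3⟩ := seqLT_iff.1 hl
  by_cases hn : n < u.length
  · left
    intro a' b'
    refine seqLT_iff.2 ⟨n, fun i hi => ?_, ?_, ?_⟩
    · rw [wordAppend_lt_congr (u := u) (y := a) (by omega),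
        wordAppend_lt_congr (u := v) (y := b) (by omega)]
      exact h1 i hi
    · rw [wordAppend_lt_congr (y := a) (by omega)]; exact h2
    · rw [wordAppend_lt_congr (y := b) (by omega)]; exact h3
  · right
    have e : u = v := by
      apply List.ext_getElem h
      intro i hi1 hi2
      have := h1 i (by omega)
      rw [wordAppend_lt hi1, wordAppend_lt hi2] at this
      simpa [List.getD, hi1, hi2] using this
    subst e
    exact ⟨rfl, append_lt_append_iff.1 hl⟩

theorem below_of_le (h : u.length = v.length) (hl : u ⊹ a ≼ v ⊹ b) :
    Below u v ∨ (u = v ∧ a ≼ b) := by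
  rcases hl.lt_or_eq with h1 | h1
  · rcases below_of_lt h h1 with h2 | h2
    · exact Or.inl h2
    · exact Or.inr ⟨h2.1, h2.2.le⟩
  · obtain ⟨e1, e2⟩ := wordAppend_inj h h1
    exact Or.inr ⟨e1, e2 ▸ seqLE.rfl⟩

theorem below_trichotomy (h : u.length = v.length) : Below u v ∨ u = v ∨ Below v u := by
  rcases seq_le_or_lt (u ⊹ zeroSeq) (v ⊹ zeroSeq) with h1 | h1
  · rcases below_of_le h h1 with h2 | h2
    · exact Or.inl h2
    · exact Or.inr (Or.inl h2.1)
  · rcases below_of_lt h.symm h1 with h2 | h2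
    · exact Or.inr (Or.inr h2)
    · exact Or.inr (Or.inl h2.1.symm)

/-- A sequence between `p0…` and `p1…` starts with `p0` or `p1`. -/
theorem between (h1 : (p ++ [false]) ⊹ a ≼ z) (h2 : z ≼ (p ++ [true]) ⊹ b) :
    (∃ z', z = (p ++ [false]) ⊹ z' ∧ a ≼ z') ∨ (∃ z', z = (p ++ [true]) ⊹ z' ∧ z' ≼ b) := by
  obtain ⟨u, z1, hu, rfl⟩ := exists_eq_append z p.length
  rw [append_wordAppend] at h1 h2
  have e : u = p := by
    rcases below_of_le hu.symm h1 with h3 | h3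
    · rcases below_of_le hu h2 with h4 | h4
      · exact absurd (h3.trans h4) (Below.irrefl _)
      · exact h4.1
    · exact h3.1.symm
  subst e
  rw [append_le_append_iff] at h1 h2
  obtain ⟨t, z2, ht, rfl⟩ := exists_eq_append z1 1
  obtain ⟨d, rfl⟩ := List.length_eq_one_iff.1 ht
  cases d
  · left
    exact ⟨z2, (append_wordAppend _ _ _).symm, append_le_append_iff.1 h1⟩
  · right
    exact ⟨z2, (append_wordAppend _ _ _).symm, append_le_append_iff.1 h2⟩

/-- The words p0 and p1 are consecutive among the words of their length. -/
theorem below_concat_true (h : u.length = p.length + 1) (hb : Below u (p ++ [true])) :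
    Below u (p ++ [false]) ∨ u = p ++ [false] := by
  rcases below_trichotomy (u := u) (v := p ++ [false]) (by simp [h]) with h1 | h1 | h1
  · exact Or.inl h1
  · exact Or.inr h1
  · exfalso
    rcases between (h1 zeroSeq zeroSeq).le (hb zeroSeq zeroSeq).le with ⟨z, e, -⟩ | ⟨z, e, -⟩
    · rw [(wordAppend_inj (by simp [h]) e).1] at h1; exact Below.irrefl _ h1
    · rw [(wordAppend_inj (by simp [h]) e).1] at hb; exact Below.irrefl _ hb

/-! ### Periodic sequences -/

theorem wordPow_eq (hw : w ≠ []) : w ⊹ wordPow w = wordPow w := by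
  have h0 : 0 < w.length := List.length_pos_iff.2 hw
  funext i
  by_cases h : i < w.length
  · rw [wordAppend_lt h, wordPow, Nat.mod_eq_of_lt h]
  · rw [wordAppend_ge (by omega), wordPow, wordPow, ← Nat.mod_eq_sub_mod (by omega)]

theorem eq_wordPow (hw : w ≠ []) (h : x = w ⊹ x) : x = wordPow w := by
  have h0 : 0 < w.length := List.length_pos_iff.2 hw
  funext i
  induction i using Nat.strong_induction_on with
  | _ i ih =>
    rw [h, ← wordPow_eq hw]
    by_cases hi : i < w.length
    · exact wordAppend_lt_congr hi
    · rw [wordAppend_ge (by omega), wordAppend_ge (by omega)]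
      exact ih _ (by omega)

theorem wordPow_append_comm (hu : u ≠ []) (v : Word) : u ⊹ wordPow (v ++ u) = wordPow (u ++ v) := by
  apply eq_wordPow (by simp [hu])
  conv_lhs => rw [← wordPow_eq (w := v ++ u) (by simp [hu])]
  simp only [append_wordAppend]

theorem shiftBy_length_wordPow (hw : w ≠ []) : shiftBy w.length (wordPow w) = wordPow w := by
  conv_lhs => rw [← wordPow_eq hw]
  simp

theorem shiftBy_mul_wordPow (hw : w ≠ []) (k : ℕ) :
    shiftBy (k * w.length) (wordPow w) = wordPow w := by
  induction k with
  | zero => simp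
  | succ k ih => rw [Nat.succ_mul, ← shiftBy_shiftBy, ih, shiftBy_length_wordPow hw]

theorem shiftBy_wordPow (hw : w ≠ []) (n : ℕ) :
    shiftBy n (wordPow w) = w.drop (n % w.length) ⊹ wordPow w := by
  have h0 : 0 < w.length := List.length_pos_iff.2 hw
  conv_lhs => rw [← Nat.div_add_mod' n w.length, ← shiftBy_shiftBy, shiftBy_mul_wordPow hw,
    ← wordPow_eq hw]
  rw [shiftBy_append_of_le (Nat.mod_lt _ h0).le]

theorem forall_shift_wordPow {K : Seq → Prop} (hw : w ≠ [])
    (h : ∀ p y, w = p ++ y → y ≠ [] → K (y ⊹ wordPow w)) (n : ℕ) :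
    K (shiftBy n (wordPow w)) := by
  have h0 : 0 < w.length := List.length_pos_iff.2 hw
  rw [shiftBy_wordPow hw]
  refine h (w.take (n % w.length)) _ (List.take_append_drop _ w).symm ?_
  intro e
  have := congrArg List.length e
  have := Nat.mod_lt n h0
  simp at *; omega

theorem suffix_append_wordPow (hw : w ≠ []) (e : w = p ++ q) :
    q ⊹ wordPow w = shiftBy p.length (wordPow w) := by
  conv_rhs => rw [← wordPow_eq hw]
  subst e
  rw [shiftBy_append_append]

theorem wordPow_block {m : ℕ} (hm : 1 ≤ m) (h : shiftBy m x = x) : wordPow (block x 0 m) = x := by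
  symm
  apply eq_wordPow
  · intro e
    have := congrArg List.length e
    simp at this; omega
  · conv_rhs => rw [← h]
    have h2 := block_append_shiftBy x m
    rw [h]; rw [h] at h2; exact h2.symm

/-- If x first exceeded w^∞ at position n, then wx would still agree with w^∞ at n, since x is read
there only before n; so wx ≺ x. This replaces the infinite iteration x ≼ wx ≼ wwx ≼ … by one step.
-/
theorem le_wordPow_of_le_append (hw : w ≠ []) (h : x ≼ w ⊹ x) : x ≼ wordPow w := by
  have h0 : 0 < w.length := List.length_pos_iff.2 hw
  rw [← seq_not_lt]
  intro hl
  obtain ⟨n, h1, h2, h3⟩ := seqLT_iff.1 hl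
  refine h.not_lt (seqLT_iff.2 ⟨n, fun i hi => ?_, ?_, h3⟩)
  · rw [← h1 i hi, ← wordPow_eq hw]
    by_cases hi' : i < w.length
    · exact wordAppend_lt_congr hi'
    · rw [wordAppend_ge (by omega), wordAppend_ge (by omega)]
      exact (h1 _ (by omega)).symm
  · rw [← h2, ← wordPow_eq hw]
    by_cases hi' : n < w.length
    · exact wordAppend_lt_congr hi'
    · rw [wordAppend_ge (by omega), wordAppend_ge (by omega)]
      exact (h1 _ (by omega)).symm

theorem wordPow_le_of_append_le (hw : w ≠ []) (h : w ⊹ x ≼ x) : wordPow w ≼ x := by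
  have h0 : 0 < w.length := List.length_pos_iff.2 hw
  rw [← seq_not_lt]
  intro hl
  obtain ⟨n, h1, h2, h3⟩ := seqLT_iff.1 hl
  refine h.not_lt (seqLT_iff.2 ⟨n, fun i hi => ?_, h2, ?_⟩)
  · rw [h1 i hi, ← wordPow_eq hw]
    by_cases hi' : i < w.length
    · exact wordAppend_lt_congr hi'
    · rw [wordAppend_ge (by omega), wordAppend_ge (by omega)]
      exact (h1 _ (by omega)).symm
  · rw [← h3, ← wordPow_eq hw]
    by_cases hi' : n < w.length
    · exact wordAppend_lt_congr hi'
    · rw [wordAppend_ge (by omega), wordAppend_ge (by omega)]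
      exact h1 _ (by omega)

theorem append_le_of_le (hw : w ≠ []) (h : x ≼ wordPow w) : x ≼ w ⊹ x := by
  rw [← seq_not_lt]
  intro hl
  have := h.antisymm (wordPow_le_of_append_le hw hl.le)
  rw [this, wordPow_eq hw] at hl
  exact seqLT.irrefl _ hl

/-- With its mirror image `append_le_of_ge`, this is how bounds are propagated through
concatenations of blocks: only the periodic power of each block has to be compared with z. -/
theorem le_append_of_le (hw : w ≠ []) (h : z ≼ wordPow w) (hx : z ≼ x) : z ≼ w ⊹ x :=
  (append_le_of_le hw h).trans (append_le_append_iff.2 hx)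

theorem append_le_of_ge (hw : w ≠ []) (h : wordPow w ≼ z) (hx : x ≼ z) : w ⊹ x ≼ z := by
  refine (append_le_append_iff.2 hx).trans ?_
  rw [← seq_not_lt]
  intro hl
  have := h.antisymm (le_wordPow_of_le_append hw hl.le)
  rw [← this, wordPow_eq hw] at hl
  exact seqLT.irrefl _ hl

/-! ### Limits -/

theorem le_of_approx (h : ∀ N, ∃ r, z ≼ r ∧ ∀ i < N, r i = x i) : z ≼ x := by
  rw [← seq_not_lt]
  intro hl
  obtain ⟨n, h1, h2, h3⟩ := seqLT_iff.1 hl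
  obtain ⟨r, hr, h4⟩ := h (n + 1)
  exact hr.not_lt (seqLT_iff.2 ⟨n, fun i hi => by rw [h4 i (by omega), h1 i hi],
    by rw [h4 n (by omega), h2], h3⟩)

theorem approx_le (h : ∀ N, ∃ r, r ≼ z ∧ ∀ i < N, r i = x i) : x ≼ z := by
  rw [← seq_not_lt]
  intro hl
  obtain ⟨n, h1, h2, h3⟩ := seqLT_iff.1 hl
  obtain ⟨r, hr, h4⟩ := h (n + 1)
  exact hr.not_lt (seqLT_iff.2 ⟨n, fun i hi => by rw [h4 i (by omega), h1 i hi],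
    h2, by rw [h4 n (by omega), h3]⟩)

/-- If `x ≺ y`, then this is decided by finitely many digits. -/
theorem seqLT.exists_depth (h : x ≺ y) :
    ∃ N, ∀ x' y' : Seq, (∀ i < N, x' i = x i) → (∀ i < N, y' i = y i) → x' ≺ y' := by
  obtain ⟨n, h1, h2, h3⟩ := seqLT_iff.1 h
  refine ⟨n + 1, fun x' y' hx hy => seqLT_iff.2 ⟨n, fun i hi => ?_, ?_, ?_⟩⟩
  · rw [hx i (by omega), hy i (by omega), h1 i hi]
  · rw [hx n (by omega), h2]
  · rw [hy n (by omega), h3]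

/-- Peeling off nonempty words reaches depth N after finitely many steps; the rest is replaced by
`r₀`. For closed conditions such as z ≼ x this suffices. -/
theorem approx_coinduction {K P : Seq → Prop} (r₀ : Seq) (h₀ : K r₀)
    (hP : ∀ x, P x → K x ∨ ∃ w x', w ≠ [] ∧ x = w ⊹ x' ∧ P x' ∧ ∀ r, K r → K (w ⊹ r))
    (N : ℕ) : ∀ x, P x → ∃ r, K r ∧ ∀ i < N, r i = x i := by
  induction N using Nat.strong_induction_on with
  | _ N ih =>
    intro x hx
    rcases Nat.eq_zero_or_pos N with rfl | hN
    · exact ⟨r₀, h₀, fun i hi => absurd hi (by omega)⟩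
    rcases hP x hx with h | ⟨w, x', hw, rfl, hx', hK⟩
    · exact ⟨x, h, fun _ _ => rfl⟩
    · have h0 : 0 < w.length := List.length_pos_iff.2 hw
      obtain ⟨r, hr, h⟩ := ih (N - w.length) (by omega) x' hx'
      refine ⟨w ⊹ r, hK r hr, fun i hi => ?_⟩
      by_cases hi' : i < w.length
      · exact wordAppend_lt_congr hi'
      · rw [wordAppend_ge (by omega), wordAppend_ge (by omega)]
        exact h _ (by omega)

theorem le_coinduction {P : Seq → Prop}
    (hP : ∀ x, P x → z ≼ x ∨ ∃ w x', w ≠ [] ∧ x = w ⊹ x' ∧ P x' ∧ ∀ r, z ≼ r → z ≼ w ⊹ r)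
    (x : Seq) (hx : P x) : z ≼ x :=
  le_of_approx fun N => approx_coinduction (K := fun r => z ≼ r) z seqLE.rfl hP N x hx

theorem ge_coinduction {P : Seq → Prop}
    (hP : ∀ x, P x → x ≼ z ∨ ∃ w x', w ≠ [] ∧ x = w ⊹ x' ∧ P x' ∧ ∀ r, r ≼ z → w ⊹ r ≼ z)
    (x : Seq) (hx : P x) : x ≼ z :=
  approx_le fun N => approx_coinduction (K := fun r => r ≼ z) z seqLE.rfl hP N x hx

/-- If every shift of `x` is below `p1…`, then `x` is at most `(p0)^∞`. -/
theorem le_wordPow_of_forall_lt (h : ∀ n, shiftBy n x ≺ (p ++ [true]) ⊹ zeroSeq) (n : ℕ) :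
    shiftBy n x ≼ wordPow (p ++ [false]) := by
  refine ge_coinduction (P := fun y => ∃ n, y = shiftBy n x) ?_ _ ⟨n, rfl⟩
  rintro y ⟨n, rfl⟩
  rcases seq_le_or_lt ((p ++ [false]) ⊹ zeroSeq) (shiftBy n x) with h1 | h1
  · right
    rcases between h1 (h n).le with ⟨z', e, -⟩ | ⟨z', e, h2⟩
    · refine ⟨p ++ [false], z', by simp, e, ⟨n + (p ++ [false]).length, ?_⟩, fun r hr => ?_⟩
      · rw [← shiftBy_shiftBy, e, shiftBy_length_append]
      · exact append_le_of_ge (by simp) seqLE.rfl hr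
    · have h3 := h n
      rw [e, append_lt_append_iff] at h3
      exact absurd h3 (zeroSeq_le _).not_lt
  · left
    rw [← wordPow_eq (w := p ++ [false]) (by simp)]
    exact (h1.trans_le (append_le_append_iff.2 (zeroSeq_le _))).le

/-- The lexicographic infimum of a nonempty set. -/
theorem exists_lexInf (T : Set Seq) (hT : T.Nonempty) :
    ∃ y, (∀ t ∈ T, y ≼ t) ∧ ∀ N, ∃ t ∈ T, ∀ i < N, t i = y i := by
  classical
  -- Digits are chosen one by one: 0 whenever some element with the prefix chosen so far continues
  -- with 0.
  let step : Set Seq → ℕ → Set Seq := fun B n =>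
    if ∃ t ∈ B, t n = false then {t ∈ B | t n = false} else B
  let F : ℕ → Set Seq := fun n => Nat.rec (motive := fun _ => Set Seq) T (fun n B => step B n) n
  have hF : ∀ n, F (n + 1) = step (F n) n := fun n => rfl
  let y : Seq := fun n => if ∃ t ∈ F n, t n = false then false else true
  have hne : ∀ n, (F n).Nonempty := by
    intro n
    induction n with
    | zero => exact hT
    | succ n ih =>
      rw [hF]
      by_cases h : ∃ t ∈ F n, t n = false
      · simp only [step, if_pos h]
        obtain ⟨t, h1, h2⟩ := h
        exact ⟨t, h1, h2⟩
      · simp only [step, if_neg h]; exact ih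
  have hmem : ∀ n, F n = {t ∈ T | ∀ i < n, t i = y i} := by
    intro n
    induction n with
    | zero => ext t; simp [F]
    | succ n ih =>
      ext t
      rw [hF]
      by_cases h : ∃ t ∈ F n, t n = false
      · have hy : y n = false := by simp only [y, if_pos h]
        simp only [step, if_pos h, Set.mem_ofPred_eq]
        rw [ih]
        constructor
        · rintro ⟨⟨h1, h2⟩, h3⟩
          refine ⟨h1, fun i hi => ?_⟩
          rcases Nat.lt_succ_iff_lt_or_eq.1 hi with h4 | rfl
          · exact h2 i h4
          · rw [h3, hy]
        · rintro ⟨h1, h2⟩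
          exact ⟨⟨h1, fun i hi => h2 i (by omega)⟩, by rw [h2 n (by omega), hy]⟩
      · have hy : y n = true := by simp only [y, if_neg h]
        simp only [step, if_neg h]
        constructor
        · intro ht
          have ht' := ht
          rw [ih] at ht'
          refine ⟨ht'.1, fun i hi => ?_⟩
          rcases Nat.lt_succ_iff_lt_or_eq.1 hi with h4 | rfl
          · exact ht'.2 i h4
          · rw [hy]
            by_contra h5
            exact h ⟨t, ht, by simpa using h5⟩
        · rintro ⟨h1, h2⟩
          rw [ih]
          exact ⟨h1, fun i hi => h2 i (by omega)⟩
  refine ⟨y, fun t ht => ?_, fun N => ?_⟩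
  · rw [← seq_not_lt]
    intro hl
    obtain ⟨n, h1, h2, h3⟩ := seqLT_iff.1 hl
    have : t ∈ F n := by rw [hmem]; exact ⟨ht, h1⟩
    have h4 : y n = false := by simp only [y]; rw [if_pos ⟨t, this, h2⟩]
    rw [h4] at h3; cases h3
  · obtain ⟨t, ht⟩ := hne N
    rw [hmem] at ht
    exact ⟨t, ht.1, ht.2⟩

end words

/-! ### Lyndon words -/

section lyndon
variable {x y z D D' : Seq} {u v w p q l s : Word}

/-- Lyndon words in a form adapted to sequences: `w` is smaller than each of its proper suffixes
and none of these is a prefix of `w`. -/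
def SL (w : Word) : Prop := w ≠ [] ∧ ∀ p y, w = p ++ y → p ≠ [] → y ≠ [] → Below w y

theorem SL.le_suffix (h : SL l) (e : l = p ++ s) (hs : s ≠ []) : l ⊹ x ≼ s ⊹ x := by
  by_cases hp : p = []
  · subst hp; rw [e]; exact seqLE.rfl
  · exact (h.2 p s e hp hs x x).le

theorem SL.le_suffix_append (h : SL l) (hz : z ≼ wordPow l) (hx : z ≼ x) (e : l = p ++ s)
    (hs : s ≠ []) : z ≼ s ⊹ x :=
  (le_append_of_le h.1 hz hx).trans (h.le_suffix e hs)

theorem SL.le_shiftBy (h : SL l) (n : ℕ) : wordPow l ≼ shiftBy n (wordPow l) :=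
  forall_shift_wordPow (K := fun t => wordPow l ≼ t) h.1
    (fun _ _ e hy => h.le_suffix_append seqLE.rfl seqLE.rfl e hy) n

theorem Below.wordPow_lt (hu : u ≠ []) (hv : v ≠ []) (h : Below u v) : wordPow u ≺ wordPow v := by
  rw [← wordPow_eq hu, ← wordPow_eq hv]; exact h _ _

/-- A word followed by a sequence below a shift-minimal sequence. -/
theorem wordPow_le_of_append_le_min (hz : ∀ n, z ≼ shiftBy n z) (hw : w ≠ []) (h : w ⊹ x ≼ z) :
    wordPow w ≼ z := by
  obtain ⟨q, z', hq, e⟩ := exists_eq_append z w.length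
  have h' := h
  rw [e] at h'
  rcases below_of_le hq.symm h' with h1 | ⟨rfl, -⟩
  · rw [e, ← wordPow_eq hw]; exact (h1 _ _).le
  · have h2 := hz w.length
    conv_rhs at h2 => rw [e, shiftBy_length_append]
    apply wordPow_le_of_append_le hw
    conv_rhs => rw [e]
    exact append_le_append_iff.2 h2

/-- The first return of a sequence below itself gives a Lyndon word. -/
theorem SL_of_return (hv : v ≠ []) (hD : D = v ⊹ D') (h1 : D' ≼ D)
    (h2 : ∀ i, 1 ≤ i → i < v.length → D ≺ shiftBy i D) : SL v := by
  refine ⟨hv, fun p y e hp hy => ?_⟩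
  have hp' : 0 < p.length := List.length_pos_iff.2 hp
  have hy' : 0 < y.length := List.length_pos_iff.2 hy
  have hl : v.length = p.length + y.length := by rw [e]; simp
  have h3 := h2 p.length (by omega) (by omega)
  have h4 : shiftBy p.length D = y ⊹ D' := by
    rw [hD]; conv_lhs => rw [e]
    rw [shiftBy_append_append]
  rw [h4] at h3
  have hv2 : v = v.take y.length ++ v.drop y.length := (List.take_append_drop _ _).symm
  have h5 : D = v.take y.length ⊹ v.drop y.length ⊹ D' := by
    rw [← append_wordAppend, ← hv2, ← hD]
  have hlt : (v.take y.length).length = y.length := by simp; omega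
  conv_lhs at h3 => rw [h5]
  rcases below_of_lt hlt h3 with h6 | ⟨-, h6⟩
  · rw [hv2]
    have := h6.append (v.drop y.length) []
    simpa using this
  -- If y is a border of v, the tail of D after y lies below D' ≼ D, although proper shifts inside v
  -- lie above D.
  · exfalso
    have h7 := h2 y.length (by omega) (by omega)
    have h8 : shiftBy y.length D = v.drop y.length ⊹ D' := by
      conv_lhs => rw [h5]
      conv_lhs => arg 1; rw [← hlt]
      rw [shiftBy_length_append]
    rw [h8] at h7
    exact seqLT.irrefl _ ((h7.trans h6).trans_le h1)

/-- A shift-minimal periodic sequence is a power of a Lyndon word. -/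
theorem exists_SL_of_periodic (hx : ∀ n, x ≼ shiftBy n x) (hper : ∃ m, 1 ≤ m ∧ shiftBy m x = x) :
    ∃ w, SL w ∧ x = wordPow w := by
  classical
  have hm := Nat.find_spec hper
  set m := Nat.find hper with hmdef
  have hb : block x 0 m ≠ [] := by
    intro e
    have := congrArg List.length e
    simp at this; omega
  have e := wordPow_block hm.1 hm.2
  refine ⟨block x 0 m, SL_of_return (D := x) (D' := x) hb ?_ seqLE.rfl ?_, e.symm⟩
  · have h3 := wordPow_eq hb
    rw [e] at h3
    exact h3.symm
  · intro i h1 h2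
    refine (hx i).lt_of_ne fun h3 => ?_
    simp only [length_block] at h2
    exact Nat.find_min hper h2 ⟨h1, h3.symm⟩

theorem below_of_digits {i L k : ℕ} (hk : i + k < L) (h1 : ∀ t < k, x t = x (i + t))
    (h2 : x k = false) (h3 : x (i + k) = true) (e : block x 0 L = p ++ s) (hp : p.length = i) :
    Below (block x 0 L) s := by
  have hl : L = p.length + s.length := by
    have := congrArg List.length e
    simpa using this
  have hs : s = block x i (L - i) := by
    have h4 : block x 0 L = block x 0 i ++ block x i (L - i) := by
      have := block_add x 0 i (L - i)
      rw [Nat.add_sub_cancel' (by omega)] at this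
      simpa using this
    rw [h4] at e
    exact ((List.append_inj e (by simp [hp])).2).symm
  have key : ∀ (j n t : ℕ) (a : Seq), t < n → (block x j n ⊹ a) t = x (j + t) := by
    intro j n t a ht
    rw [wordAppend_lt (by simpa using ht)]
    simp [block, List.getD, ht]
  intro a b
  rw [hs]
  refine seqLT_iff.2 ⟨k, fun t ht => ?_, ?_, ?_⟩
  · rw [key _ _ _ _ (by omega), key _ _ _ _ (by omega), Nat.zero_add]; exact h1 t ht
  · rw [key _ _ _ _ (by omega), Nat.zero_add]; exact h2
  · rw [key _ _ _ _ (by omega)]; exact h3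

/-- A sequence smaller than all its proper shifts has arbitrarily long Lyndon prefixes. -/
theorem exists_SL_initial (hx : ∀ n, 1 ≤ n → x ≺ shiftBy n x) (N : ℕ) :
    ∃ L, N ≤ L ∧ SL (block x 0 L) := by
  have hx' : ∀ n, ∃ k, 1 ≤ n → (∀ t < k, x t = x (n + t)) ∧ x k = false ∧ x (n + k) = true := by
    intro n
    by_cases hn : 1 ≤ n
    · obtain ⟨k, hk⟩ := seqLT_iff.1 (hx n hn)
      exact ⟨k, fun _ => hk⟩
    · exact ⟨0, fun h => absurd h hn⟩
  choose e he using hx'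
  -- Here `e n` is the index at which σⁿx first exceeds x, a comparison using digits up to n + `e
  -- n`. The prefix is cut just after the largest such position for n ≤ N + 1.
  obtain ⟨m, hm, hmax⟩ := Finset.exists_max_image (Finset.Icc 1 (N + 1)) (fun i => i + e i)
    ⟨1, by simp⟩
  rw [Finset.mem_Icc] at hm
  obtain ⟨g1, g2, g3⟩ := he m hm.1
  have hN := hmax (N + 1) (by simp)
  refine ⟨m + e m + 1, by omega, ?_, ?_⟩
  · intro h
    have := congrArg List.length h
    simp at this
  intro p y hpy hp hy
  have hp' : 0 < p.length := List.length_pos_iff.2 hp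
  have hy' : 0 < y.length := List.length_pos_iff.2 hy
  have hl : m + e m + 1 = p.length + y.length := by
    have := congrArg List.length hpy
    simpa using this
  rcases le_or_gt p.length (N + 1) with h | h
  · have := hmax p.length (by rw [Finset.mem_Icc]; omega)
    obtain ⟨f1, f2, f3⟩ := he p.length hp'
    exact below_of_digits (by omega) f1 f2 f3 hpy rfl
  -- A suffix starting beyond N + 1 lies inside the copy of x that begins at m. It is decided as for
  -- σ^i x, or at the very last digit, which is 1 where the copied digit of x is 0.
  · obtain ⟨i, hi⟩ : ∃ i, p.length = m + i := ⟨p.length - m, by omega⟩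
    have hi1 : 1 ≤ i := by omega
    obtain ⟨f1, f2, f3⟩ := he i hi1
    have hie : i ≤ e m := by omega
    rcases lt_or_ge (i + e i) (e m) with h5 | h5
    · refine below_of_digits (k := e i) (by omega) (fun t ht => ?_) f2 ?_ hpy hi
      · rw [f1 t ht, g1 _ (by omega)]; congr 1; omega
      · rw [← f3, g1 _ h5]; congr 1; omega
    · refine below_of_digits (k := e m - i) (by omega) (fun t ht => ?_) ?_ ?_ hpy hi
      · rw [f1 t (by omega), g1 _ (by omega)]; congr 1; omega
      · rcases Nat.lt_or_ge (e m - i) (e i) with h6 | h6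
        · rw [f1 _ h6, Nat.add_sub_cancel' hie]; exact g2
        · rw [show e m - i = e i by omega]; exact f2
      · rw [← g3]; congr 1; omega

/-- All suffixes reduce to the comparison of uv with v: suffixes of v are not below v, and proper
suffixes of u already exceed u. When one of u, v is a prefix of the other, the Lyndon property of
the longer word decides. -/
theorem append_SL (hu : SL u) (hv : SL v) (h : wordPow u ≺ wordPow v) :
    SL (u ++ v) ∧ Below (u ++ v) v := by
  have hb : Below (u ++ v) v := by
    rcases le_or_gt u.length v.length with hl | hl
    · have hv2 : v = v.take u.length ++ v.drop u.length := (List.take_append_drop _ _).symm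
      rcases below_trichotomy (u := u) (v := v.take u.length) (by simp [hl]) with h1 | h1 | h1
      · have := h1.append v (v.drop u.length)
        rwa [← hv2] at this
      · by_cases h2 : v.drop u.length = []
        · rw [h2, ← h1, List.append_nil] at hv2
          rw [hv2] at h; exact absurd h (seqLT.irrefl _)
        · rw [← h1] at hv2
          have h3 := hv.2 _ _ hv2 hu.1 h2
          have h4 := h3.append_left u
          rwa [← hv2] at h4
      · exfalso
        have h2 := h1.append (v.drop u.length) []
        rw [← hv2, List.append_nil] at h2
        exact seqLT.irrefl _ (h.trans (h2.wordPow_lt hv.1 hu.1))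
    · have hu2 : u = u.take v.length ++ u.drop v.length := (List.take_append_drop _ _).symm
      rcases below_trichotomy (u := u.take v.length) (v := v) (by simp; omega) with h1 | h1 | h1
      · have := h1.append (u.drop v.length ++ v) []
        rwa [← List.append_assoc, ← hu2, List.append_nil] at this
      · exfalso
        have h2 : u.drop v.length ≠ [] := by
          intro e
          have := congrArg List.length e
          simp at this; omega
        rw [h1] at hu2
        have h3 := hu.2 _ _ hu2 hv.1 h2
        have h4 : wordPow v ≼ wordPow u := by
          apply wordPow_le_of_append_le hv.1
          have h5 : wordPow u = v ⊹ u.drop v.length ⊹ wordPow u := by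
            rw [← append_wordAppend, ← hu2, wordPow_eq hu.1]
          conv_rhs => rw [h5]
          rw [append_le_append_iff]
          conv_lhs => rw [← wordPow_eq hu.1]
          exact (h3 _ _).le
        exact h.not_le h4
      · exfalso
        have h2 := h1.append [] (u.drop v.length)
        rw [← hu2, List.append_nil] at h2
        exact seqLT.irrefl _ (h.trans (h2.wordPow_lt hv.1 hu.1))
  refine ⟨⟨by simp [hu.1], fun p y e hp hy => ?_⟩, hb⟩
  rcases List.append_eq_append_iff.1 e with ⟨t, h1, h2⟩ | ⟨t, h1, h2⟩
  · subst h1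
    by_cases ht : t = []
    · subst ht
      rw [List.nil_append] at h2
      rw [← h2]; exact hb
    · exact hb.trans (hv.2 t y h2 ht hy)
  · subst h2
    by_cases ht : t = []
    · subst ht
      simpa using hb
    · have := (hu.2 p t h1 hp ht).append v v
      exact this

theorem wordPow_lt_append (hu : SL u) (hv : SL v) (h : wordPow u ≺ wordPow v) :
    wordPow u ≺ wordPow (u ++ v) := by
  have hb := (append_SL hu hv h).2
  have hne : u ++ v ≠ [] := by simp [hu.1]
  have e : wordPow (u ++ v) = u ⊹ v ⊹ wordPow (u ++ v) := by
    rw [← append_wordAppend, wordPow_eq hne]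
  have h1 : u ⊹ wordPow (u ++ v) ≺ wordPow (u ++ v) := by
    conv_rhs => rw [e]
    rw [append_lt_append_iff]
    conv_lhs => rw [← wordPow_eq hne]
    exact hb _ _
  refine (wordPow_le_of_append_le hu.1 h1.le).lt_of_ne fun h2 => ?_
  rw [← h2, wordPow_eq hu.1] at h1
  exact seqLT.irrefl _ h1

/-! ### Comparison with the order of lists -/

theorem below_of_list_lt : ∀ {u v : Word}, u.length = v.length → u < v → Below u v
  | [], [], _, h => absurd h (by simp)
  | [], _ :: _, h, _ => by simp at h
  | _ :: _, [], h, _ => by simp at h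
  | a :: u, b :: v, hl, h => by
    rw [List.cons_lt_cons_iff] at h
    rcases h with h | ⟨rfl, h⟩
    · obtain ⟨rfl, rfl⟩ := Bool.lt_iff.1 h
      exact below_cons u v
    · exact (below_of_list_lt (by simpa using hl) h).append_left [a]

theorem list_lt_of_below (hl : u.length = v.length) (h : Below u v) : u < v := by
  rcases lt_trichotomy u v with h1 | h1 | h1
  · exact h1
  · subst h1; exact absurd h (Below.irrefl _)
  · exact absurd (below_of_list_lt hl.symm h1) fun h2 => h.asymm h2

/-- Only a border needs an argument. If w = py = ys, minimality against the rotation yp puts s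
before p, while minimality against sy puts p before s. -/
theorem IsLyndon.SL (h : IsLyndon w) : SL w := by
  refine ⟨h.1, fun p y e hp hy => ?_⟩
  have hp' : 0 < p.length := List.length_pos_iff.2 hp
  have hy' : 0 < y.length := List.length_pos_iff.2 hy
  have hl : w.length = p.length + y.length := by rw [e]; simp
  have hr : w.rotate p.length = y ++ p := by rw [e]; simp
  have h1 := h.2 p.length hp' (by omega)
  rw [hr] at h1
  have h1' := below_of_list_lt (by simp; omega) h1
  have hw2 : w = w.take y.length ++ w.drop y.length := (List.take_append_drop _ _).symm
  have ht : (w.take y.length).length = y.length := by simp; omega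
  rcases below_trichotomy ht with h2 | h2 | h2
  · have := h2.append (w.drop y.length) []
    rwa [← hw2, List.append_nil] at this
  · exfalso
    have h3 := h.2 y.length hy' (by omega)
    have hr2 : w.rotate y.length = w.drop y.length ++ y := by
      rw [List.rotate_eq_drop_append_take (by omega), h2]
    rw [hr2] at h3
    have h3' := below_of_list_lt (by simp; omega) h3
    rw [h2] at hw2
    have h4 := h1' zeroSeq zeroSeq
    rw [hw2] at h4
    simp only [append_wordAppend, append_lt_append_iff] at h4
    have hd : (w.drop y.length).length = p.length := by simp; omega
    rcases below_of_lt hd h4 with h5 | ⟨-, h5⟩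
    · have h6 := h5.append y y
      rw [← e] at h6
      exact h6.asymm h3'
    · exact seqLT.irrefl _ h5
  · have := h2.append p (w.drop y.length)
    rw [← hw2] at this
    exact absurd h1' fun h3 => h3.asymm this

theorem SL.isLyndon (h : SL w) : IsLyndon w := by
  refine ⟨h.1, fun i h1 h2 => ?_⟩
  apply list_lt_of_below (by simp)
  rw [List.rotate_eq_drop_append_take h2.le]
  have h3 := h.2 (w.take i) (w.drop i) (List.take_append_drop i w).symm
    (by intro e; have := congrArg List.length e
        rw [List.length_take, List.length_nil] at this; omega)
    (by intro e; have := congrArg List.length e; simp at this; omega)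
  have := h3.append [] (w.take i)
  rwa [List.append_nil] at this

end lyndon

/-! ### Expansions -/

section expansions
variable {β : ℝ} {x y z d : Seq}

theorem digit_le_one (d : Seq) (i : ℕ) : ((d i).toNat : ℝ) ≤ 1 := by
  exact_mod_cast Bool.toNat_le (d i)

theorem summable_geom (hβ : 1 < β) : Summable fun i : ℕ => 1 / β ^ (i + 1) := by
  have h := summable_geometric_of_lt_one (r := β⁻¹) (by positivity) (inv_lt_one_of_one_lt₀ hβ)
  have h2 := (summable_nat_add_iff 1).2 h
  refine h2.congr fun i => ?_
  rw [inv_pow, one_div]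

theorem summable_proj (hβ : 1 < β) (d : Seq) :
    Summable fun i : ℕ => ((d i).toNat : ℝ) / β ^ (i + 1) := by
  have hβ0 : 0 < β := by linarith
  refine Summable.of_nonneg_of_le (fun i => by positivity) (fun i => ?_) (summable_geom hβ)
  gcongr
  exact digit_le_one d i

theorem proj_succ (hβ : 1 < β) (d : Seq) :
    proj β d = ((d 0).toNat + proj β (shiftBy 1 d)) / β := by
  have hβ0 : β ≠ 0 := by linarith
  rw [proj, (summable_proj hβ d).tsum_eq_zero_add, proj, add_div, ← tsum_div_const]
  congr 1
  · simp
  · apply tsum_congr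
    intro i
    rw [shiftBy, add_comm 1 i, pow_succ β (i + 1), div_div]

theorem proj_nonneg (hβ : 1 < β) (d : Seq) : 0 ≤ proj β d := by
  have hβ0 : 0 < β := by linarith
  exact tsum_nonneg fun i => by positivity

theorem proj_le (hβ : 1 < β) (d : Seq) : proj β d ≤ proj β fun _ => true := by
  have hβ0 : 0 < β := by linarith
  refine (summable_proj hβ d).tsum_le_tsum (fun i => ?_) (summable_proj hβ _)
  gcongr
  exact Bool.toNat_le _

theorem proj_sub (hβ : 1 < β) (n : ℕ) : ∀ {x y : Seq}, (∀ i < n, x i = y i) →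
    proj β x - proj β y = (proj β (shiftBy n x) - proj β (shiftBy n y)) / β ^ n := by
  have hβ0 : β ≠ 0 := by linarith
  induction n with
  | zero => intro x y _; simp
  | succ n ih =>
    intro x y h
    rw [proj_succ hβ x, proj_succ hβ y, h 0 (by omega)]
    have := ih (x := shiftBy 1 x) (y := shiftBy 1 y) (fun i hi => h (1 + i) (by omega))
    rw [shiftBy_shiftBy, shiftBy_shiftBy, add_comm 1 n] at this
    rw [← sub_div, add_sub_add_left_eq_sub, this, pow_succ, div_div]

theorem proj_sub_of_digits (hβ : 1 < β) {n : ℕ} (h1 : ∀ i < n, x i = y i) (h2 : x n = false)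
    (h3 : y n = true) :
    proj β y - proj β x =
      (1 + proj β (shiftBy (n + 1) y) - proj β (shiftBy (n + 1) x)) / β ^ (n + 1) := by
  have hβ0 : β ≠ 0 := by linarith
  rw [proj_sub hβ n (fun i hi => (h1 i hi).symm), proj_succ hβ (shiftBy n y),
    proj_succ hβ (shiftBy n x), shiftBy_shiftBy, shiftBy_shiftBy]
  have e1 : shiftBy n x 0 = false := by simpa [shiftBy] using h2
  have e2 : shiftBy n y 0 = true := by simpa [shiftBy] using h3
  rw [e1, e2, ← sub_div, div_div, ← pow_succ']
  simp

theorem proj_pos (hβ : 1 < β) (h : d ≠ zeroSeq) : 0 < proj β d := by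
  have hβ0 : 0 < β := by linarith
  obtain ⟨i, hi⟩ := Function.ne_iff.1 h
  refine (summable_proj hβ d).tsum_pos (fun i => by positivity) i ?_
  have : d i = true := by simpa [zeroSeq] using hi
  rw [this]; simp; positivity

/-- The bounded solution of the recursion of the remainders is the expansion. -/
theorem proj_eq_of_rec (hβ : 1 < β) {r : ℕ → ℝ} {M : ℝ} (hr : ∀ n, |r n| ≤ M)
    (h : ∀ n, β * r n = (d n).toNat + r (n + 1)) (n : ℕ) : proj β (shiftBy n d) = r n := by
  have hβ0 : 0 < β := by linarith
  -- The error is bounded but multiplied by β > 1 at every step, so it vanishes.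
  set e : ℕ → ℝ := fun n => proj β (shiftBy n d) - r n with he
  have hrec : ∀ n, e (n + 1) = β * e n := by
    intro n
    have h1 := proj_succ hβ (shiftBy n d)
    rw [shiftBy_shiftBy] at h1
    have h2 : shiftBy n d 0 = d n := by simp [shiftBy]
    rw [h2, eq_div_iff hβ0.ne'] at h1
    simp only [he, mul_sub, h n]
    linarith
  have hpow : ∀ k, e (n + k) = β ^ k * e n := by
    intro k
    induction k with
    | zero => simp
    | succ k ih => rw [← add_assoc, hrec, ih, pow_succ]; ring
  have hbd : ∀ k, |e k| ≤ (proj β fun _ => true) + M := by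
    intro k
    refine (abs_sub _ _).trans (add_le_add ?_ (hr k))
    rw [abs_of_nonneg (proj_nonneg hβ _)]
    exact proj_le hβ _
  have : e n = 0 := by
    by_contra hne
    have hpos : 0 < |e n| := abs_pos.2 hne
    obtain ⟨k, hk⟩ := pow_unbounded_of_one_lt (((proj β fun _ => true) + M) / |e n|) hβ
    rw [div_lt_iff₀ hpos] at hk
    have h1 := hbd (n + k)
    rw [hpow, abs_mul, abs_of_pos (by positivity)] at h1
    linarith
  simp only [he] at this
  linarith

theorem IsLexGreatest.unique {A : Set Seq} (hx : IsLexGreatest A x) (hy : IsLexGreatest A y) :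
    x = y := seqLE.antisymm (hy.2 x hx.1) (hx.2 y hy.1)

theorem epsilon_eq {A : Set Seq} (hx : IsLexGreatest A x) :
    Classical.epsilon (IsLexGreatest A) = x :=
  (Classical.epsilon_spec (p := IsLexGreatest A) ⟨x, hx⟩).unique hx

/-! ### Quasi-greedy expansions of 1. -/

/-- The remainders of the quasi-greedy algorithm. -/
noncomputable def qgRem (β : ℝ) : ℕ → ℝ
  | 0 => 1
  | n + 1 => if 1 < β * qgRem β n then β * qgRem β n - 1 else β * qgRem β n

open Classical in
/-- The digits of the quasi-greedy algorithm. -/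
noncomputable def qgSeq (β : ℝ) : Seq := fun n => decide (1 < β * qgRem β n)

theorem qgRem_mem (hβ : 1 < β) (hβ2 : β ≤ 2) (n : ℕ) : 0 < qgRem β n ∧ qgRem β n ≤ 1 := by
  induction n with
  | zero => simp [qgRem]
  | succ n ih =>
    rw [qgRem]
    split_ifs with h
    · exact ⟨by linarith, by nlinarith⟩
    · exact ⟨by nlinarith, by linarith⟩

theorem proj_shiftBy_qgSeq (hβ : 1 < β) (hβ2 : β ≤ 2) (n : ℕ) :
    proj β (shiftBy n (qgSeq β)) = qgRem β n := by
  refine proj_eq_of_rec hβ (M := 1) (fun n => ?_) (fun n => ?_) n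
  · have := qgRem_mem hβ hβ2 n
    rw [abs_of_pos this.1]; exact this.2
  · rw [qgSeq, qgRem]
    split_ifs with h <;> simp [h]

/-- At the first difference y gains a full digit, which outweighs the remainder because remainders
are at most 1; the tail of y makes the gain strict. Hence the algorithm produces the largest
expansion of 1 not ending in 0^∞. -/
theorem proj_lt_of_lt_qgSeq (hβ : 1 < β) (hβ2 : β ≤ 2) (h : qgSeq β ≺ y)
    (hy : ∀ n, shiftBy n y ≠ zeroSeq) : 1 < proj β y := by
  obtain ⟨n, h1, h2, h3⟩ := seqLT_iff.1 h
  have h4 := proj_sub_of_digits hβ h1 h2 h3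
  have h5 := proj_shiftBy_qgSeq hβ hβ2 0
  rw [shiftBy_zero] at h5
  rw [proj_shiftBy_qgSeq hβ hβ2, h5] at h4
  have h6 := (qgRem_mem hβ hβ2 (n + 1)).2
  have h7 := proj_pos hβ (hy (n + 1))
  have hβ0 : 0 < β := by linarith
  have h8 : 0 < (1 + proj β (shiftBy (n + 1) y) - qgRem β (n + 1)) / β ^ (n + 1) :=
    div_pos (by linarith) (by positivity)
  have : qgRem β 0 = 1 := rfl
  linarith

theorem shiftBy_qgSeq_ne_zero (hβ : 1 < β) (hβ2 : β ≤ 2) (n : ℕ) :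
    shiftBy n (qgSeq β) ≠ zeroSeq := by
  intro h
  have h1 := proj_shiftBy_qgSeq hβ hβ2 n
  rw [h] at h1
  have h2 : proj β zeroSeq = 0 := by simp [proj, zeroSeq]
  have := (qgRem_mem hβ hβ2 n).1
  linarith

theorem quasiGreedy_eq (hβ : 1 < β) (hβ2 : β ≤ 2) : quasiGreedy β = qgSeq β := by
  apply epsilon_eq
  refine ⟨⟨?_, shiftBy_qgSeq_ne_zero hβ hβ2⟩, fun y hy => ?_⟩
  · have h5 := proj_shiftBy_qgSeq hβ hβ2 0
    rwa [shiftBy_zero] at h5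
  · rw [← seq_not_lt]
    intro h
    have := proj_lt_of_lt_qgSeq hβ hβ2 h hy.2
    have := hy.1
    linarith

theorem proj_quasiGreedy (hβ : 1 < β) (hβ2 : β ≤ 2) : proj β (quasiGreedy β) = 1 := by
  have h5 := proj_shiftBy_qgSeq hβ hβ2 0
  rw [shiftBy_zero] at h5
  rw [quasiGreedy_eq hβ hβ2, h5]; rfl

theorem proj_shiftBy_quasiGreedy (hβ : 1 < β) (hβ2 : β ≤ 2) (n : ℕ) :
    0 < proj β (shiftBy n (quasiGreedy β)) ∧ proj β (shiftBy n (quasiGreedy β)) ≤ 1 := by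
  rw [quasiGreedy_eq hβ hβ2, proj_shiftBy_qgSeq hβ hβ2]
  exact qgRem_mem hβ hβ2 n

theorem shiftBy_quasiGreedy_ne_zero (hβ : 1 < β) (hβ2 : β ≤ 2) (n : ℕ) :
    shiftBy n (quasiGreedy β) ≠ zeroSeq := by
  rw [quasiGreedy_eq hβ hβ2]; exact shiftBy_qgSeq_ne_zero hβ hβ2 n

theorem shiftBy_quasiGreedy_le (hβ : 1 < β) (hβ2 : β ≤ 2) (n : ℕ) :
    shiftBy n (quasiGreedy β) ≼ quasiGreedy β := by
  rw [← seq_not_lt]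
  intro h
  have h1 : ∀ m, shiftBy m (shiftBy n (quasiGreedy β)) ≠ zeroSeq := fun m => by
    rw [shiftBy_shiftBy]; exact shiftBy_quasiGreedy_ne_zero hβ hβ2 _
  rw [quasiGreedy_eq hβ hβ2] at h
  rw [quasiGreedy_eq hβ hβ2] at h1
  have h2 := proj_lt_of_lt_qgSeq hβ hβ2 h h1
  rw [proj_shiftBy_qgSeq hβ hβ2] at h2
  have := (qgRem_mem hβ hβ2 n).2
  linarith

/-- The remainder is the whole state of the algorithm, so a return to the remainder 1 restarts it.
-/
theorem eq_quasiGreedy_of_proj_eq_one (hβ : 1 < β) (hβ2 : β ≤ 2) {n : ℕ}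
    (h : proj β (shiftBy n (quasiGreedy β)) = 1) :
    shiftBy n (quasiGreedy β) = quasiGreedy β := by
  rw [quasiGreedy_eq hβ hβ2] at h ⊢
  rw [proj_shiftBy_qgSeq hβ hβ2] at h
  have h1 : ∀ k, qgRem β (n + k) = qgRem β k := by
    intro k
    induction k with
    | zero => simpa [qgRem] using h
    | succ k ih => rw [← add_assoc, qgRem, qgRem, ih]
  funext k
  simp only [shiftBy, qgSeq, h1]

/-- One step of the estimate `π(z) ≤ 1`. -/
theorem proj_step (hβ : 1 < β) (hβ2 : β ≤ 2) (h : z ≺ quasiGreedy β) :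
    ∃ n, proj β z - 1 < (proj β (shiftBy (n + 1) z) - 1) / β ^ (n + 1) := by
  have hβ0 : 0 < β := by linarith
  obtain ⟨n, h1, h2, h3⟩ := seqLT_iff.1 h
  have h4 := proj_sub_of_digits hβ h1 h2 h3
  rw [proj_quasiGreedy hβ hβ2] at h4
  have h5 := (proj_shiftBy_quasiGreedy hβ hβ2 (n + 1)).1
  refine ⟨n, ?_⟩
  rw [lt_div_iff₀ (by positivity)]
  rw [eq_div_iff (by positivity)] at h4
  linarith

/-- A positive excess over 1 would be multiplied by at least β when passing to a suitable shift,
again and again, whereas all values are bounded. -/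
theorem proj_le_one (hβ : 1 < β) (hβ2 : β ≤ 2) (h : ∀ n, shiftBy n z ≼ quasiGreedy β) :
    proj β z ≤ 1 := by
  have hβ0 : 0 < β := by linarith
  by_contra hlt
  push Not at hlt
  have key : ∀ k : ℕ, ∃ n, β ^ k * (proj β z - 1) ≤ proj β (shiftBy n z) - 1 := by
    intro k
    induction k with
    | zero => exact ⟨0, by simp⟩
    | succ k ih =>
      obtain ⟨n, hn⟩ := ih
      have hpos : 0 < β ^ k * (proj β z - 1) := mul_pos (by positivity) (by linarith)
      have hne : shiftBy n z ≠ quasiGreedy β := by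
        intro e
        rw [e, proj_quasiGreedy hβ hβ2] at hn
        linarith
      obtain ⟨m, hm⟩ := proj_step hβ hβ2 ((h n).lt_of_ne hne)
      rw [shiftBy_shiftBy, lt_div_iff₀ (by positivity)] at hm
      refine ⟨n + (m + 1), ?_⟩
      have h1 : β ≤ β ^ (m + 1) := le_self_pow₀ hβ.le (by omega)
      calc β ^ (k + 1) * (proj β z - 1) = (β ^ k * (proj β z - 1)) * β := by ring
        _ ≤ (proj β (shiftBy n z) - 1) * β ^ (m + 1) := by gcongr; linarith
        _ ≤ _ := hm.le
  obtain ⟨k, hk⟩ := pow_unbounded_of_one_lt ((proj β fun _ => true) / (proj β z - 1)) hβ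
  rw [div_lt_iff₀ (by linarith)] at hk
  obtain ⟨n, hn⟩ := key k
  have := proj_le hβ (shiftBy n z)
  linarith

/-! ### Admissible sequences and monotonicity of the projection. -/

/-- Sequences all of whose shifts are below the quasi-greedy expansion of `1`. -/
def Adm (β : ℝ) (z : Seq) : Prop := ∀ n, shiftBy n z ≺ quasiGreedy β

theorem Adm.shiftBy (h : Adm β z) (n : ℕ) : Adm β (shiftBy n z) := fun m => by
  rw [shiftBy_shiftBy]; exact h _

theorem Adm.proj_lt_one (hβ : 1 < β) (hβ2 : β ≤ 2) (h : Adm β z) : proj β z < 1 := by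
  have hβ0 : 0 < β := by linarith
  have h0 := h 0
  rw [shiftBy_zero] at h0
  obtain ⟨n, hn⟩ := proj_step hβ hβ2 h0
  have h1 := proj_le_one hβ hβ2 fun m => (h.shiftBy (n + 1) m).le
  have h2 : (proj β (BetaHole.shiftBy (n + 1) z) - 1) / β ^ (n + 1) ≤ 0 :=
    div_nonpos_of_nonpos_of_nonneg (by linarith) (by positivity)
  linarith

/-- Admissibility of the smaller sequence suffices: after the first difference its tail has value
below 1 and cannot make up for the missing digit. In particular an admissible sequence is the
largest expansion of its value. -/
theorem Adm.proj_lt_proj (hβ : 1 < β) (hβ2 : β ≤ 2) (h : Adm β z) (hy : z ≺ y) :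
    proj β z < proj β y := by
  have hβ0 : 0 < β := by linarith
  obtain ⟨n, h1, h2, h3⟩ := seqLT_iff.1 hy
  have h4 := proj_sub_of_digits hβ h1 h2 h3
  have h5 := (h.shiftBy (n + 1)).proj_lt_one hβ hβ2
  have h6 := proj_nonneg hβ (BetaHole.shiftBy (n + 1) y)
  have : 0 < proj β y - proj β z := by
    rw [h4]; exact div_pos (by linarith) (by positivity)
  linarith

theorem Adm.proj_le_proj_iff (hβ : 1 < β) (hβ2 : β ≤ 2) (hx : Adm β x) (hy : Adm β y) :
    proj β x ≤ proj β y ↔ x ≼ y := by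
  constructor
  · intro h
    rw [← seq_not_lt]
    intro hl
    have := hy.proj_lt_proj hβ hβ2 hl
    linarith
  · intro h
    rcases h.lt_or_eq with h1 | rfl
    · exact (hx.proj_lt_proj hβ hβ2 h1).le
    · exact le_rfl

theorem Adm.proj_lt_proj_iff (hβ : 1 < β) (hβ2 : β ≤ 2) (hx : Adm β x) (hy : Adm β y) :
    proj β x < proj β y ↔ x ≺ y := by
  rw [← not_le, hy.proj_le_proj_iff hβ hβ2 hx, seq_not_le]

theorem Adm.greedy_proj (hβ : 1 < β) (hβ2 : β ≤ 2) (h : Adm β z) : greedy β (proj β z) = z := by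
  apply epsilon_eq
  refine ⟨rfl, fun y hy => ?_⟩
  rw [← seq_not_lt]
  intro hl
  have := h.proj_lt_proj hβ hβ2 hl
  rw [Set.mem_ofPred_eq] at hy
  linarith

/-! ### Greedy expansions as itineraries. -/

open Classical in
/-- The digits produced by the orbit of `t` under the map `x ↦ β x mod 1`. -/
noncomputable def orbitSeq (β t : ℝ) : Seq := fun n => decide (1 ≤ β * (betaMap β)^[n] t)

theorem shiftBy_orbitSeq (β t : ℝ) (n : ℕ) :
    shiftBy n (orbitSeq β t) = orbitSeq β ((betaMap β)^[n] t) := by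
  funext i
  simp only [shiftBy, orbitSeq]
  rw [← Function.iterate_add_apply, add_comm]

theorem betaMap_iterate_mem {t : ℝ} (ht : t ∈ Set.Ico (0 : ℝ) 1) (n : ℕ) :
    (betaMap β)^[n] t ∈ Set.Ico (0 : ℝ) 1 := by
  cases n with
  | zero => exact ht
  | succ n =>
    rw [Function.iterate_succ_apply']
    exact ⟨Int.fract_nonneg _, Int.fract_lt_one _⟩

theorem proj_orbitSeq (hβ : 1 < β) (hβ2 : β ≤ 2) {t : ℝ} (ht : t ∈ Set.Ico (0 : ℝ) 1) :
    proj β (orbitSeq β t) = t := by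
  have h := proj_eq_of_rec hβ (d := orbitSeq β t) (r := fun n => (betaMap β)^[n] t) (M := 1)
    (fun n => ?_) (fun n => ?_) 0
  · simpa using h
  · have := betaMap_iterate_mem (β := β) ht n
    rw [abs_of_nonneg this.1]; exact this.2.le
  · obtain ⟨h1, h2⟩ := betaMap_iterate_mem (β := β) ht n
    simp only [Function.iterate_succ_apply', orbitSeq]
    set r := (betaMap β)^[n] t
    have h3 : 0 ≤ β * r := by positivity
    by_cases h : 1 ≤ β * r
    · have h4 : ⌊β * r⌋ = 1 := by
        rw [Int.floor_eq_iff]; push_cast; exact ⟨h, by nlinarith⟩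
      rw [betaMap, Int.fract, h4]; simp [h]
    · have h4 : ⌊β * r⌋ = 0 := by
        rw [Int.floor_eq_iff]; push_cast; exact ⟨h3, by linarith⟩
      rw [betaMap, Int.fract, h4]; simp [h]

theorem adm_orbitSeq (hβ : 1 < β) (hβ2 : β ≤ 2) {t : ℝ} (ht : t ∈ Set.Ico (0 : ℝ) 1) :
    Adm β (orbitSeq β t) := by
  have hβ0 : 0 < β := by linarith
  intro n
  rw [shiftBy_orbitSeq]
  have h0 := betaMap_iterate_mem (β := β) ht n
  generalize (betaMap β)^[n] t = r at h0
  have h1 := proj_orbitSeq hβ hβ2 h0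
  rw [← seq_not_le]
  intro hle
  rcases hle.lt_or_eq with h | h
  · obtain ⟨n, e1, e2, e3⟩ := seqLT_iff.1 h
    have h4 := proj_sub_of_digits hβ e1 e2 e3
    have h5 := (proj_shiftBy_quasiGreedy hβ hβ2 (n + 1)).2
    have h6 := proj_nonneg hβ (shiftBy (n + 1) (orbitSeq β r))
    have : 0 ≤ proj β (orbitSeq β r) - proj β (quasiGreedy β) := by
      rw [h4]; exact div_nonneg (by linarith) (by positivity)
    rw [h1, proj_quasiGreedy hβ hβ2] at this
    linarith [h0.2]
  · rw [← h, proj_quasiGreedy hβ hβ2] at h1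
    linarith [h0.2]

theorem greedy_eq_orbitSeq (hβ : 1 < β) (hβ2 : β ≤ 2) {t : ℝ} (ht : t ∈ Set.Ico (0 : ℝ) 1) :
    greedy β t = orbitSeq β t := by
  have := (adm_orbitSeq hβ hβ2 ht).greedy_proj hβ hβ2
  rwa [proj_orbitSeq hβ hβ2 ht] at this

theorem adm_greedy (hβ : 1 < β) (hβ2 : β ≤ 2) {t : ℝ} (ht : t ∈ Set.Ico (0 : ℝ) 1) :
    Adm β (greedy β t) := by
  rw [greedy_eq_orbitSeq hβ hβ2 ht]; exact adm_orbitSeq hβ hβ2 ht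

theorem proj_greedy (hβ : 1 < β) (hβ2 : β ≤ 2) {t : ℝ} (ht : t ∈ Set.Ico (0 : ℝ) 1) :
    proj β (greedy β t) = t := by
  rw [greedy_eq_orbitSeq hβ hβ2 ht]; exact proj_orbitSeq hβ hβ2 ht

/-- If α(γ) ≼ α(β), all shifts of α(γ) are bounded by α(β), so its value in base β is at most 1; but
it exceeds its value 1 in the larger base γ. -/
theorem quasiGreedy_lt (hβ : 1 < β) {γ : ℝ} (h : β < γ) (hγ2 : γ ≤ 2) :
    quasiGreedy β ≺ quasiGreedy γ := by
  have hβ0 : 0 < β := by linarith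
  have hγ : 1 < γ := by linarith
  rw [← seq_not_le]
  intro hle
  have h1 := proj_le_one hβ (by linarith) fun n =>
    (shiftBy_quasiGreedy_le hγ hγ2 n).trans hle
  have h2 := proj_quasiGreedy hγ hγ2
  have h3 : proj γ (quasiGreedy γ) < proj β (quasiGreedy γ) := by
    have hne := shiftBy_quasiGreedy_ne_zero hγ hγ2 0
    rw [shiftBy_zero] at hne
    obtain ⟨i, hi⟩ := Function.ne_iff.1 hne
    have hi' : quasiGreedy γ i = true := by simpa [zeroSeq] using hi
    refine (summable_proj hγ _).tsum_lt_tsum (i := i) (fun j => ?_) ?_ (summable_proj hβ _)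
    · gcongr
    · rw [hi']
      simp only [Bool.toNat_true, Nat.cast_one]
      gcongr
  linarith

/-- The greedy expansion of `1` if the quasi-greedy expansion is periodic. -/
theorem greedy_one_of_periodic (hβ : 1 < β) (hβ2 : β < 2)
    (hper : IsPurelyPeriodic (quasiGreedy β)) :
    ∃ p, quasiGreedy β = wordPow (p ++ [false]) ∧ greedy β 1 = (p ++ [true]) ⊹ zeroSeq ∧
      ∀ i, 1 ≤ i → i ≤ p.length → shiftBy i (quasiGreedy β) ≠ quasiGreedy β := by
  classical
  have hβ0 : 0 < β := by linarith
  have hm := Nat.find_spec hper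
  set m := Nat.find hper with hmdef
  have hmin : ∀ i, 1 ≤ i → i < m → shiftBy i (quasiGreedy β) ≠ quasiGreedy β :=
    fun i h1 h2 h3 => Nat.find_min hper h2 ⟨h1, h3⟩
  have hone := proj_quasiGreedy hβ hβ2.le
  have hrem := proj_shiftBy_quasiGreedy hβ hβ2.le
  have heq : ∀ n, proj β (shiftBy n (quasiGreedy β)) = 1 → _ :=
    fun n => eq_quasiGreedy_of_proj_eq_one (n := n) hβ hβ2.le
  set a := quasiGreedy β with ha
  have hpow := wordPow_block hm.1 hm.2
  obtain ⟨k, hk⟩ : ∃ k, m = k + 1 := ⟨m - 1, by omega⟩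
  rw [hk] at hm hpow
  -- A final digit 1 in the period would give β r = 2 for a remainder r ≤ 1, impossible for β < 2.
  have hlast : a k = false := by
    by_contra h
    have hak : a k = true := by simpa using h
    have h1 := proj_succ hβ (shiftBy k a)
    rw [shiftBy_shiftBy, hm.2, hone] at h1
    have h2 : shiftBy k a 0 = true := by simpa [shiftBy] using hak
    rw [h2, eq_div_iff hβ0.ne'] at h1
    have h3 := (hrem k).2
    simp only [Bool.toNat_true, Nat.cast_one] at h1
    nlinarith
  have hblock : block a 0 (k + 1) = block a 0 k ++ [false] := by
    rw [block_add]; simp [block, hlast]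
  refine ⟨block a 0 k, by rw [← hblock, hpow], ?_, fun i h1 h2 => hmin i h1 (by
    rw [length_block] at h2; omega)⟩
  set c : Seq := (block a 0 k ++ [true]) ⊹ zeroSeq with hc
  have hca : ∀ i < k, c i = a i := by
    intro i hi
    rw [hc, append_wordAppend, wordAppend_lt (by simpa using hi)]
    simp [block, List.getD, hi]
  have hck : c k = true := by
    rw [hc, append_wordAppend, wordAppend_ge (by simp)]
    simp [wordAppend]
  have hcs : ∀ i, k < i → shiftBy i c = zeroSeq := by
    intro i hi
    rw [hc, shiftBy_append_of_ge (by simp; omega)]; rfl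
  have hzero : proj β zeroSeq = 0 := by simp [proj, zeroSeq]
  have hprojc : proj β c = 1 := by
    have h1 := proj_sub_of_digits hβ (fun i hi => (hca i hi).symm) hlast hck
    rw [hcs _ (by omega), hm.2, hone, hzero] at h1
    norm_num at h1
    linarith
  apply epsilon_eq
  refine ⟨hprojc, fun y hy => ?_⟩
  rw [Set.mem_ofPred_eq] at hy
  rw [← seq_not_lt]
  intro hl
  obtain ⟨i, h1, h2, h3⟩ := seqLT_iff.1 hl
  have hnn := proj_nonneg hβ (shiftBy (i + 1) y)
  rcases lt_trichotomy i k with h | rfl | h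
  · have h4 := proj_sub_of_digits hβ (x := a) (fun j hj => by rw [← hca j (by omega), h1 j hj])
      (by rw [← hca i h, h2]) h3
    rw [hy, hone, sub_self, eq_comm, div_eq_zero_iff] at h4
    rcases h4 with h4 | h4
    · have h5 := (hrem (i + 1)).2
      exact hmin (i + 1) (by omega) (by omega) (heq _ (by linarith))
    · exact absurd h4 (by positivity)
  · rw [hck] at h2; cases h2
  · have h4 := proj_sub_of_digits hβ h1 h2 h3
    rw [hy, hprojc, hcs _ (by omega), hzero, sub_self, eq_comm, div_eq_zero_iff] at h4
    rcases h4 with h4 | h4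
    · linarith
    · exact absurd h4 (by positivity)

end expansions

/-! ### Farey words -/

/-- Neighbouring Farey words. -/
inductive FareyPair : Word → Word → Prop
  | base : FareyPair [false] [true]
  | left {u v : Word} : FareyPair u v → FareyPair u (u ++ v)
  | right {u v : Word} : FareyPair u v → FareyPair (u ++ v) v

theorem fareyInsert_cons (b : Word) (l : List Word) : ∃ l', fareyInsert (b :: l) = b :: l' := by
  cases l with
  | nil => exact ⟨[], rfl⟩
  | cons c l => exact ⟨_, rfl⟩

theorem isChain_fareyInsert : ∀ l : List Word, l.IsChain FareyPair →
    (fareyInsert l).IsChain FareyPair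
  | [], _ => by simp [fareyInsert]
  | [a], _ => by simp [fareyInsert]
  | a :: b :: l, h => by
    rw [List.isChain_cons_cons] at h
    have ih := isChain_fareyInsert (b :: l) h.2
    obtain ⟨l', hl'⟩ := fareyInsert_cons b l
    rw [fareyInsert]
    rw [hl'] at ih ⊢
    rw [List.isChain_cons_cons, List.isChain_cons_cons]
    exact ⟨h.1.left, h.1.right, ih⟩

theorem isChain_fareyList (n : ℕ) : (fareyList n).IsChain FareyPair := by
  induction n with
  | zero => simp [fareyList, FareyPair.base]
  | succ n ih => exact isChain_fareyInsert _ ih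

theorem mem_fareyInsert : ∀ l : List Word, l.IsChain FareyPair → ∀ s ∈ fareyInsert l,
    s ∈ l ∨ ∃ u v, FareyPair u v ∧ s = u ++ v
  | [], _, s, hs => by simp [fareyInsert] at hs
  | [a], _, s, hs => by left; simpa [fareyInsert] using hs
  | a :: b :: l, h, s, hs => by
    rw [List.isChain_cons_cons] at h
    rw [fareyInsert, List.mem_cons, List.mem_cons] at hs
    rcases hs with rfl | rfl | hs
    · left; simp
    · right; exact ⟨a, b, h.1, rfl⟩
    · rcases mem_fareyInsert (b :: l) h.2 s hs with h1 | h1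
      · left; exact List.mem_cons_of_mem _ h1
      · exact Or.inr h1

theorem IsFarey.exists_pair {S : Word} (hS : IsFarey S) : ∃ u v, FareyPair u v ∧ S = u ++ v := by
  obtain ⟨⟨n, hn⟩, h2⟩ := hS
  induction n with
  | zero =>
    simp only [fareyList, List.mem_cons, List.not_mem_nil, or_false] at hn
    rcases hn with rfl | rfl <;> simp at h2
  | succ n ih =>
    rcases mem_fareyInsert _ (isChain_fareyList n) S hn with h | h
    · exact ih h
    · exact h

/-! ### Exchange of the two digits and the largest rotation of a Farey word. -/

/-- The complementary word. -/
def compl (w : Word) : Word := w.map not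

/-- The complementary sequence. -/
def complSeq (x : Seq) : Seq := fun i => !x i

theorem complSeq_append (w : Word) (x : Seq) : complSeq (w ⊹ x) = compl w ⊹ complSeq x := by
  funext i
  by_cases h : i < w.length
  · rw [complSeq, wordAppend_lt h, wordAppend_lt (by simpa [compl] using h)]
    simp [compl, List.getD, h]
  · rw [complSeq, wordAppend_ge (by omega), wordAppend_ge (by simpa [compl] using h)]
    simp [compl, complSeq]

theorem complSeq_complSeq (x : Seq) : complSeq (complSeq x) = x := by
  funext i; simp [complSeq]

theorem compl_compl (w : Word) : compl (compl w) = w := by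
  simp [compl, Function.comp_def]

theorem complSeq_lt {x y : Seq} (h : x ≺ y) : complSeq y ≺ complSeq x := by
  obtain ⟨n, h1, h2, h3⟩ := seqLT_iff.1 h
  exact seqLT_iff.2 ⟨n, fun i hi => by simp [complSeq, h1 i hi], by simp [complSeq, h3],
    by simp [complSeq, h2]⟩

theorem Below.compl {u v : Word} (h : Below u v) : Below (compl v) (compl u) := fun a b => by
  have := complSeq_lt (h (complSeq b) (complSeq a))
  rwa [complSeq_append, complSeq_append, complSeq_complSeq, complSeq_complSeq] at this

theorem SL_singleton (b : Bool) : SL [b] := by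
  refine ⟨by simp, fun p y e hp hy => ?_⟩
  have := congrArg List.length e
  have h1 := List.length_pos_iff.2 hp
  have h2 := List.length_pos_iff.2 hy
  simp at this; omega

/-- The combinatorial properties of neighbouring Farey words `u = 0u₁` and `v = v₁1`. -/
def FareyInv (u v : Word) : Prop :=
  ∃ u₁ v₁ lu lv : Word, u = false :: u₁ ∧ v = v₁ ++ [true] ∧
    u ++ v = v₁ ++ [false] ++ (true :: u₁) ∧
    lv ++ (lu ++ [false]) = (true :: u₁) ++ (v₁ ++ [false]) ∧ lu ++ [true] = true :: u₁ ∧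
    SL u ∧ SL v ∧ wordPow u ≺ wordPow v ∧ SL (compl (lu ++ [false])) ∧ SL (compl lv) ∧
    wordPow (compl lv) ≺ wordPow (compl (lu ++ [false]))

/-- The invariant is chosen so as to survive both replacements of a pair (u, v), by (u, uv) and by
(uv, v). The identity uv = (v₁0)(1u₁) exhibits the conjugate (1u₁)(v₁0) of uv. Its second
factorization `lv` · (`lu` 0) is into words that are Lyndon after exchanging the digits, which will
make this conjugate the largest one. -/
theorem FareyPair.inv {u v : Word} (h : FareyPair u v) : FareyInv u v := by
  induction h with
  | base =>
    have hlt : wordPow [false] ≺ wordPow [true] := by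
      have := (below_cons [] [])
      exact this.wordPow_lt (by simp) (by simp)
    exact ⟨[], [], [], [true], rfl, rfl, rfl, rfl, rfl, SL_singleton _, SL_singleton _, hlt,
      SL_singleton _, SL_singleton _, hlt⟩
  | @left u v _ ih =>
    obtain ⟨u₁, v₁, lu, lv, h1, h2, h3, h4, h5, h6, h7, h8, h9, h10, h11⟩ := ih
    have e1 : u ++ v₁ = v₁ ++ [false] ++ lu := by
      have : (u ++ v₁) ++ [true] = (v₁ ++ [false] ++ lu) ++ [true] := by
        rw [List.append_assoc _ lu, h5, ← h3, h2, List.append_assoc]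
      exact List.append_cancel_right this
    refine ⟨u₁, u ++ v₁, lu, lv ++ (lu ++ [false]), h1, by rw [h2, List.append_assoc], ?_, ?_, h5,
      h6, (append_SL h6 h7 h8).1, wordPow_lt_append h6 h7 h8, h9, ?_, ?_⟩
    · rw [h3]; simp
    · rw [h4]
      have := congrArg (fun t => t ++ [false]) e1
      simp only [List.append_assoc] at this ⊢
      rw [this]
    · rw [compl, List.map_append]; exact (append_SL h10 h9 h11).1
    · rw [compl, List.map_append]
      exact (append_SL h10 h9 h11).2.wordPow_lt (by simp) h9.1
  | @right u v _ ih =>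
    obtain ⟨u₁, v₁, lu, lv, h1, h2, h3, h4, h5, h6, h7, h8, h9, h10, h11⟩ := ih
    have e1 : lv ++ lu = (true :: u₁) ++ v₁ := by
      have : (lv ++ lu) ++ [false] = ((true :: u₁) ++ v₁) ++ [false] := by
        rw [List.append_assoc, h4, List.append_assoc]
      exact List.append_cancel_right this
    have e2 : lv ++ lu ++ [true] = true :: (u₁ ++ v) := by
      rw [e1, h2]; simp
    refine ⟨u₁ ++ v, v₁, lv ++ lu, lv, by rw [h1]; simp, h2, by rw [h3]; simp, ?_, e2,
      (append_SL h6 h7 h8).1, h7, (append_SL h6 h7 h8).2.wordPow_lt (by simp [h6.1]) h7.1,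
      ?_, h10, ?_⟩
    · rw [← e2, List.append_assoc _ lu, h4, List.append_assoc lv lu, h5]; simp
    · rw [List.append_assoc, compl, List.map_append]; exact (append_SL h10 h9 h11).1
    · rw [List.append_assoc]
      have := wordPow_lt_append h10 h9 h11
      rwa [compl, compl, ← List.map_append] at this

theorem foldr_max_eq {l : List Word} {a m : Word} (hm : m ∈ l) (h : ∀ x ∈ l, x ≤ m) (ha : a ≤ m) :
    l.foldr max a = m := by
  apply le_antisymm
  · clear hm
    induction l with
    | nil => exact ha
    | cons x l ih =>
      rw [List.foldr_cons]
      exact max_le (h x (by simp)) (ih fun y hy => h y (by simp [hy]))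
  · induction l with
    | nil => simp at hm
    | cons x l ih =>
      rw [List.foldr_cons]
      rcases List.mem_cons.1 hm with rfl | hm
      · exact le_max_left _ _
      · exact (ih hm fun y hy => h y (by simp [hy])).trans (le_max_right _ _)

/-- The facts about a Farey word `S = 0P1` that are used: its largest rotation is `1P0`, and
`S⁻ L(S)^∞ = U S^∞` for a Lyndon word `U`. -/
structure FareyData (S P U : Word) : Prop where
  eq : S = false :: P ++ [true]
  rot : largestRotation S = true :: P ++ [false]
  sl : SL S
  slU : SL U
  ltU : wordPow U ≺ wordPow S
  ltLen : U.length < S.length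
  shiftA : ∃ d, wordPow (true :: P ++ [false]) = shiftBy d (wordPow S)
  shiftS : ∃ d, wordPow S = shiftBy d (wordPow (true :: P ++ [false]))
  maxA : ∀ n, shiftBy n (wordPow (true :: P ++ [false])) ≼ wordPow (true :: P ++ [false])
  minusU : (false :: P ++ [false]) ⊹ wordPow (true :: P ++ [false]) = U ⊹ wordPow S

/-- For S = uv with u = 0u₁ and v = v₁1, take P = u₁v₁ and U = u. Exchanging the blocks v₁0 and 1u₁
turns S into 1P0, and 0P0(1P0)^∞ = u(v₁0)(1u₁v₁0)^∞ = uS^∞. -/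
theorem IsFarey.data {S : Word} (hS : IsFarey S) : ∃ P U, FareyData S P U := by
  obtain ⟨u, v, huv, rfl⟩ := hS.exists_pair
  obtain ⟨u₁, v₁, lu, lv, h1, h2, h3, h4, h5, h6, h7, h8, h9, h10, h11⟩ := huv.inv
  set A : Word := true :: (u₁ ++ v₁) ++ [false] with hA
  have hA1 : A = (true :: u₁) ++ (v₁ ++ [false]) := by simp [hA]
  have hSL : SL (compl A) := by
    rw [hA1, ← h4, compl, List.map_append]; exact (append_SL h10 h9 h11).1
  have hmax : ∀ p y, A = p ++ y → p ≠ [] → y ≠ [] → Below y A := by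
    intro p y e hp hy
    have := (hSL.2 (compl p) (compl y) (by rw [e, compl, List.map_append]; rfl)
      (by simpa [compl] using hp) (by simpa [compl] using hy)).compl
    rwa [compl_compl, compl_compl] at this
  have hA0 : A ≠ [] := by simp [hA]
  have eS : u ++ v = (v₁ ++ [false]) ++ (true :: u₁) := by rw [h3]
  refine ⟨u₁ ++ v₁, u, ?_, ?_, (append_SL h6 h7 h8).1, h6, wordPow_lt_append h6 h7 h8, ?_, ?_, ?_,
    ?_, ?_⟩
  · rw [h1, h2]; simp
  · rw [largestRotation]
    have hrot : A ~r (u ++ v) := ⟨(true :: u₁).length, by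
      rw [hA1, eS, List.rotate_append_length_eq]⟩
    have hle : ∀ x, x ~r (u ++ v) → x ≤ A := by
      intro x hx
      have hx' : A ~r x := hrot.trans hx.symm
      obtain ⟨n, hn, rfl⟩ := List.isRotated_iff_mod.1 hx'
      by_cases h0 : n = 0 ∨ n = A.length
      · rcases h0 with rfl | rfl <;> simp
      · apply le_of_lt
        apply list_lt_of_below (by simp)
        rw [List.rotate_eq_drop_append_take hn]
        have := (hmax (A.take n) (A.drop n) (List.take_append_drop n A).symm
          (by intro e; have := congrArg List.length e
              rw [List.length_take, List.length_nil] at this; omega)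
          (by intro e; have := congrArg List.length e
              rw [List.length_drop, List.length_nil] at this; omega)).append (A.take n) []
        rwa [List.append_nil] at this
    exact foldr_max_eq (List.mem_cyclicPermutations_iff.2 hrot)
      (fun x hx => hle x (List.mem_cyclicPermutations_iff.1 hx)) (hle _ (List.IsRotated.refl _))
  · have := List.length_pos_iff.2 h7.1
    simp; omega
  · refine ⟨(v₁ ++ [false]).length, ?_⟩
    rw [← hA, hA1, eS, ← wordPow_append_comm (u := true :: u₁) (by simp),
      suffix_append_wordPow (by simp) rfl]
  · refine ⟨(true :: u₁).length, ?_⟩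
    rw [← hA, hA1, eS, ← wordPow_append_comm (u := v₁ ++ [false]) (by simp),
      suffix_append_wordPow (by simp) rfl]
  · rw [← hA]
    refine forall_shift_wordPow (K := fun t => t ≼ wordPow A) hA0 fun p y e hy => ?_
    by_cases hp : p = []
    · subst hp
      rw [List.nil_append] at e
      rw [← e, wordPow_eq hA0]; exact seqLE.rfl
    · conv_rhs => rw [← wordPow_eq hA0]
      exact (hmax p y e hp hy _ _).le
  · rw [← hA, hA1, eS]
    rw [← wordPow_append_comm (u := v₁ ++ [false]) (by simp), ← append_wordAppend]
    rw [h1]; simp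

/-! ### The symbolic setting -/

/-- The word `L(S) = 1P0` for `S = 0P1`. -/
abbrev wA (P : Word) : Word := true :: P ++ [false]

/-- The word `L(S)⁺ = 1P1`. -/
abbrev wAp (P : Word) : Word := true :: P ++ [true]

/-- The word `S⁻ = 0P0`. -/
abbrev wSm (P : Word) : Word := false :: P ++ [false]

/-- The sequence `S⁻ L(S)^∞`. -/
def seqB (P : Word) : Seq := wSm P ⊹ wordPow (wA P)

/-- The sequences all of whose shifts lie between `y` and `a`. -/
def Surv (a y : Seq) : Set Seq := {z | ∀ n : ℕ, y ≼ shiftBy n z ∧ shiftBy n z ≼ a}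

theorem Surv.shiftBy {a y z : Seq} (h : z ∈ Surv a y) (n : ℕ) : shiftBy n z ∈ Surv a y :=
  fun m => by rw [shiftBy_shiftBy]; exact h _

theorem Surv.mono {a y y' : Seq} (h : y ≼ y') : Surv a y' ⊆ Surv a y :=
  fun _ hz n => ⟨h.trans (hz n).1, (hz n).2⟩

/-- The combinatorial situation for a base `β` in the basic interval of `S = 0P1`; here `a` is the
quasi-greedy expansion of `1` and `c` is the sequence used in the construction. -/
structure Setting (S P U : Word) (a c : Seq) : Prop where
  fd : FareyData S P U
  a_ne_zero : ∀ n, shiftBy n a ≠ zeroSeq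
  c_shift_lt : ∀ n, 1 ≤ n → shiftBy n c ≺ c
  c_cases : c = a ∨ ∃ p, a = wordPow (p ++ [false]) ∧ c = (p ++ [true]) ⊹ zeroSeq
  lt_a : wordPow (wA P) ≺ a
  a_lt : a ≺ wAp P ⊹ seqB P
  c_eq : c = wAp P ⊹ shiftBy S.length c
  c_lt : shiftBy S.length c ≺ seqB P

section setting
variable {S P U : Word} {a c x y z : Seq} {β βl βs : ℝ}

/-- Transfers an upper bound from a periodic α(β) = (p0)^∞ to the finite expansion p10^∞. If b lay
between them and began with p0, its tail would be ≼ b and so b ≼ (p0)^∞; if it began with p1, it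
would end in 0^∞. -/
theorem le_of_finite_case {p : Word} {b : Seq} (hb : ∀ n, shiftBy n b ≼ b)
    (hb0 : ∀ n, shiftBy n b ≠ zeroSeq) (h : wordPow (p ++ [false]) ≺ b) :
    (p ++ [true]) ⊹ zeroSeq ≺ b := by
  rw [← seq_not_le]
  intro hle
  have h' := h.le
  rw [← wordPow_eq (w := p ++ [false]) (by simp)] at h'
  rcases between h' hle with ⟨z, e, -⟩ | ⟨z, e, hz⟩
  · have h1 : b ≼ (p ++ [false]) ⊹ b := by
      conv_lhs => rw [e]
      rw [append_le_append_iff]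
      have := hb (p ++ [false]).length
      conv_lhs at this => rw [e, shiftBy_length_append]
      exact this
    exact h.not_le (le_wordPow_of_le_append (by simp) h1)
  · apply hb0 (p ++ [true]).length
    rw [e, shiftBy_length_append]
    exact hz.antisymm (zeroSeq_le _)

/-- A suffix t0 of the period is at most the prefix of the same length. Equality would force an
earlier return of the periodic sequence, excluded by minimality, so raising the last digit to t1 at
worst produces that prefix, followed by 0^∞ instead of a nonzero tail. -/
theorem shift_lt_of_finite_case {p : Word} (ha : ∀ n, shiftBy n (wordPow (p ++ [false])) ≼
    wordPow (p ++ [false]))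
    (hmin : ∀ i, 1 ≤ i → i ≤ p.length →
      shiftBy i (wordPow (p ++ [false])) ≠ wordPow (p ++ [false])) (n : ℕ) (hn : 1 ≤ n) :
    shiftBy n ((p ++ [true]) ⊹ zeroSeq) ≺ (p ++ [true]) ⊹ zeroSeq := by
  set a := wordPow (p ++ [false]) with hadef
  have hz : ∀ t : Word, zeroSeq ≺ (t ++ [true]) ⊹ zeroSeq := by
    intro t
    refine (zeroSeq_le _).lt_of_ne fun e => ?_
    have := congrFun e t.length
    rw [append_wordAppend, wordAppend_ge le_rfl] at this
    simp [zeroSeq, wordAppend] at this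
  rcases lt_or_ge p.length n with h | h
  · rw [shiftBy_append_of_ge (by simp; omega)]
    exact hz p
  · have ht : shiftBy n ((p ++ [true]) ⊹ zeroSeq) = (p.drop n ++ [true]) ⊹ zeroSeq := by
      rw [shiftBy_append_of_le (by simp; omega), List.drop_append_of_le_length h]
    have hta : shiftBy n a = (p.drop n ++ [false]) ⊹ a := by
      rw [hadef, ← wordPow_eq (w := p ++ [false]) (by simp), shiftBy_append_of_le (by simp; omega),
        List.drop_append_of_le_length h, wordPow_eq (by simp)]
    rw [ht]
    set t := p.drop n with htd
    have htl : t.length + 1 ≤ p.length := by simp [htd]; omega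
    set pre := p.take (t.length + 1) with hpre
    have hpl : pre.length = t.length + 1 := by simp [hpre]; omega
    have hp : p = pre ++ p.drop (t.length + 1) := (List.take_append_drop _ _).symm
    have hpa : a = pre ⊹ shiftBy (t.length + 1) a := by
      have hX : a = pre ⊹ (p.drop (t.length + 1) ++ [false]) ⊹ a := by
        rw [← append_wordAppend, ← List.append_assoc, ← hp]
        exact (wordPow_eq (by simp)).symm
      have h3 := congrArg (shiftBy pre.length) hX
      rw [shiftBy_length_append, hpl] at h3
      rw [h3]; exact hX
    have hle := ha n
    rw [hta] at hle
    conv_rhs at hle => rw [hpa]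
    have hc : (p ++ [true]) ⊹ zeroSeq = pre ⊹ (p.drop (t.length + 1) ++ [true]) ⊹ zeroSeq := by
      conv_lhs => rw [hp]
      simp only [append_wordAppend]
    rw [hc]
    rcases below_of_le (by simp [hpl]) hle with h1 | ⟨h1, h2⟩
    · rcases below_trichotomy (u := t ++ [true]) (v := pre) (by simp [hpl]) with h3 | h3 | h3
      · exact h3 _ _
      · rw [h3, append_lt_append_iff]; exact hz _
      · exfalso
        rcases below_concat_true hpl h3 with h4 | h4
        · exact h1.asymm h4
        · rw [h4] at h1; exact Below.irrefl _ h1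
    · exfalso
      have h3 := h2.antisymm (ha (t.length + 1))
      exact hmin _ (by omega) htl h3.symm

theorem wordMinus_concat (w : Word) (b : Bool) : wordMinus (w ++ [b]) = w ++ [false] := by
  simp [wordMinus]

theorem wordPlus_concat (w : Word) (b : Bool) : wordPlus (w ++ [b]) = w ++ [true] := by
  simp [wordPlus]

theorem FareyData.length (h : FareyData S P U) : S.length = P.length + 2 := by
  rw [h.eq]; simp

/-- The bounds A^∞ ≺ c ≺ 1P1 S⁻A^∞ force c to begin with 1P1: after a start 1P0 the tail would be ≼
c, whence c ≼ (1P0)^∞. -/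
theorem setting_of_basic (hS : IsFarey S) (hbasic : IsBasicInterval S βl βs)
    (hβ : β ∈ Set.Ioo βl βs) :
    1 < β ∧ β < 2 ∧ ∃ P U, Setting S P U (quasiGreedy β) (baseSeq β) := by
  obtain ⟨hl, hs, el, es⟩ := hbasic
  have h1 : 1 < β := hl.1.trans hβ.1
  have h2 : β < 2 := hβ.2.trans_le hs.2
  obtain ⟨P, U, fd⟩ := hS.data
  refine ⟨h1, h2, P, U, ?_⟩
  have ha0 := shiftBy_quasiGreedy_ne_zero h1 h2.le
  have hle := shiftBy_quasiGreedy_le h1 h2.le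
  have hlt1 := quasiGreedy_lt hl.1 hβ.1 h2.le
  have hlt2 := quasiGreedy_lt h1 hβ.2 hs.2
  have hs0 := shiftBy_quasiGreedy_ne_zero hs.1 hs.2
  have hsle := shiftBy_quasiGreedy_le hs.1 hs.2
  rw [el, fd.rot] at hlt1
  rw [fd.rot, wordPlus_concat, append_wordAppend] at es
  have es' : quasiGreedy βs = wAp P ⊹ seqB P := by
    rw [es, seqB]; congr 2
    conv_lhs => rw [fd.eq]
    exact wordMinus_concat _ _
  have hc : (∀ n, 1 ≤ n → shiftBy n (baseSeq β) ≺ baseSeq β) ∧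
      (baseSeq β = quasiGreedy β ∨ ∃ p, quasiGreedy β = wordPow (p ++ [false]) ∧
        baseSeq β = (p ++ [true]) ⊹ zeroSeq) ∧ quasiGreedy β ≼ baseSeq β ∧
      baseSeq β ≺ quasiGreedy βs := by
    by_cases hper : IsPurelyPeriodic (quasiGreedy β)
    · obtain ⟨p, e1, e2, e3⟩ := greedy_one_of_periodic h1 h2 hper
      have hb : baseSeq β = (p ++ [true]) ⊹ zeroSeq := by rw [baseSeq, if_pos hper, e2]
      rw [e1] at e3 hle hlt2
      rw [hb, e1]
      refine ⟨shift_lt_of_finite_case hle e3, Or.inr ⟨p, rfl, rfl⟩, ?_,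
        le_of_finite_case hsle hs0 hlt2⟩
      rw [← wordPow_eq (w := p ++ [false]) (by simp)]
      exact (below_concat p _ _).le
    · have hb : baseSeq β = quasiGreedy β := by rw [baseSeq, if_neg hper]
      rw [hb]
      exact ⟨fun n hn => (hle n).lt_of_ne fun e => hper ⟨n, hn, e⟩, Or.inl rfl, seqLE.rfl, hlt2⟩
  obtain ⟨c1, c2, c3, c4⟩ := hc
  have hAc := hlt1.trans_le c3
  set c := baseSeq β with hcdef
  rw [es'] at c4 hlt2
  have hc' := hAc.le
  rw [← wordPow_eq (w := true :: P ++ [false]) (by simp)] at hc'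
  have key : ∃ c', c = wAp P ⊹ c' ∧ c' ≼ seqB P := by
    rcases between hc' c4.le with ⟨z, e, hz⟩ | h
    · exfalso
      have h3 : c ≼ wA P ⊹ c := by
        conv_lhs => rw [e]
        rw [append_le_append_iff]
        have := (c1 (true :: P ++ [false]).length (by simp)).le
        conv_lhs at this => rw [e, shiftBy_length_append]
        exact this
      exact hAc.not_le (le_wordPow_of_le_append (by simp) h3)
    · exact h
  obtain ⟨c', e, -⟩ := key
  have hsh : shiftBy S.length c = c' := by
    rw [fd.length, show P.length + 2 = (wAp P).length by simp]
    conv_lhs => rw [e]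
    rw [shiftBy_length_append]
  refine ⟨fd, ha0, c1, c2, hlt1, hlt2, by rw [hsh]; exact e, ?_⟩
  rw [hsh]
  rw [e, append_lt_append_iff] at c4
  exact c4

theorem suffix_block {j : ℕ} {p s : Word} (h : block c 0 j = p ++ s) :
    s ⊹ shiftBy j c = shiftBy p.length c := by
  have h1 := block_append_shiftBy c j
  rw [h, append_wordAppend] at h1
  conv_rhs => rw [← h1, shiftBy_length_append]

namespace Setting

theorem S_ne_nil (st : Setting S P U a c) : S ≠ [] := st.fd.sl.1

theorem length_Ap (st : Setting S P U a c) : (wAp P).length = S.length := by rw [st.fd.length]; simp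

theorem length_pos (st : Setting S P U a c) : 0 < S.length := List.length_pos_iff.2 st.S_ne_nil

theorem le_c (st : Setting S P U a c) : a ≼ c := by
  rcases st.c_cases with h | ⟨p, h1, h2⟩
  · rw [h]; exact seqLE.rfl
  · rw [h1, h2, ← wordPow_eq (w := p ++ [false]) (by simp)]
    exact (below_concat p _ _).le

theorem shift_c_le (st : Setting S P U a c) (n : ℕ) : shiftBy n c ≼ c := by
  cases n with
  | zero => rw [shiftBy_zero]; exact seqLE.rfl
  | succ n => exact (st.c_shift_lt _ (by omega)).le

theorem block_c (st : Setting S P U a c) : block c 0 S.length = wAp P := by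
  rw [← st.length_Ap, st.c_eq, block_wordAppend]

/-- Control of the shifts by `c` gives control by `a`. -/
theorem le_a (st : Setting S P U a c)
    (h : ∀ n, shiftBy n z ≼ c ∧ (shiftBy n z = c → c = a)) (n : ℕ) :
    shiftBy n z ≼ a := by
  by_cases hca : c = a
  · rw [← hca]; exact (h n).1
  · rcases st.c_cases with h1 | ⟨p, h1, h2⟩
    · exact absurd h1 hca
    · rw [h1]
      apply le_wordPow_of_forall_lt
      intro m
      rw [← h2]
      exact (h m).1.lt_of_ne fun e => hca ((h m).2 e)

theorem eq_a_of_le (st : Setting S P U a c) (h : c ≼ a) : c = a := h.antisymm st.le_c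

/-- When c is finite, a nonzero tail places the cut before its final 1, where c and a still agree;
so a begins with C1. -/
theorem minus_lt_a (st : Setting S P U a c) {j : ℕ} {C : Word} (hj : shiftBy j c ≠ zeroSeq)
    (hC : block c 0 j = C ++ [true]) : wordPow (C ++ [false]) ≺ a := by
  have hl : j = C.length + 1 := by
    have := congrArg List.length hC
    simpa using this
  rw [← wordPow_eq (w := C ++ [false]) (by simp)]
  suffices h : ∃ b, a = (C ++ [true]) ⊹ b by
    obtain ⟨b, hb⟩ := h
    rw [hb]; exact below_concat C _ _
  rcases st.c_cases with h1 | ⟨p, h1, h2⟩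
  · refine ⟨shiftBy j c, ?_⟩
    rw [← h1, ← hC, block_append_shiftBy]
  · have hjp : j ≤ p.length := by
      by_contra h
      apply hj
      rw [h2, shiftBy_append_of_ge (by simp; omega)]; rfl
    have h3 : block c 0 j = p.take j := by
      have h4 : c = p.take j ⊹ (p.drop j ++ [true]) ⊹ zeroSeq := by
        rw [← append_wordAppend, ← List.append_assoc, List.take_append_drop, ← h2]
      have h5 := block_wordAppend (p.take j) ((p.drop j ++ [true]) ⊹ zeroSeq)
      rw [← h4, List.length_take, min_eq_left hjp] at h5
      exact h5
    refine ⟨(p.drop j ++ [false]) ⊹ a, ?_⟩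
    rw [← hC, h3, ← append_wordAppend, ← List.append_assoc, List.take_append_drop, h1,
      wordPow_eq (by simp)]

theorem minus_lt_c (st : Setting S P U a c) {j : ℕ} {p s : Word}
    (h : block c 0 j = p ++ (s ++ [true])) (x : Seq) :
    (s ++ [false]) ⊹ x ≺ c :=
  ((below_concat s x _).trans_le (by rw [suffix_block h]; exact st.shift_c_le _))

theorem shift_powS_le (st : Setting S P U a c) (n : ℕ) : shiftBy n (wordPow S) ≼ wordPow (wA P) := by
  obtain ⟨d, hd⟩ := st.fd.shiftS
  rw [hd, shiftBy_shiftBy]; exact st.fd.maxA _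

theorem le_shift_powA (st : Setting S P U a c) (n : ℕ) : wordPow S ≼ shiftBy n (wordPow (wA P)) := by
  obtain ⟨d, hd⟩ := st.fd.shiftA
  rw [hd, shiftBy_shiftBy]; exact st.fd.sl.le_shiftBy _

theorem seqB_eq (st : Setting S P U a c) : seqB P = U ⊹ wordPow S := st.fd.minusU

theorem S_eq (st : Setting S P U a c) : S = false :: P ++ [true] := st.fd.eq

theorem seqB_lt_powS (st : Setting S P U a c) : seqB P ≺ wordPow S := by
  rw [seqB, ← wordPow_eq st.S_ne_nil]
  conv_rhs => rw [st.S_eq]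
  exact below_concat (false :: P) _ _

/-- The two forms of this sequence serve its two bounds: US^∞, built from Lyndon words, gives the
lower one, and S⁻A^∞ gives the upper one in `shift_seqB_le`. -/
theorem le_shift_seqB (st : Setting S P U a c) (n : ℕ) : seqB P ≼ shiftBy n (seqB P) := by
  conv_rhs => rw [st.seqB_eq]
  refine forall_shift_append (K := fun t => seqB P ≼ t) (fun p y e hy => ?_) (fun n => ?_) n
  · rw [st.seqB_eq]; exact st.fd.slU.le_suffix e hy
  · exact st.seqB_lt_powS.le.trans (st.fd.sl.le_shiftBy n)

theorem shift_powA_lt_c (st : Setting S P U a c) (n : ℕ) : shiftBy n (wordPow (wA P)) ≺ c :=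
  ((st.fd.maxA n).trans_lt st.lt_a).trans_le st.le_c

theorem suffix_Sm_le (st : Setting S P U a c) {p s : Word} (h : wSm P = p ++ s) :
    s ⊹ wordPow (wA P) ≼ wordPow (wA P) := by
  cases p with
  | nil =>
    rw [List.nil_append] at h
    rw [← h]
    conv_rhs => rw [← wordPow_eq (w := wA P) (by simp)]
    exact (below_cons (P ++ [false]) (P ++ [false]) _ _).le
  | cons b p =>
    have h1 : P ++ [false] = p ++ s := (List.cons.inj h).2
    have h2 : wA P = (true :: p) ++ s := by rw [List.cons_append, ← h1]; rfl
    rw [suffix_append_wordPow (by simp) h2]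
    exact st.fd.maxA _

theorem shift_seqB_le (st : Setting S P U a c) (n : ℕ) : shiftBy n (seqB P) ≼ wordPow (wA P) := by
  rw [seqB]
  refine forall_shift_append (K := fun t => t ≼ wordPow (wA P)) (fun p y e hy => ?_)
    (fun n => ?_) n
  · exact st.suffix_Sm_le e
  · exact st.fd.maxA n

end Setting
end setting

/-! ### The critical value -/

theorem exists_block_repeat (z : Seq) (N k : ℕ) :
    ∃ i i', N ≤ i ∧ i < i' ∧ i' ≤ N + 2 ^ k ∧ ∀ r < k, z (i + r) = z (i' + r) := by
  let f : Fin (2 ^ k + 1) → (Fin k → Bool) := fun t r => z (N + t + r)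
  obtain ⟨s, t, hne, h⟩ := Fintype.exists_ne_map_eq_of_card_lt f (by simp)
  have key : ∀ s t : Fin (2 ^ k + 1), s < t → f s = f t →
      ∃ i i', N ≤ i ∧ i < i' ∧ i' ≤ N + 2 ^ k ∧ ∀ r < k, z (i + r) = z (i' + r) := by
    intro s t hst h
    refine ⟨N + s, N + t, by omega, by have : (s : ℕ) < t := hst; omega, by omega,
      fun r hr => ?_⟩
    exact congrFun h ⟨r, hr⟩
  rcases lt_or_gt_of_ne hne with h1 | h1
  · exact key s t h1 h
  · exact key t s h1 h.symm

/-- If the digit before a block of length `k` is determined by the block, then the sequence is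
purely periodic. -/
theorem periodic_of_left_determined {z : Seq} {k : ℕ}
    (h : ∀ i i', (∀ r < k, z (i + 1 + r) = z (i' + 1 + r)) → z i = z i') :
    ∃ m, 1 ≤ m ∧ shiftBy m z = z := by
  -- By pigeonhole a block of length k repeats at some distance p ≤ 2^k arbitrarily far out; the
  -- factorial is a common multiple of all such distances.
  refine ⟨(2 ^ k).factorial, Nat.succ_le_of_lt (Nat.factorial_pos _), ?_⟩
  funext q
  rw [shiftBy]
  obtain ⟨i, i', h1, h2, h3, h4⟩ := exists_block_repeat z (q + (2 ^ k).factorial) k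
  obtain ⟨p, hp⟩ : ∃ p, i' = i + p := ⟨i' - i, by omega⟩
  subst hp
  -- Left determination carries the repetition back, digit by digit, to the beginning.
  have key : ∀ d ≤ i, ∀ r < k, z (i - d + r) = z (i - d + p + r) := by
    intro d
    induction d with
    | zero => intro _ r hr; simpa using h4 r hr
    | succ d ih =>
      intro hd r hr
      have ih' := ih (by omega)
      cases r with
      | zero =>
        apply h
        intro r hr
        rw [show i - (d + 1) + 0 + 1 + r = i - d + r by omega, ih' r hr]
        congr 1; omega
      | succ r =>
        have := ih' r (by omega)
        rw [show i - (d + 1) + (r + 1) = i - d + r by omega, this]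
        congr 1; omega
  have key2 : ∀ q' < i, z q' = z (q' + p) := by
    intro q' hq'
    have := key (i - (q' + 1)) (by omega)
    apply h
    intro r hr
    have h5 := this r hr
    rw [show i - (i - (q' + 1)) = q' + 1 by omega] at h5
    rw [h5]; congr 1; omega
  have hdvd : p ∣ (2 ^ k).factorial := Nat.dvd_factorial (by omega) (by omega)
  obtain ⟨t, ht⟩ := hdvd
  have key3 : ∀ s ≤ t, z (q + p * s) = z q := by
    intro s
    induction s with
    | zero => intro _; simp
    | succ s ih =>
      intro hs
      have h6 : p * (s + 1) ≤ p * t := Nat.mul_le_mul_left _ hs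
      rw [Nat.mul_succ] at h6 ⊢
      rw [← add_assoc, ← key2 _ (by omega)]
      exact ih (by omega)
  rw [add_comm, ht]
  exact key3 t le_rfl

section tau
variable {S P U : Word} {a c z : Seq} {β : ℝ}

/-- After 1P1 the bound a ≺ 1P1 S⁻A^∞ would require a tail below S⁻A^∞, which survivors do not have.
-/
theorem Setting.lt_Ap_of_mem (st : Setting S P U a c) (hz : z ∈ Surv a (seqB P)) (n : ℕ) :
    shiftBy n z ≺ wAp P ⊹ zeroSeq := by
  rw [← seq_not_le]
  intro h
  have h2 := (hz n).2.trans_lt st.a_lt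
  obtain ⟨u, z', hu, e⟩ := exists_eq_append (shiftBy n z) (wAp P).length
  rw [e] at h h2
  rcases below_of_lt hu h2 with h3 | ⟨-, h3⟩
  · exact h.not_lt (h3 _ _)
  · have h4 := (hz (n + u.length)).1
    rw [← shiftBy_shiftBy, e, shiftBy_length_append] at h4
    exact h4.not_lt h3

/-- An occurrence of S⁻ squeezes the tail to A^∞. Otherwise a digit 0 must be followed by a block of
length |P|+1 that is at least P1, and a digit 1 by a smaller one; each digit is then determined by
the block after it. -/
theorem Setting.eventually_periodic (st : Setting S P U a c) (hz : z ∈ Surv a (seqB P)) :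
    ∃ u w, z = u ⊹ wordPow w := by
  have h1 := st.lt_Ap_of_mem hz
  have h2 : ∀ n, shiftBy n z ≼ wordPow (wA P) := le_wordPow_of_forall_lt h1
  by_cases h3 : ∃ n, shiftBy n z ≺ S ⊹ zeroSeq
  · obtain ⟨n, hn⟩ := h3
    rw [st.S_eq] at hn
    rcases between (hz n).1 hn.le with ⟨z', e, hz'⟩ | ⟨z', e, hz'⟩
    · refine ⟨block z 0 n ++ wSm P, wA P, ?_⟩
      have h4 := h2 (n + (wSm P).length)
      rw [← shiftBy_shiftBy, e, shiftBy_length_append] at h4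
      rw [hz'.antisymm h4, append_wordAppend, ← e, block_append_shiftBy]
    · rw [e, append_lt_append_iff] at hn
      exact absurd hn (zeroSeq_le _).not_lt
  · have h4 : ∀ n, S ⊹ zeroSeq ≼ shiftBy n z := fun n => by
      rw [← seq_not_lt]; exact fun h => h3 ⟨n, h⟩
    have hcons : ∀ n b, z n = b → shiftBy n z = [b] ⊹ shiftBy (n + 1) z := by
      intro n b hb
      have := block_append_shiftBy' z n 1
      rw [← this]; simp [block, hb]
    have key : ∀ i i', (∀ r < P.length + 1, z (i + 1 + r) = z (i' + 1 + r)) →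
        z i = false → z i' = true → False := by
      intro i i' hr hi hi'
      have g1 := h4 i
      rw [hcons i _ hi, st.S_eq, show false :: P ++ [true] = [false] ++ (P ++ [true]) from rfl,
        append_wordAppend, append_le_append_iff] at g1
      have g2 := h1 i'
      rw [hcons i' _ hi', show wAp P = [true] ++ (P ++ [true]) from rfl,
        append_wordAppend, append_lt_append_iff] at g2
      have hb : block (shiftBy (i + 1) z) 0 (P.length + 1) =
          block (shiftBy (i' + 1) z) 0 (P.length + 1) := block_congr hr
      rw [← block_append_shiftBy (shiftBy (i + 1) z) (P.length + 1)] at g1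
      rw [← block_append_shiftBy (shiftBy (i' + 1) z) (P.length + 1)] at g2
      rcases below_of_lt (by simp) g2 with g3 | ⟨-, g3⟩
      · rw [hb] at g1
        exact g1.not_lt (g3 _ _)
      · exact absurd g3 (zeroSeq_le _).not_lt
    obtain ⟨m, hm1, hm2⟩ := periodic_of_left_determined (z := z) (k := P.length + 1) (by
      intro i i' hr
      cases hi : z i <;> cases hi' : z i'
      · rfl
      · exact absurd (key i i' hr hi hi') id
      · exact absurd (key i' i (fun r h => (hr r h).symm) hi' hi) id
      · rfl)
    exact ⟨[], block z 0 m, by rw [nil_wordAppend, wordPow_block hm1 hm2]⟩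

theorem Setting.countable_surv (st : Setting S P U a c) : (Surv a (seqB P)).Countable := by
  refine (Set.countable_range fun q : Word × Word => q.1 ⊹ wordPow q.2).mono ?_
  intro z hz
  obtain ⟨u, w, e⟩ := st.eventually_periodic hz
  exact ⟨(u, w), e.symm⟩

theorem Setting.adm_seqB (st : Setting S P U (quasiGreedy β) c) : Adm β (seqB P) :=
  fun n => (st.shift_seqB_le n).trans_lt st.lt_a

/-- The survivor set at the value of S⁻A^∞ is covered by the projections of countably many
itineraries, so it has dimension 0. Only this upper bound for τ(β) is used. -/
theorem Setting.criticalValue_le (h1 : 1 < β) (h2 : β < 2)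
    (st : Setting S P U (quasiGreedy β) c) : criticalValue β ≤ proj β (seqB P) := by
  apply csInf_le
  · exact ⟨0, fun t ht => ht.1.le⟩
  · refine ⟨proj_pos h1 ?_, ?_⟩
    · intro h
      have h3 := congrArg (shiftBy (wSm P).length) h
      rw [seqB, shiftBy_length_append] at h3
      have h4 := congrFun h3 0
      simp [wordPow, zeroSeq, shiftBy] at h4
    · apply Set.Countable.dimH_zero
      refine (st.countable_surv.image (proj β)).mono ?_
      rintro x ⟨hx, hx2⟩
      refine ⟨orbitSeq β x, fun n => ⟨?_, (adm_orbitSeq h1 h2.le hx n).le⟩,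
        proj_orbitSeq h1 h2.le hx⟩
      rw [← st.adm_seqB.proj_le_proj_iff h1 h2.le ((adm_orbitSeq h1 h2.le hx).shiftBy n),
        shiftBy_orbitSeq, proj_orbitSeq h1 h2.le (betaMap_iterate_mem hx n)]
      exact hx2 n

end tau

/-! ### Cuts and return words -/

section cuts
variable {S P U C d v : Word} {a c x y z Q : Seq} {j n s k k' j' n' : ℕ}

theorem IsReturn.unique (h : IsReturn c j n) (h' : IsReturn c j n') : n = n' := h.2.unique h'.2

theorem IsCut.unique (h : IsCut c s k j) : ∀ {j'}, IsCut c s k j' → j = j' := by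
  induction h with
  | first =>
    intro j' h'
    cases h' with
    | first => rfl
    | next h1 h2 => cases h1
  | next h1 h2 ih =>
    intro j' h'
    cases h' with
    | first => cases h1
    | next h3 h4 =>
      have e := ih h3
      subst e
      rw [h2.unique h4]

theorem IsCut.mono (h : IsCut c s k j) :
    ∀ {k' j'}, IsCut c s k' j' → k' ≤ k → j' ≤ j ∧ shiftBy j c ≼ shiftBy j' c := by
  induction h with
  | first =>
    intro k' j' h' hk
    cases h' with
    | first => exact ⟨le_rfl, seqLE.rfl⟩
    | next h1 h2 => cases h1 <;> omega
  | next h1 h2 ih =>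
    intro k' j' h' hk
    rcases Nat.lt_or_eq_of_le hk with h3 | rfl
    · have := ih h' (by omega)
      exact ⟨by omega, h2.2.1.2.trans this.2⟩
    · rw [h'.unique (h1.next h2)]
      exact ⟨le_rfl, seqLE.rfl⟩

theorem IsCut.one_le (h : IsCut c s k j) : 1 ≤ k := by
  cases h <;> omega

/-- Everything needed about a cut `j` with return word `v1` and `c = C1…`. -/
structure RetData (S : Word) (c : Seq) (j n : ℕ) (C v : Word) : Prop where
  block_C : block c 0 j = C ++ [true]
  block_v : block c j n = v ++ [true]
  ne_zero : shiftBy j c ≠ zeroSeq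
  le_first : shiftBy j c ≼ shiftBy S.length c
  next_le : shiftBy (j + n) c ≼ shiftBy j c
  sl : SL (v ++ [true])

theorem eq_zeroSeq_of_shift_le (h : x = [false] ⊹ y) (h' : y ≼ x) : x = zeroSeq := by
  have h1 : wordPow [false] = zeroSeq := by
    symm; apply eq_wordPow (by simp)
    funext i; cases i <;> simp [zeroSeq, wordAppend]
  have h2 : x ≼ [false] ⊹ x := by conv_lhs => rw [h]
                                  rw [append_le_append_iff]; exact h'
  have h3 := le_wordPow_of_le_append (by simp) h2
  rw [h1] at h3
  exact h3.antisymm (zeroSeq_le _)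

theorem SL.eq_concat_true {b : Bool} {w : Word} (h : SL (false :: b :: w)) :
    ∃ v, false :: b :: w = v ++ [true] := by
  obtain ⟨v, b', e⟩ : ∃ v b', false :: b :: w = v ++ [b'] :=
    ⟨_, _, (List.dropLast_append_getLast (by simp)).symm⟩
  refine ⟨v, ?_⟩
  rw [e]
  congr 2
  have hv : v ≠ [] := by rintro rfl; simp at e
  have h1 := h.2 v [b'] e hv (by simp)
  cases b' with
  | true => rfl
  | false =>
    exfalso
    have h2 := h1 zeroSeq zeroSeq
    have h3 : [false] ⊹ zeroSeq = zeroSeq := by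
      funext i; cases i <;> simp [zeroSeq, wordAppend]
    rw [h3] at h2
    exact (zeroSeq_le _).not_lt h2

theorem IsReturn.sl (h : IsReturn c j n) : SL (block c j n) := by
  obtain ⟨-, ⟨h1, h2⟩, h3⟩ := h
  refine SL_of_return (D := shiftBy j c) (D' := shiftBy (j + n) c) ?_
    (block_append_shiftBy' c j n).symm h2 ?_
  · intro e
    have := congrArg List.length e
    simp at this; omega
  · intro i hi hin
    rw [length_block] at hin
    rw [← seq_not_le, shiftBy_shiftBy]
    intro hle
    exact absurd (h3 ⟨hi, hle⟩) (by omega)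

/-- A position with `σ^j c ≼ σ^s c` begins with `0`. -/
theorem Setting.eq_zero_cons (st : Setting S P U a c)
    (h : shiftBy j c ≼ shiftBy S.length c) : ∃ x, shiftBy j c = [false] ⊹ x := by
  have h1 := h.trans_lt st.c_lt
  obtain ⟨u, x, hu, e⟩ := exists_eq_append (shiftBy j c) 1
  refine ⟨x, ?_⟩
  rw [e]
  obtain ⟨b, rfl⟩ := List.length_eq_one_iff.1 hu
  cases b with
  | false => rfl
  | true =>
    exfalso
    rw [e, seqB] at h1
    have h2 := below_cons (P ++ [false]) [] (wordPow (wA P)) x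
    exact h1.not_le h2.le

/-- Makes the lowered return word meaningful. A Lyndon word of length at least two that begins with
0 ends with 1, and a one-letter return word would be 0, forcing the tail to be 0^∞. -/
theorem Setting.retData_aux (st : Setting S P U a c) (hle : shiftBy j c ≼ shiftBy S.length c)
    (hr : IsReturn c j n) : ∃ v, block c j n = v ++ [true] := by
  have hsl := hr.sl
  obtain ⟨x, hx⟩ := st.eq_zero_cons hle
  have hD := block_append_shiftBy' c j n
  obtain ⟨h0, ⟨h1, h2⟩, -⟩ := hr
  generalize hw : block c j n = w at hsl hD ⊢
  match w, hsl, hD with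
  | [], hsl, _ => exact absurd rfl hsl.1
  | [b], _, hD =>
    exfalso
    rw [hx] at hD
    obtain ⟨e, rfl⟩ := wordAppend_inj (by simp) hD
    exact h0 (eq_zeroSeq_of_shift_le hx h2)
  | b :: b' :: w, hsl, hD =>
    have : b = false := by
      rw [hx] at hD
      have := congrFun hD 0
      simpa [wordAppend] using this
    subst this
    exact hsl.eq_concat_true

theorem Setting.cut_le_first (_st : Setting S P U a c) (h : IsCut c S.length k j) :
    S.length ≤ j ∧ shiftBy j c ≼ shiftBy S.length c :=
  h.mono IsCut.first h.one_le

theorem Setting.cut_block (st : Setting S P U a c) (h : IsCut c S.length k j) :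
    ∃ C, block c 0 j = C ++ [true] := by
  cases h with
  | first => exact ⟨true :: P, st.block_c⟩
  | next h1 h2 =>
    obtain ⟨v, hv⟩ := st.retData_aux (st.cut_le_first h1).2 h2
    rw [block_add, zero_add, hv, ← List.append_assoc]
    exact ⟨_, rfl⟩

theorem Setting.retData (st : Setting S P U a c) (h : IsCut c S.length k j)
    (hr : IsReturn c j n) : ∃ C v, RetData S c j n C v := by
  obtain ⟨C, hC⟩ := st.cut_block h
  have hle := (st.cut_le_first h).2
  obtain ⟨v, hv⟩ := st.retData_aux hle hr
  exact ⟨C, v, hC, hv, hr.1, hle, hr.2.1.2, hv ▸ hr.sl⟩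

theorem length_of_block {w : Word} (h : block c j n = w) : n = w.length := by
  rw [← h, length_block]

theorem c_eq_of_block (h : block c 0 j = C) : c = C ⊹ shiftBy j c := by
  rw [← h, block_append_shiftBy]

namespace RetData

theorem D_eq (rd : RetData S c j n C v) :
    shiftBy j c = (v ++ [true]) ⊹ shiftBy (j + n) c := by
  rw [← rd.block_v, block_append_shiftBy']

theorem c_eq (rd : RetData S c j n C v) : c = (C ++ [true]) ⊹ shiftBy j c :=
  c_eq_of_block rd.block_C

theorem length_C (rd : RetData S c j n C v) : j = C.length + 1 := by
  simpa using length_of_block rd.block_C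

theorem length_v (rd : RetData S c j n C v) : n = v.length + 1 := by
  simpa using length_of_block rd.block_v

theorem D_le (rd : RetData S c j n C v) : shiftBy j c ≼ wordPow (v ++ [true]) := by
  apply le_wordPow_of_le_append (by simp)
  conv_lhs => rw [rd.D_eq]
  rw [append_le_append_iff]
  exact rd.next_le

end RetData

theorem Setting.powV_le_seqB (st : Setting S P U a c) (rd : RetData S c j n C v) :
    wordPow (v ++ [true]) ≼ seqB P := by
  refine wordPow_le_of_append_le_min st.le_shift_seqB (by simp) (x := shiftBy (j + n) c) ?_
  rw [← rd.D_eq]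
  exact (rd.le_first.trans_lt st.c_lt).le

theorem Setting.powV_lt_powS (st : Setting S P U a c) (rd : RetData S c j n C v) :
    wordPow (v ++ [true]) ≺ wordPow S := (st.powV_le_seqB rd).trans_lt st.seqB_lt_powS

theorem powV_anti {C' v' : Word} (rd : RetData S c j n C v)
    (rd' : RetData S c j' n' C' v') (h : shiftBy j c ≼ shiftBy j' c) :
    wordPow (v ++ [true]) ≼ wordPow (v' ++ [true]) := by
  refine wordPow_le_of_append_le_min rd'.sl.le_shiftBy (by simp) (x := shiftBy (j + n) c) ?_
  rw [← rd.D_eq]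
  exact h.trans rd'.D_le

/-- `Q` is at most `w^∞` for all return words `w` before the `k`-th cut. -/
def Low (c : Seq) (s k : ℕ) (Q : Seq) : Prop :=
  ∀ k' j' n', k' < k → IsCut c s k' j' → IsReturn c j' n' → Q ≼ wordPow (block c j' n')

theorem Low.mono (h : Low c s k Q) (hk : k' ≤ k) : Low c s k' Q :=
  fun k₁ j₁ n₁ h1 => h k₁ j₁ n₁ (by omega)

theorem Low.anti (h : Low c s k Q) (hx : x ≼ Q) : Low c s k x :=
  fun k₁ j₁ n₁ h1 h2 h3 => hx.trans (h k₁ j₁ n₁ h1 h2 h3)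

theorem Setting.low_powV (st : Setting S P U a c) (hc : IsCut c S.length k j)
    (rd : RetData S c j n C v) : Low c S.length k (wordPow (v ++ [true])) := by
  intro k' j' n' hk h1 h2
  obtain ⟨C', v', rd'⟩ := st.retData h1 h2
  rw [rd'.block_v]
  exact powV_anti rd rd' (hc.mono h1 hk.le).2

/-- The prefix up to a cut is 1P1 followed by the earlier return words. Each return word is Lyndon
with power at least Q, and the proper suffixes of 1P1 are suffixes of S, so the bound passes through
block by block. -/
theorem Setting.le_suffix_cut (st : Setting S P U a c) (h : IsCut c S.length k j)
    (hS : Q ≼ wordPow S) (hQ : Low c S.length k Q) :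
    ∀ {p y x}, block c 0 j = p ++ y → Q ≼ x → Q ≼ y ⊹ x := by
  induction h with
  | first =>
    intro p y x e hx
    rw [st.block_c] at e
    cases p with
    | nil =>
      rw [List.nil_append] at e
      rw [← e]
      refine hS.trans ?_
      rw [← wordPow_eq st.S_ne_nil, st.S_eq]
      exact (below_cons (P ++ [true]) (P ++ [true]) _ _).le
    | cons b p =>
      by_cases hy : y = []
      · rw [hy, nil_wordAppend]; exact hx
      · have e2 : P ++ [true] = p ++ y := (List.cons.inj e).2
        have e3 : S = (false :: p) ++ y := by rw [st.S_eq, List.cons_append, e2]; rfl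
        exact st.fd.sl.le_suffix_append hS hx e3 hy
  | @next k j n h1 h2 ih =>
    intro p y x e hx
    have hv := hQ _ _ _ (Nat.lt_succ_self _) h1 h2
    have ih := @ih (hQ.mono (Nat.le_succ _))
    rw [block_add, zero_add] at e
    rcases List.append_eq_append_iff.1 e with ⟨t, e1, e2⟩ | ⟨t, e1, e2⟩
    · by_cases hy : y = []
      · rw [hy, nil_wordAppend]; exact hx
      · exact h2.sl.le_suffix_append hv hx e2 hy
    · rw [e2, append_wordAppend]
      exact ih e1 (le_append_of_le h2.sl.1 hv hx)

/-! ### Upper bounds -/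

theorem Setting.suffix_below (st : Setting S P U a c) (h : block c 0 j = C ++ [true])
    {p y : Word} (e : C = p ++ y) (hp : p ≠ []) : Below (y ++ [false]) C := by
  have e1 : block c 0 j = p ++ (y ++ [true]) := by rw [h, e, List.append_assoc]
  have h1 := suffix_block e1
  have h2 := st.shift_c_le p.length
  rw [← h1] at h2
  have hl : y.length + 1 ≤ C.length := by
    rw [e, List.length_append]
    have := List.length_pos_iff.2 hp
    omega
  have h3 := c_eq_of_block h
  conv_rhs at h2 => rw [h3, ← List.take_append_drop (y.length + 1) C, append_wordAppend,
    append_wordAppend]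
  have h4 : Below (y ++ [false]) (C.take (y.length + 1)) := by
    rcases below_of_le (by simp [hl]) h2 with h5 | ⟨h5, -⟩
    · exact (below_concat y).trans h5
    · rw [← h5]; exact below_concat y
  have := h4.append [] (C.drop (y.length + 1))
  rwa [List.append_nil, List.take_append_drop] at this

theorem Setting.suffix_E_le (st : Setting S P U a c) (h : block c 0 j = C ++ [true])
    {p y : Word} (e : C = p ++ y) :
    (y ++ [false]) ⊹ wordPow (C ++ [false]) ≼ wordPow (C ++ [false]) := by
  by_cases hp : p = []
  · subst hp
    rw [List.nil_append] at e
    rw [← e, wordPow_eq (by simp)]; exact seqLE.rfl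
  · conv_rhs => rw [← wordPow_eq (w := C ++ [false]) (by simp), append_wordAppend]
    exact (st.suffix_below h e hp _ _).le

theorem Setting.shift_E_le (st : Setting S P U a c) (h : block c 0 j = C ++ [true]) (n : ℕ) :
    shiftBy n (wordPow (C ++ [false])) ≼ wordPow (C ++ [false]) := by
  refine forall_shift_wordPow (K := fun t => t ≼ wordPow (C ++ [false])) (by simp) ?_ n
  intro p y e hy
  obtain ⟨y', b, rfl⟩ : ∃ y' b, y = y' ++ [b] :=
    ⟨_, _, (List.dropLast_append_getLast hy).symm⟩
  rw [← List.append_assoc] at e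
  obtain ⟨e1, e2⟩ := List.append_inj' e rfl
  cases e2
  exact st.suffix_E_le h e1

/-- Lowering the last digit of a suffix of `d1`, where `σ^j c = d1…`. -/
theorem Setting.suffix_minus_le (st : Setting S P U a c) (h : block c 0 j = C ++ [true])
    (hd : shiftBy j c = (d ++ [true]) ⊹ x) (hsl : SL (d ++ [true])) :
    ∀ q p, d = p ++ q →
      (q ++ [false]) ⊹ wordPow (C ++ [false]) ≼ wordPow (C ++ [false]) := by
  intro q
  induction hl : q.length using Nat.strong_induction_on generalizing q with
  | _ l ih =>
  subst hl
  intro p e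
  have h1 : (q ++ [true]) ⊹ x ≼ c := by
    have h2 := st.shift_c_le (j + p.length)
    rw [← shiftBy_shiftBy, hd, e, List.append_assoc, shiftBy_append_append] at h2
    exact h2
  have hE : wordPow (C ++ [false]) = C ⊹ [false] ⊹ wordPow (C ++ [false]) := by
    conv_lhs => rw [← wordPow_eq (w := C ++ [false]) (by simp), append_wordAppend]
  have h3 := c_eq_of_block h
  rcases lt_or_ge q.length C.length with hq | hq
  · conv_rhs at h1 => rw [h3, ← List.take_append_drop (q.length + 1) C, append_wordAppend,
      append_wordAppend]
    have h4 : Below (q ++ [false]) (C.take (q.length + 1)) := by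
      rcases below_of_le (by simp; omega) h1 with h5 | ⟨h5, -⟩
      · exact (below_concat q).trans h5
      · rw [← h5]; exact below_concat q
    conv_rhs => rw [hE, ← List.take_append_drop (q.length + 1) C, append_wordAppend]
    exact (h4 _ _).le
  · -- `q1` begins with a word `q₁` of length `j`
    obtain ⟨q₁, q₂, hq₁, e2⟩ : ∃ q₁ q₂ : Word, q₁.length = C.length + 1 ∧ q ++ [true] = q₁ ++ q₂ :=
      ⟨(q ++ [true]).take (C.length + 1), _, by simp; omega, (List.take_append_drop _ _).symm⟩
    have h5 := h1
    rw [e2, append_wordAppend] at h5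
    conv_rhs at h5 => rw [h3]
    rcases List.eq_nil_or_concat' q₂ with rfl | ⟨q₃, b, rfl⟩
    · rw [List.append_nil] at e2
      have hql : q.length = C.length := by
        have := congrArg List.length e2
        simp at this; omega
      have h6 : Below (q ++ [false]) (C ++ [true]) := by
        rcases below_of_le (by simp [hq₁]) h5 with h7 | ⟨h7, -⟩
        · rw [← e2] at h7
          exact (below_concat q).trans h7
        · rw [← e2] at h7
          rw [← h7]; exact below_concat q
      rcases below_concat_true (by simp [hql]) h6 with h7 | h7
      · rw [hE, ← append_wordAppend C]; exact (h7 _ _).le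
      · rw [h7, wordPow_eq (by simp)]; exact seqLE.rfl
    · rw [← List.append_assoc] at e2
      obtain ⟨e3, e4⟩ := List.append_inj' e2 rfl
      cases e4
      -- Equality with C1 is impossible: maximality of c would leave a remainder at most D, but the
      -- remainder begins with a proper suffix of the Lyndon word d1 and exceeds D.
      have h6 : Below q₁ (C ++ [true]) := by
        rcases below_of_le (by simp [hq₁]) h5 with h7 | ⟨h7, h8⟩
        · exact h7
        · exfalso
          have e5 : d ++ [true] = (p ++ q₁) ++ (q₃ ++ [true]) := by rw [e, e3]; simp
          have hb := hsl.2 (p ++ q₁) (q₃ ++ [true]) e5 (by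
            intro h0
            rw [(List.append_eq_nil_iff.1 h0).2] at hq₁
            simp at hq₁) (by simp)
          have h9 := hb x x
          rw [← hd] at h9
          exact h8.not_lt h9
      rw [e3, List.append_assoc, append_wordAppend]
      rcases below_concat_true (by simp [hq₁]) h6 with h7 | h7
      · conv_rhs => rw [hE, ← append_wordAppend C]
        exact (h7 _ _).le
      · rw [h7]
        conv_rhs => rw [← wordPow_eq (w := C ++ [false]) (by simp)]
        rw [append_le_append_iff]
        exact ih q₃.length (by rw [e3]; simp [hq₁]) q₃ rfl (p ++ q₁)
          (by rw [e, e3, List.append_assoc])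

/-- A suffix q1 of d1 strictly exceeds the prefix of d of its length, so q0 is at least that prefix.
In case of equality the rest of d0 followed by e is compared with e, which is the hypothesis. -/
theorem SL.minus_le_suffix {e : Seq} (hsl : SL (d ++ [true]))
    (he : ∀ f p, d = p ++ f → (f ++ [false]) ⊹ e ≼ e) {q p : Word} (ed : d = p ++ q) :
    (d ++ [false]) ⊹ e ≼ (q ++ [false]) ⊹ e := by
  by_cases hp : p = []
  · subst hp
    rw [List.nil_append] at ed
    rw [ed]; exact seqLE.rfl
  have hl : q.length + 1 ≤ d.length := by
    rw [ed, List.length_append]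
    have := List.length_pos_iff.2 hp
    omega
  have hb := hsl.2 p (q ++ [true]) (by rw [ed]; simp) hp (by simp)
  obtain ⟨e₁, f, he₁, ed₁⟩ : ∃ e₁ f : Word, e₁.length = q.length + 1 ∧ d = e₁ ++ f :=
    ⟨d.take (q.length + 1), _, by simp; omega, (List.take_append_drop _ _).symm⟩
  have hb2 : Below e₁ (q ++ [true]) := by
    have h1 := hb e e
    rw [ed₁, List.append_assoc, append_wordAppend] at h1
    rcases below_of_lt (by simp [he₁]) h1 with h2 | ⟨h2, -⟩
    · exact h2
    · exfalso
      have h3 := hb e (f ⊹ [true] ⊹ e)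
      rw [← h2, ed₁] at h3
      simp only [append_wordAppend] at h3
      exact seqLT.irrefl _ h3
  conv_lhs => rw [ed₁, List.append_assoc, append_wordAppend]
  rcases below_concat_true he₁ hb2 with h1 | h1
  · exact (h1 _ _).le
  · rw [h1, append_le_append_iff]
    exact he f e₁ ed₁

/-- The sequence `d0E` is the smallest of its shifts within `d0`. -/
theorem Setting.minus_le_suffix (st : Setting S P U a c) (h : block c 0 j = C ++ [true])
    (hd : shiftBy j c = (d ++ [true]) ⊹ x) (hsl : SL (d ++ [true])) {q p : Word}
    (e : d = p ++ q) :
    (d ++ [false]) ⊹ wordPow (C ++ [false]) ≼ (q ++ [false]) ⊹ wordPow (C ++ [false]) :=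
  hsl.minus_le_suffix (st.suffix_minus_le h hd hsl) e

theorem Setting.powA_le_E (st : Setting S P U a c) (hj : S.length ≤ j)
    (h : block c 0 j = C ++ [true]) : wordPow (wA P) ≼ wordPow (C ++ [false]) := by
  obtain ⟨m, rfl⟩ := Nat.exists_eq_add_of_le hj
  rw [block_add, st.block_c, zero_add] at h
  rcases List.eq_nil_or_concat' (block c S.length m) with h1 | ⟨w, b, h1⟩
  · rw [h1, List.append_nil] at h
    have : C = true :: P := (List.append_inj' h.symm rfl).1
    rw [this]; exact seqLE.rfl
  · rw [h1, ← List.append_assoc] at h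
    have : C = wAp P ++ w := (List.append_inj' h.symm rfl).1
    rw [← wordPow_eq (w := wA P) (by simp), ← wordPow_eq (w := C ++ [false]) (by simp), this,
      List.append_assoc, append_wordAppend (wAp P)]
    exact (below_concat (true :: P) _ _).le

theorem forall_shift_minus_append {K : Seq → Prop} {d : Word} {e : Seq}
    (h1 : ∀ p q, d = p ++ q → K ((q ++ [false]) ⊹ e)) (h2 : ∀ n, K (shiftBy n e)) (n : ℕ) :
    K (shiftBy n ((d ++ [false]) ⊹ e)) := by
  refine forall_shift_append (K := K) ?_ h2 n
  intro p y e hy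
  obtain ⟨y', b, rfl⟩ : ∃ y' b, y = y' ++ [b] :=
    ⟨_, _, (List.dropLast_append_getLast hy).symm⟩
  rw [← List.append_assoc] at e
  obtain ⟨e1, e2⟩ := List.append_inj' e rfl
  cases e2
  exact h1 _ _ e1

theorem Setting.shift_minus_E_le (st : Setting S P U a c) (h : block c 0 j = C ++ [true])
    (hd : shiftBy j c = (d ++ [true]) ⊹ x) (hsl : SL (d ++ [true])) (n : ℕ) :
    shiftBy n ((d ++ [false]) ⊹ wordPow (C ++ [false])) ≼ wordPow (C ++ [false]) :=
  forall_shift_minus_append (K := fun t => t ≼ wordPow (C ++ [false]))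
    (fun p q e => st.suffix_minus_le h hd hsl q p e) (st.shift_E_le h) n

/-! ### The structure of the survivors above the left endpoint -/

/-- The left endpoint `v⁻(C⁻)^∞` of a window. -/
def leftEnd (C v : Word) : Seq := (v ++ [false]) ⊹ wordPow (C ++ [false])

/-- One half of the trap; `RetData.split_high` is the other. Each alternative ends in one of the two
regions again, so the process continues forever. -/
theorem RetData.split_low (rd : RetData S c j n C v) (h1 : leftEnd C v ≼ x)
    (h2 : x ≼ shiftBy j c) :
    (∃ x', x = (v ++ [false]) ⊹ x' ∧ wordPow (C ++ [false]) ≼ x') ∨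
      ∃ x', x = (v ++ [true]) ⊹ x' ∧ x' ≼ shiftBy j c := by
  rw [rd.D_eq] at h2
  rcases between h1 h2 with h3 | ⟨x', e, h3⟩
  · exact Or.inl h3
  · exact Or.inr ⟨x', e, h3.trans rd.next_le⟩

theorem RetData.split_high (rd : RetData S c j n C v) (h1 : wordPow (C ++ [false]) ≼ x)
    (h2 : x ≼ c) :
    (∃ x', x = (C ++ [false]) ⊹ x' ∧ wordPow (C ++ [false]) ≼ x') ∨
      ∃ x', x = (C ++ [true]) ⊹ x' ∧ x' ≼ shiftBy j c := by
  rw [← wordPow_eq (w := C ++ [false]) (by simp)] at h1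
  rw [rd.c_eq] at h2
  exact between h1 h2

theorem Setting.shift_leftEnd_le (st : Setting S P U a c) (rd : RetData S c j n C v) (i : ℕ) :
    shiftBy i (leftEnd C v) ≼ wordPow (C ++ [false]) :=
  st.shift_minus_E_le rd.block_C rd.D_eq rd.sl i

theorem Setting.E_lt_a (st : Setting S P U a c) (rd : RetData S c j n C v) :
    wordPow (C ++ [false]) ≺ a := st.minus_lt_a rd.ne_zero rd.block_C

theorem leftEnd_lt_powV (C v : Word) : leftEnd C v ≺ wordPow (v ++ [true]) := by
  rw [leftEnd, ← wordPow_eq (w := v ++ [true]) (by simp)]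
  exact below_concat v _ _

end cuts

/-! ### Survivor shifts that are not transitive -/

section nontransitive
variable {S P U C v w : Word} {a c x W : Seq} {j n k : ℕ}

theorem Setting.eq_a_of_shift_eq (st : Setting S P U a c) (hw : w ≠ [])
    (h : shiftBy j c = wordPow w) (h0 : shiftBy j c ≠ zeroSeq) : c = a := by
  rcases st.c_cases with h1 | ⟨p, -, h2⟩
  · exact h1
  · exfalso
    apply h0
    have h3 := shiftBy_mul_wordPow hw (p.length + 1)
    rw [← h, shiftBy_shiftBy] at h3
    have h4 : 1 ≤ w.length := List.length_pos_iff.2 hw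
    have h5 : (p.length + 1) * 1 ≤ (p.length + 1) * w.length := Nat.mul_le_mul_left _ h4
    rw [← h3, h2, shiftBy_append_of_ge (by simp; omega)]
    rfl

theorem Setting.powS_mem (st : Setting S P U a c) (hW : W ≼ wordPow S) :
    wordPow S ∈ Surv a W := fun n =>
  ⟨hW.trans (st.fd.sl.le_shiftBy n), ((st.shift_powS_le n).trans_lt st.lt_a).le⟩

/-- No sequence of the survivor shift that starts below `σ^j c` can end in an orbit of `S^∞`. -/
theorem Setting.no_return_to_S (st : Setting S P U a c) (hj : S.length ≤ j)
    (rd : RetData S c j n C v)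
    (hw : w ≠ []) (hX : leftEnd C v ≼ wordPow w) (hWv : wordPow w ≼ wordPow (v ++ [true])) (m : ℕ) :
    ∀ x ∈ Surv a (wordPow w), ∀ i, shiftBy m x = shiftBy i (wordPow S) →
      ¬ x ≼ shiftBy j c ∧
      ¬ (wordPow (C ++ [false]) ≼ x ∧ (x = wordPow (C ++ [false]) → wordPow w = leftEnd C v)) := by
  induction m using Nat.strong_induction_on with
  | _ m ih =>
  intro x hx i hi
  have hWS := hWv.trans_lt (st.powV_lt_powS rd)
  have hx0 := hx 0
  rw [shiftBy_zero] at hx0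
  have hxc : x ≼ c := hx0.2.trans st.le_c
  rcases Nat.eq_zero_or_pos m with rfl | hm
  · rw [shiftBy_zero] at hi
    constructor
    · intro h
      have h1 : wordPow S ≼ x := by rw [hi]; exact st.fd.sl.le_shiftBy i
      exact (h1.trans (h.trans rd.D_le)).not_lt (st.powV_lt_powS rd)
    · rintro ⟨h1, h2⟩
      have h3 : x ≼ wordPow (wA P) := by rw [hi]; exact st.shift_powS_le i
      have h4 := st.powA_le_E hj rd.block_C
      -- What remains is x = A^∞ = (C0)^∞. By the second condition on x this forces w^∞ = X, so the
      -- periodic sequence w^∞ recurs as a shift of A^∞ and is therefore ≽ S^∞, a contradiction.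
      have h5 := h2 ((h3.trans h4).antisymm h1)
      have h6 : wordPow (C ++ [false]) = wordPow (wA P) := (h1.trans h3).antisymm h4
      rw [leftEnd, h6] at h5
      have h7 := shiftBy_mul_wordPow hw (v ++ [false]).length
      have h8 : 1 ≤ w.length := List.length_pos_iff.2 hw
      have h9 : (v ++ [false]).length * 1 ≤ (v ++ [false]).length * w.length :=
        Nat.mul_le_mul_left _ h8
      conv_lhs at h7 => rw [h5]
      rw [shiftBy_append_of_ge (by omega)] at h7
      have h10 := st.le_shift_powA ((v ++ [false]).length * w.length - (v ++ [false]).length)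
      rw [h7] at h10
      exact h10.not_lt hWS
  · have step : ∀ (y : Word) (x' : Seq), x = y ⊹ x' → y ≠ [] → x' ∈ Surv a (wordPow w) ∧
        m - y.length < m ∧ ∃ i', shiftBy (m - y.length) x' = shiftBy i' (wordPow S) := by
      intro y x' e hy
      have hyl : 1 ≤ y.length := List.length_pos_iff.2 hy
      have e' : x' = shiftBy y.length x := by rw [e, shiftBy_length_append]
      refine ⟨e' ▸ Surv.shiftBy hx _, by omega, i + (y.length - m), ?_⟩
      rw [e', shiftBy_shiftBy, ← shiftBy_shiftBy (y.length - m) i, ← hi, shiftBy_shiftBy]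
      congr 1; omega
    constructor
    · intro h
      rcases rd.split_low (hX.trans hx0.1) h with ⟨x', e, h1⟩ | ⟨x', e, h1⟩
      · obtain ⟨g1, g2, i', g3⟩ := step _ _ e (by simp)
        refine (ih _ g2 x' g1 i' g3).2 ⟨h1, fun e2 => ?_⟩
        rw [e2] at e
        have h2 := hx0.1
        rw [e] at h2
        exact h2.antisymm hX
      · obtain ⟨g1, g2, i', g3⟩ := step _ _ e (by simp)
        exact (ih _ g2 x' g1 i' g3).1 h1
    · rintro ⟨h, he⟩
      rcases rd.split_high h hxc with ⟨x', e, h1⟩ | ⟨x', e, h1⟩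
      · obtain ⟨g1, g2, i', g3⟩ := step _ _ e (by simp)
        refine (ih _ g2 x' g1 i' g3).2 ⟨h1, fun e2 => he ?_⟩
        rw [e, e2, wordPow_eq (by simp)]
      · obtain ⟨g1, g2, i', g3⟩ := step _ _ e (by simp)
        exact (ih _ g2 x' g1 i' g3).1 h1

/-- The witness is the word C1, which occurs in the survivor C1w^∞, against the sequence S^∞: what
follows C1 is at most D, hence trapped. -/
theorem Setting.not_isTransitive (st : Setting S P U a c) (hc : IsCut c S.length k j)
    (rd : RetData S c j n C v) (hw : SL w) (hadm : ∀ n, shiftBy n (wordPow w) ≺ a)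
    (hX : leftEnd C v ≼ wordPow w)
    (hW : wordPow w ≺ wordPow (v ++ [true]) ∨
      (wordPow w = wordPow (v ++ [true]) ∧ shiftBy j c = wordPow (v ++ [true]))) :
    ¬ IsTransitive (Surv a (wordPow w)) := by
  have hWv : wordPow w ≼ wordPow (v ++ [true]) := by
    rcases hW with h | h
    · exact h.le
    · rw [h.1]; exact seqLE.rfl
  -- Between X and v1^∞ the sequence w^∞ begins with v0, and so lies below D; a start v1 would give
  -- w^∞ ≽ v1^∞, since w^∞ is minimal among its shifts.
  have hWD : wordPow w ≼ shiftBy j c := by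
    rcases hW with h | ⟨h1, h2⟩
    · have h1 := h.le
      rw [← wordPow_eq (w := v ++ [true]) (by simp)] at h1
      rcases between hX h1 with ⟨x', e, -⟩ | ⟨x', e, -⟩
      · rw [e, rd.D_eq]; exact (below_concat v _ _).le
      · exfalso
        have h3 := hw.le_shiftBy (v ++ [true]).length
        conv_rhs at h3 => rw [e, shiftBy_length_append]
        have h4 : (v ++ [true]) ⊹ wordPow w ≼ wordPow w := by
          conv_rhs => rw [e]
          rw [append_le_append_iff]; exact h3
        exact h.not_le (wordPow_le_of_append_le (by simp) h4)
    · rw [h1, h2]; exact seqLE.rfl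
  have hWS : wordPow w ≼ wordPow S := hWv.trans (st.powV_lt_powS rd).le
  have hlow : Low c S.length k (wordPow w) := (st.low_powV hc rd).anti hWv
  have hmem : (C ++ [true]) ⊹ wordPow w ∈ Surv a (wordPow w) := by
    have hlow : ∀ n, wordPow w ≼ shiftBy n ((C ++ [true]) ⊹ wordPow w) :=
      forall_shift_append (K := fun t => wordPow w ≼ t)
        (fun p y e _ => st.le_suffix_cut hc hWS hlow (rd.block_C.trans e) seqLE.rfl)
        hw.le_shiftBy
    have hup : ∀ n, shiftBy n ((C ++ [true]) ⊹ wordPow w) ≼ c ∧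
        (shiftBy n ((C ++ [true]) ⊹ wordPow w) = c → c = a) := by
      refine forall_shift_append (K := fun t => t ≼ c ∧ (t = c → c = a)) (fun p y e _ => ?_)
        (fun n => ?_)
      · have h1 := suffix_block (rd.block_C.trans e)
        have h2 : y ⊹ shiftBy j c ≼ c := by rw [h1]; exact st.shift_c_le _
        refine ⟨(append_le_append_iff.2 hWD).trans h2, fun e2 => ?_⟩
        conv_rhs at h2 => rw [← e2]
        rw [append_le_append_iff] at h2
        have h3 := h2.antisymm hWD
        exact st.eq_a_of_shift_eq hw.1 h3 rd.ne_zero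
      · have h1 := (hadm n).trans_le st.le_c
        exact ⟨h1.le, fun e => absurd e h1.ne⟩
    exact fun n => ⟨hlow n, st.le_a hup n⟩
  intro htr
  obtain ⟨t, ht⟩ := htr (C ++ [true]) ⟨_, hmem, 0, block_wordAppend _ _⟩ _ (st.powS_mem hWS)
  rw [append_wordAppend] at ht
  have h1 : t ⊹ wordPow S ∈ Surv a (wordPow w) := by
    have := Surv.shiftBy ht (C ++ [true]).length
    rwa [shiftBy_length_append] at this
  have h2 := (ht 0).2.trans st.le_c
  rw [shiftBy_zero] at h2
  conv_rhs at h2 => rw [rd.c_eq]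
  rw [append_le_append_iff] at h2
  exact (st.no_return_to_S (st.cut_le_first hc).1 rd hw.1 hX hWv t.length _ h1 0
    (by simp)).1 h2

end nontransitive

/-! ### `β`-Lyndon words -/

section star
variable {S P U v w : Word} {c : Seq} {β : ℝ}

theorem isBetaLyndon_iff (h1 : 1 < β) (h2 : β < 2) :
    IsBetaLyndon β w ↔ SL w ∧ Adm β (wordPow w) := by
  constructor
  · rintro ⟨h, t, ht, e⟩
    exact ⟨h.SL, e ▸ adm_greedy h1 h2.le ht⟩
  · rintro ⟨h, ha⟩
    exact ⟨h.isLyndon, proj β (wordPow w), ⟨proj_nonneg h1 _, ha.proj_lt_one h1 h2.le⟩,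
      ha.greedy_proj h1 h2.le⟩

theorem Setting.adm_powS (st : Setting S P U (quasiGreedy β) c) : Adm β (wordPow S) :=
  fun n => (st.shift_powS_le n).trans_lt st.lt_a

/-- Approximation of an aperiodic shift-minimal Y from below. Replacing a later tail of Y by the
smaller periodic sequence only lowers each shift, and strictly. -/
theorem adm_wordPow_block {Y : Seq} {L : ℕ} (hY : ∀ n, shiftBy n Y ≼ quasiGreedy β) (hL : 1 ≤ L)
    (hlt : ∀ n, 1 ≤ n → Y ≺ shiftBy n Y) :
    wordPow (block Y 0 L) ≺ Y ∧ Adm β (wordPow (block Y 0 L)) := by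
  have hne : block Y 0 L ≠ [] := by
    intro e
    have := congrArg List.length e
    simp at this; omega
  have hmin : ∀ n, Y ≼ shiftBy n Y := by
    intro n
    rcases Nat.eq_zero_or_pos n with rfl | hn
    · rw [shiftBy_zero]; exact seqLE.rfl
    · exact (hlt n hn).le
  have h1 : wordPow (block Y 0 L) ≼ Y := by
    refine wordPow_le_of_append_le_min hmin hne (x := shiftBy L Y) ?_
    rw [block_append_shiftBy]; exact seqLE.rfl
  have h2 : wordPow (block Y 0 L) ≺ Y := by
    refine h1.lt_of_ne fun e => ?_
    have h3 := shiftBy_length_wordPow hne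
    rw [e, length_block] at h3
    exact (hlt L hL).ne h3.symm
  refine ⟨h2, fun n => ?_⟩
  refine forall_shift_wordPow (K := fun t => t ≺ quasiGreedy β) hne ?_ n
  intro p y e hy
  have h3 : y ⊹ shiftBy L Y = shiftBy p.length Y := suffix_block e
  have h4 := hY p.length
  rw [← h3] at h4
  exact (append_lt_append_iff.2 (h2.trans (hlt L hL))).trans_le h4

/-- Every Lyndon word `v` with `v^∞ ≼ S^∞` has a smallest `β`-Lyndon word above it. -/
theorem Setting.exists_star (st : Setting S P U (quasiGreedy β) c) (h1 : 1 < β) (h2 : β < 2)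
    (hv : SL v) (hvS : wordPow v ≼ wordPow S) : ∃ u, IsStar β v u := by
  let T : Set Seq := {t | ∃ u, SL u ∧ Adm β (wordPow u) ∧ wordPow v ≼ wordPow u ∧ t = wordPow u}
  have hT : T.Nonempty := ⟨_, S, st.fd.sl, st.adm_powS, hvS, rfl⟩
  obtain ⟨Y, hY1, hY2⟩ := exists_lexInf T hT
  suffices h : Y ∈ T by
    obtain ⟨u, g1, g2, g3, g4⟩ := h
    refine ⟨u, ⟨(isBetaLyndon_iff h1 h2).2 ⟨g1, g2⟩, g3⟩, fun u' hu' hle => ?_⟩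
    obtain ⟨g5, g6⟩ := (isBetaLyndon_iff h1 h2).1 hu'
    rw [← g4]
    exact hY1 _ ⟨u', g5, g6, hle, rfl⟩
  have hmin : ∀ n, Y ≼ shiftBy n Y := by
    intro n
    refine le_of_approx fun N => ?_
    obtain ⟨t, ht, hag⟩ := hY2 (n + N)
    refine ⟨shiftBy n t, ?_, fun i hi => hag _ (by omega)⟩
    have := hY1 t ht
    obtain ⟨u, g1, -, -, rfl⟩ := ht
    exact this.trans (g1.le_shiftBy n)
  have hup : ∀ n, shiftBy n Y ≼ quasiGreedy β := by
    intro n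
    refine approx_le fun N => ?_
    obtain ⟨t, ⟨u, -, g2, -, rfl⟩, hag⟩ := hY2 (n + N)
    exact ⟨shiftBy n (wordPow u), (g2 n).le, fun i hi => hag _ (by omega)⟩
  have hvY : wordPow v ≼ Y := by
    refine le_of_approx fun N => ?_
    obtain ⟨t, ⟨u, -, -, g3, rfl⟩, hag⟩ := hY2 N
    exact ⟨_, g3, hag⟩
  -- An aperiodic infimum Y would be strictly approached from below by powers of its long Lyndon
  -- prefixes, which still lie above v^∞ and are candidates themselves.
  by_cases hlt : ∀ n, 1 ≤ n → Y ≺ shiftBy n Y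
  · exfalso
    have hvY' : wordPow v ≺ Y := by
      refine hvY.lt_of_ne fun e => ?_
      have h3 := shiftBy_length_wordPow hv.1
      rw [e] at h3
      exact (hlt _ (List.length_pos_iff.2 hv.1)).ne h3.symm
    obtain ⟨N, hN⟩ := hvY'.exists_depth
    obtain ⟨L, hL, hsl⟩ := exists_SL_initial hlt (N + 1)
    obtain ⟨h3, h4⟩ := adm_wordPow_block hup (by omega : 1 ≤ L) hlt
    have h5 : wordPow v ≺ wordPow (block Y 0 L) := by
      refine hN _ _ (fun _ _ => rfl) fun i hi => ?_
      rw [← wordPow_eq hsl.1]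
      conv_rhs => rw [← block_append_shiftBy Y L]
      exact wordAppend_lt_congr (by simp; omega)
    exact (hY1 _ ⟨_, hsl, h4, h5.le, rfl⟩).not_lt h3
  · push Not at hlt
    obtain ⟨m, hm, hm2⟩ := hlt
    have hper : shiftBy m Y = Y := (seq_not_lt.1 hm2).antisymm (hmin m)
    obtain ⟨y, hy, e⟩ := exists_SL_of_periodic hmin ⟨m, hm, hper⟩
    by_cases hadm : Adm β Y
    · exact ⟨y, hy, e ▸ hadm, e ▸ hvY, e⟩
    -- If the periodic Y meets α(β) at time n, a candidate larger than Y that agrees with it on n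
    -- digits would have a shift above α(β). So Y is itself a candidate.
    · obtain ⟨n, hn⟩ : ∃ n, shiftBy n Y = quasiGreedy β := by
        by_contra hne
        push Not at hne
        exact hadm fun n => (hup n).lt_of_ne (hne n)
      obtain ⟨t, ht, hag⟩ := hY2 n
      by_cases hte : t = Y
      · exact hte ▸ ht
      · exfalso
        have h3 := (hY1 t ht).lt_of_ne (Ne.symm hte)
        obtain ⟨u, -, g2, -, rfl⟩ := ht
        rw [← block_append_shiftBy Y n, ← block_append_shiftBy (wordPow u) n,
          block_congr hag, append_lt_append_iff, hn] at h3
        exact h3.not_le (g2 n).le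

end star

/-! ### Transitive survivor shifts -/

/-- A single depth, one past the first difference of x and y, serves all z ≽ y at once; it is
applied to all suffixes of a word simultaneously. -/
theorem seqLT.exists_depth_of_le {x y : Seq} (h : x ≺ y) :
    ∃ N, ∀ z z' : Seq, y ≼ z → (∀ i < N, z' i = z i) → x ≺ z' := by
  obtain ⟨n, h1, h2, h3⟩ := seqLT_iff.1 h
  refine ⟨n + 1, fun z z' hz hag => ?_⟩
  rw [← seq_not_le]
  intro hle
  have h4 : z ≺ y := by
    rcases hle.lt_or_eq with h5 | h5
    · obtain ⟨m, g1, g2, g3⟩ := seqLT_iff.1 h5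
      rcases lt_or_ge m n with hm | hm
      · refine seqLT_iff.2 ⟨m, fun i hi => ?_, ?_, ?_⟩
        · rw [← hag i (by omega), g1 i hi, h1 i (by omega)]
        · rw [← hag m (by omega), g2]
        · rw [← h1 m hm, g3]
      · have hzn : z n = false := by
          rw [← hag n (by omega)]
          rcases Nat.lt_or_eq_of_le hm with hm | rfl
          · rw [g1 n hm, h2]
          · exact g2
        refine seqLT_iff.2 ⟨n, fun i hi => ?_, hzn, h3⟩
        rw [← hag i (by omega), g1 i (by omega), h1 i hi]
    · subst h5
      exact seqLT_iff.2 ⟨n, fun i hi => by rw [← hag i (by omega), h1 i hi],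
        by rw [← hag n (by omega), h2], h3⟩
  exact hz.not_lt h4

/-- `w ⊹ w ⊹ … ⊹ x`. -/
def repAppend (w : Word) : ℕ → Seq → Seq
  | 0, x => x
  | m + 1, x => w ⊹ repAppend w m x

theorem repAppend_agree {w : Word} (hw : w ≠ []) (x : Seq) (m : ℕ) :
    ∀ i < m, repAppend w m x i = wordPow w i := by
  have hl : 1 ≤ w.length := List.length_pos_iff.2 hw
  induction m with
  | zero => intro i hi; omega
  | succ m ih =>
    intro i hi
    rw [repAppend, ← wordPow_eq hw]
    rcases lt_or_ge i w.length with h | h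
    · exact wordAppend_lt_congr h
    · rw [wordAppend_ge h, wordAppend_ge h]
      exact ih _ (by omega)

theorem append_agree {u : Word} {x y : Seq} {N : ℕ} (h : ∀ i < N, x i = y i) :
    ∀ i < N, (u ⊹ x) i = (u ⊹ y) i := by
  intro i hi
  rcases lt_or_ge i u.length with h' | h'
  · exact wordAppend_lt_congr h'
  · rw [wordAppend_ge h', wordAppend_ge h']
    exact h _ (by omega)

section transitive
variable {S P U C d v w u : Word} {a c x z W : Seq} {j n k r : ℕ}

/-- All shifts are between `W` and `c`, the latter strictly, and the orbit ends in that of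
`L(S)^∞`. -/
def Good (P : Word) (c W z : Seq) : Prop :=
  (∀ n, W ≼ shiftBy n z ∧ shiftBy n z ≺ c) ∧ ∃ m i, shiftBy m z = shiftBy i (wordPow (wA P))

theorem Good.shift (h : Good P c W z) (n : ℕ) : Good P c W (shiftBy n z) := by
  refine ⟨fun m => by rw [shiftBy_shiftBy]; exact h.1 _, ?_⟩
  obtain ⟨m, i, e⟩ := h.2
  refine ⟨m, i + n, ?_⟩
  rw [shiftBy_shiftBy, add_comm n m, ← shiftBy_shiftBy, e, shiftBy_shiftBy]

theorem Good.append (h : Good P c W z)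
    (hu : ∀ p y, u = p ++ y → y ≠ [] → W ≼ y ⊹ z ∧ y ⊹ z ≺ c) : Good P c W (u ⊹ z) := by
  refine ⟨forall_shift_append (K := fun t => W ≼ t ∧ t ≺ c) hu h.1, ?_⟩
  obtain ⟨m, i, e⟩ := h.2
  refine ⟨u.length + m, i, ?_⟩
  rw [← shiftBy_shiftBy, shiftBy_length_append, e]

theorem Setting.good_powA (st : Setting S P U a c) (hW : W ≼ wordPow S) :
    Good P c W (wordPow (wA P)) :=
  ⟨fun n => ⟨hW.trans (st.le_shift_powA n), st.shift_powA_lt_c n⟩, 0, 0, rfl⟩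

/-! ### Leaving the traps when no window contains W. -/

/-- `W` lies in no window. -/
def NoWindow (S : Word) (c W : Seq) : Prop :=
  ∀ k j n C v, IsCut c S.length k j → IsReturn c j n → RetData S c j n C v →
    leftEnd C v ≼ W → ¬ W ≺ wordPow (v ++ [true]) ∧
      ¬ (W = wordPow (v ++ [true]) ∧ shiftBy j c = wordPow (v ++ [true]))

theorem NoWindow.lt_leftEnd (h : NoWindow S c W) (hc : IsCut c S.length k j)
    (hr : IsReturn c j n) (rd : RetData S c j n C v) (hD : W ≺ shiftBy j c) :
    W ≺ leftEnd C v := by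
  rw [← seq_not_le]
  intro hle
  exact (h _ _ _ _ _ hc hr rd hle).1 (hD.trans_le rd.D_le)

theorem Setting.minus_append_lt_c (st : Setting S P U a c)
    (hd : shiftBy j c = (d ++ [true]) ⊹ x) {p q : Word} (e : d = p ++ q) (z : Seq) :
    (q ++ [false]) ⊹ z ≺ c := by
  refine (below_concat q z x).trans_le ?_
  have h2 := st.shift_c_le (j + p.length)
  rwa [← shiftBy_shiftBy, hd, e, List.append_assoc, shiftBy_append_append] at h2

theorem forall_suffix_minus {K : Seq → Prop} (h : ∀ p q, d = p ++ q → K ((q ++ [false]) ⊹ z)) :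
    ∀ p y, d ++ [false] = p ++ y → y ≠ [] → K (y ⊹ z) := by
  intro p y e hy
  obtain ⟨y', b, rfl⟩ : ∃ y' b, y = y' ++ [b] :=
    ⟨_, _, (List.dropLast_append_getLast hy).symm⟩
  rw [← List.append_assoc] at e
  obtain ⟨e1, e2⟩ := List.append_inj' e rfl
  cases e2
  exact h _ _ e1

/-- Induction over the cuts. At the first cut C0 = A and z = A^∞. Later z is a power of C0 followed
by the sequence z₀ of the previous cut, with exponent so large that W ≺ d0(C0)^∞ is already decided.
Since C = C₀1v, the bound W ≼ v0z₀ and z₀ ≺ C₀10^∞ let one prepend C0 repeatedly while staying ≽ z₀.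
-/
theorem Setting.exists_good_below (st : Setting S P U a c) (hWS : W ≼ wordPow S)
    (hno : NoWindow S c W) (hc : IsCut c S.length k j) :
    ∀ C d x, W ≺ shiftBy j c → block c 0 j = C ++ [true] →
      shiftBy j c = (d ++ [true]) ⊹ x → SL (d ++ [true]) →
      W ≺ (d ++ [false]) ⊹ wordPow (C ++ [false]) →
      ∃ z, z ≺ (C ++ [true]) ⊹ zeroSeq ∧ Good P c W z ∧ Good P c W ((d ++ [false]) ⊹ z) := by
  induction hc with
  | first =>
    intro C d x hWD hC hd hsl hWd
    have hCe : C = true :: P := by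
      have := st.block_c
      rw [hC] at this
      exact (List.append_inj' this rfl).1
    have g := st.good_powA hWS
    subst hCe
    refine ⟨wordPow (wA P), ?_, g, g.append ?_⟩
    · rw [← wordPow_eq (w := wA P) (by simp)]
      exact below_concat (true :: P) _ _
    · refine forall_suffix_minus (K := fun t => W ≼ t ∧ t ≺ c) fun p q e => ⟨?_, ?_⟩
      · exact (hWd.trans_le (st.minus_le_suffix hC hd hsl e)).le
      · exact st.minus_append_lt_c hd e _
  | @next k j n hc hr ih =>
    intro C d x hWD hC hd hsl hWd
    obtain ⟨C₀, v, rd⟩ := st.retData hc hr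
    have hWD₀ : W ≺ shiftBy j c := hWD.trans_le rd.next_le
    have hWX := hno.lt_leftEnd hc hr rd hWD₀
    obtain ⟨z₀, hz₀, g₀, gv⟩ := ih C₀ v _ hWD₀ rd.block_C rd.D_eq rd.sl hWX
    have hCe : C = (C₀ ++ [true]) ++ v := by
      rw [block_add, zero_add, rd.block_C, rd.block_v, ← List.append_assoc] at hC
      exact (List.append_inj' hC.symm rfl).1
    have hlow : Low c S.length k W := by
      intro k' j' n' hk h1 h2
      obtain ⟨C', v', rd'⟩ := st.retData h1 h2
      rw [rd'.block_v]
      exact (hWD₀.le.trans (hc.mono h1 hk.le).2).trans rd'.D_le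
    -- prepending `C⁻`
    have key : ∀ y, Good P c W y → z₀ ≼ y →
        z₀ ≼ (C ++ [false]) ⊹ y ∧ Good P c W ((C ++ [false]) ⊹ y) := by
      intro y hy hle
      constructor
      · refine hz₀.le.trans ?_
        rw [hCe]
        simp only [append_wordAppend]
        rw [append_le_append_iff, append_le_append_iff]
        exact zeroSeq_le _
      · refine hy.append (forall_suffix_minus (K := fun t => W ≼ t ∧ t ≺ c) ?_)
        intro p q e
        refine ⟨?_, st.minus_lt_c (j := j + n) (p := p) (by rw [hC, e, List.append_assoc]) _⟩
        rw [hCe] at e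
        have hv : ∀ p q, v = p ++ q → W ≼ (q ++ [false]) ⊹ y := by
          intro p q e
          have := (gv.1 p.length).1
          rw [e, List.append_assoc, shiftBy_append_append] at this
          exact this.trans (append_le_append_iff.2 hle)
        rcases List.append_eq_append_iff.1 e with ⟨t, e1, e2⟩ | ⟨t, e1, e2⟩
        · exact hv _ _ e2
        · rw [e2, List.append_assoc, append_wordAppend]
          exact st.le_suffix_cut hc hWS hlow (rd.block_C.trans e1) (hv [] v rfl)
    have key2 : ∀ m, z₀ ≼ repAppend (C ++ [false]) m z₀ ∧
        Good P c W (repAppend (C ++ [false]) m z₀) := by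
      intro m
      induction m with
      | zero => exact ⟨seqLE.rfl, g₀⟩
      | succ m ih => exact key _ ih.2 ih.1
    obtain ⟨N, hN⟩ := hWd.exists_depth_of_le
    refine ⟨repAppend (C ++ [false]) (N + 1) z₀, ?_, (key2 _).2, (key2 _).2.append ?_⟩
    · rw [repAppend]
      exact below_concat C _ _
    · refine forall_suffix_minus (K := fun t => W ≼ t ∧ t ≺ c) fun p q e => ⟨?_, ?_⟩
      · refine (hN _ _ (st.minus_le_suffix hC hd hsl e) (append_agree fun i hi => ?_)).le
        exact repAppend_agree (by simp) _ _ _ (by omega)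
      · exact st.minus_append_lt_c hd e _

theorem Setting.exists_last_cut (_st : Setting S P U a c) (hr : S.length ≤ r) :
    ∃ k j, IsCut c S.length k j ∧ j ≤ r ∧ ∀ n, IsReturn c j n → r < j + n := by
  by_contra hcon
  push Not at hcon
  have : ∀ m, ∃ k j, IsCut c S.length k j ∧ j ≤ r ∧ m ≤ j := by
    intro m
    induction m with
    | zero => exact ⟨1, _, IsCut.first, hr, by omega⟩
    | succ m ih =>
      obtain ⟨k, j, h1, h2, h3⟩ := ih
      obtain ⟨n, h4, h5⟩ := hcon k j h1 h2
      have := h4.2.1.1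
      exact ⟨_, _, h1.next h4, h5, by omega⟩
  obtain ⟨k, j, -, h2, h3⟩ := this (r + 1)
  omega

theorem exists_isReturn {m : ℕ} (h0 : shiftBy j c ≠ zeroSeq) (hm : 1 ≤ m)
    (h : shiftBy (j + m) c ≼ shiftBy j c) : ∃ n, IsReturn c j n ∧ n ≤ m := by
  classical
  have hex : ∃ m, 1 ≤ m ∧ shiftBy (j + m) c ≼ shiftBy j c := ⟨m, hm, h⟩
  exact ⟨Nat.find hex, ⟨h0, Nat.find_spec hex, fun i hi => Nat.find_min' hex hi⟩,
    Nat.find_min' hex ⟨hm, h⟩⟩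

/-- Beyond the first |S| digits, take the last cut j ≤ r. Let d1 be its return word or, if σ^j(c)
never returns, a long Lyndon prefix of it. Lowering the last digit of d1, which lies after position
r, and leaving the trap through `exists_good_below` gives a sequence just below σ^r(c). -/
theorem Setting.exists_good_lt (st : Setting S P U a c) (hWS : W ≼ wordPow S)
    (hno : NoWindow S c W) (hr : W ≺ shiftBy r c)
    (hlow : ∀ p y, block c 0 r = p ++ y → W ≼ y ⊹ W) :
    ∃ z, Good P c W z ∧ z ≺ shiftBy r c := by
  rcases lt_or_ge r S.length with h | h
  · refine ⟨_, (st.good_powA hWS).shift r, ?_⟩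
    have hr' : r ≤ (true :: P).length := by rw [st.fd.length] at h; simp; omega
    rw [← wordPow_eq (w := wA P) (by simp), st.c_eq, shiftBy_append_of_le (by simp at hr' ⊢; omega),
      shiftBy_append_of_le (by simp at hr' ⊢; omega), List.drop_append_of_le_length hr',
      List.drop_append_of_le_length hr']
    exact below_concat _ _ _
  · obtain ⟨k, j, hc, hjr, hret⟩ := st.exists_last_cut h
    obtain ⟨l, rfl⟩ := Nat.exists_eq_add_of_le hjr
    have hD : shiftBy j c = block c j l ⊹ shiftBy (j + l) c := (block_append_shiftBy' c j l).symm
    have hWD : W ≺ shiftBy j c := by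
      rw [hD]
      refine (hlow (block c 0 j) (block c j l) ?_).trans_lt (append_lt_append_iff.2 hr)
      rw [block_add, zero_add]
    have hD0 : shiftBy j c ≠ zeroSeq := by
      intro e
      rw [e] at hWD
      exact hWD.not_le (zeroSeq_le _)
    obtain ⟨C, hC⟩ := st.cut_block hc
    have hd : ∃ d x, shiftBy j c = (d ++ [true]) ⊹ x ∧ SL (d ++ [true]) ∧ l ≤ d.length ∧
        W ≺ (d ++ [false]) ⊹ wordPow (C ++ [false]) := by
      by_cases hex : ∃ n, IsReturn c j n
      · obtain ⟨n, hn⟩ := hex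
        obtain ⟨C', v, rd⟩ := st.retData hc hn
        have := hret n hn
        have e : C' = C := (List.append_inj' (rd.block_C.symm.trans hC) rfl).1
        subst e
        exact ⟨v, _, rd.D_eq, rd.sl, by have := rd.length_v; omega,
          hno.lt_leftEnd hc hn rd hWD⟩
      · have hlt : ∀ m, 1 ≤ m → shiftBy j c ≺ shiftBy m (shiftBy j c) := by
          intro m hm
          rw [← seq_not_le, shiftBy_shiftBy]
          intro hle
          obtain ⟨n, hn, -⟩ := exists_isReturn hD0 hm hle
          exact hex ⟨n, hn⟩
        obtain ⟨N, hN⟩ := hWD.exists_depth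
        obtain ⟨L, hL, hsl⟩ := exists_SL_initial hlt (l + N + 2)
        have hx := block_append_shiftBy (shiftBy j c) L
        obtain ⟨d, hde⟩ : ∃ d, block (shiftBy j c) 0 L = d ++ [true] := by
          obtain ⟨x, hx0⟩ := st.eq_zero_cons (st.cut_le_first hc).2
          have hl : (block (shiftBy j c) 0 L).length = L := length_block _ _ _
          generalize hw : block (shiftBy j c) 0 L = w at hsl hx hl ⊢
          match w, hsl, hx, hl with
          | [], _, _, hl => simp at hl; omega
          | [b], _, _, hl => simp at hl; omega
          | b :: b' :: w, hsl, hx, _ =>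
            have : b = false := by
              rw [hx0] at hx
              have := congrFun hx 0
              simpa [wordAppend] using this
            subst this
            exact hsl.eq_concat_true
        rw [hde] at hsl hx
        have hdl : L = d.length + 1 := by simpa using length_of_block hde
        refine ⟨d, _, hx.symm, hsl, by omega, hN _ _ (fun _ _ => rfl) fun i hi => ?_⟩
        conv_rhs => rw [← hx]
        rw [append_wordAppend, append_wordAppend]
        exact wordAppend_lt_congr (by omega)
    obtain ⟨d, x, hd1, hd2, hd3, hd4⟩ := hd
    obtain ⟨z, -, -, hz⟩ := st.exists_good_below hWS hno hc C d x hWD hC hd1 hd2 hd4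
    have hl : (d.take l).length = l := by simp [hd3]
    refine ⟨(d.drop l ++ [false]) ⊹ z, ?_, ?_⟩
    · have := hz.shift l
      rwa [shiftBy_append_of_le (by simp; omega), List.drop_append_of_le_length hd3] at this
    · have h3 := congrArg (shiftBy l) hd1
      rw [shiftBy_shiftBy, shiftBy_append_of_le (by simp; omega),
        List.drop_append_of_le_length hd3] at h3
      rw [h3]
      exact below_concat _ _ _

/-- A survivor above a sequence outside all windows that ends in `W` never meets `c`. -/
theorem Setting.shift_ne_c (st : Setting S P U a c) (hw : SL w)
    (hadm : ∀ n, shiftBy n (wordPow w) ≺ a) (hno : NoWindow S c (wordPow w))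
    (hu : u ⊹ wordPow w ∈ Surv a (wordPow w)) (i : ℕ) : shiftBy i (u ⊹ wordPow w) ≠ c := by
  intro e
  have hca : c = a := st.eq_a_of_le (e ▸ (hu i).2)
  have hge : ∀ m, wordPow w ≼ shiftBy m c := fun m => by
    rw [← e, shiftBy_shiftBy]; exact (hu _).1
  have hm : ∃ m, shiftBy m c = wordPow w := by
    rcases lt_or_ge u.length i with h | h
    · rw [shiftBy_append_of_ge h.le] at e
      exact absurd (e.trans hca) (hadm _).ne
    · refine ⟨u.length - i, ?_⟩
      rw [← e, shiftBy_shiftBy, Nat.add_sub_cancel' h, shiftBy_length_append]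
  obtain ⟨m, hm⟩ := hm
  obtain ⟨m, hmS, hm⟩ : ∃ m, S.length ≤ m ∧ shiftBy m c = wordPow w := by
    refine ⟨m + S.length * w.length, ?_, ?_⟩
    · have : S.length * 1 ≤ S.length * w.length :=
        Nat.mul_le_mul_left _ (List.length_pos_iff.2 hw.1)
      omega
    · rw [← shiftBy_shiftBy, hm, shiftBy_mul_wordPow hw.1]
  -- Since σ^m(c) = w^∞ is minimal along the orbit, a return occurs at m at the latest, so the last
  -- cut is m itself. Then σ^m(c) = v1^∞ = w^∞, which is the closed endpoint excluded by `NoWindow`.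
  obtain ⟨k, j, hc, hjm, hret⟩ := st.exists_last_cut hmS
  have h0 : shiftBy j c ≠ zeroSeq := by rw [hca]; exact st.a_ne_zero j
  rcases Nat.lt_or_eq_of_le hjm with hlt | rfl
  · obtain ⟨n, hn, hnm⟩ := exists_isReturn (m := m - j) h0 (by omega) (by
      rw [Nat.add_sub_cancel' hjm, hm]; exact hge j)
    have := hret n hn
    omega
  · obtain ⟨n, hn, -⟩ := exists_isReturn (m := w.length) h0 (List.length_pos_iff.2 hw.1) (by
      rw [← shiftBy_shiftBy, hm, shiftBy_length_wordPow hw.1]; exact seqLE.rfl)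
    obtain ⟨C, v, rd⟩ := st.retData hc hn
    have h1 : shiftBy (j + n) c = wordPow w :=
      (rd.next_le.trans (by rw [hm]; exact seqLE.rfl)).antisymm (hge _)
    have h2 := rd.D_eq
    rw [h1, hm] at h2
    have h3 := eq_wordPow (by simp) h2
    exact (hno _ _ _ _ _ hc hn rd (by rw [h3]; exact (leftEnd_lt_powV C v).le)).2
      ⟨h3, hm.trans h3⟩

/-! ### Bridging -/

theorem exists_suffix_rep {A : Word} {M : ℕ} {ρ p y : Word}
    (e : (List.replicate M A).flatten ++ ρ = p ++ y) :
    (∃ p', ρ = p' ++ y) ∨ ∃ p' s t, A = p' ++ s ∧ s ≠ [] ∧ y = s ++ t := by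
  induction M generalizing p with
  | zero => exact Or.inl ⟨p, by simpa using e⟩
  | succ M ih =>
    rw [List.replicate_succ, List.flatten_cons, List.append_assoc] at e
    rcases List.append_eq_append_iff.1 e with ⟨t, e1, e2⟩ | ⟨t, e1, e2⟩
    · exact ih e2
    · by_cases ht : t = []
      · subst ht
        exact ih (p := []) (by simpa using e2.symm)
      · exact Or.inr ⟨p, t, _, e1, ht, e2⟩

theorem repAppend_eq (A : Word) (M : ℕ) (x : Seq) :
    repAppend A M x = (List.replicate M A).flatten ⊹ x := by
  induction M with
  | zero => simp [repAppend, nil_wordAppend]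
  | succ M ih => rw [repAppend, ih, List.replicate_succ, List.flatten_cons, append_wordAppend]

theorem repAppend_wordPow {A : Word} (hA : A ≠ []) (M : ℕ) :
    repAppend A M (wordPow A) = wordPow A := by
  induction M with
  | zero => rfl
  | succ M ih => rw [repAppend, ih, wordPow_eq hA]

/-- Every survivor can be entered from the periodic orbit of `L(S)^∞`. -/
theorem Setting.exists_bridge (st : Setting S P U a c) (hWB : W ≼ seqB P) (z : Seq) :
    ∃ ρ ρ' : Word, wA P = ρ ++ ρ' ∧ ∀ M p y, (List.replicate M (wA P)).flatten ++ ρ = p ++ y →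
      y ≠ [] → W ≼ y ⊹ z ∧ y ⊹ z ≺ c := by
  classical
  have hA : wA P ≠ [] := by simp
  have hAl : (wA P).length = S.length := by rw [st.fd.length]; simp
  have hshift : ∀ {ρ ρ' : Word} {M p y}, wA P = ρ ++ ρ' →
      (List.replicate M (wA P)).flatten ++ ρ = p ++ y →
      y ⊹ ρ' ⊹ wordPow (wA P) = shiftBy p.length (wordPow (wA P)) := by
    intro ρ ρ' M p y e1 e2
    have h1 : (List.replicate M (wA P)).flatten ⊹ ρ ⊹ ρ' ⊹ wordPow (wA P) = wordPow (wA P) := by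
      rw [← append_wordAppend ρ, ← e1, wordPow_eq hA, ← repAppend_eq, repAppend_wordPow hA]
    rw [← append_wordAppend, e2, append_wordAppend] at h1
    conv_rhs => rw [← h1, shiftBy_length_append]
  by_cases hex : ∃ q < S.length, z ≼ shiftBy q (wordPow (wA P))
  -- The switch from A^∞ to z is made where the remaining tail T of A^∞ is the smallest shift ≽ z.
  -- The upper bound is then immediate.
  · obtain ⟨q, hq, hmin⟩ := Finset.exists_min_image
      ((Finset.range S.length).filter fun q => z ≼ shiftBy q (wordPow (wA P)))
      (fun q => toLex (shiftBy q (wordPow (wA P))))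
      (by obtain ⟨q, h1, h2⟩ := hex; exact ⟨q, Finset.mem_filter.2 ⟨Finset.mem_range.2 h1, h2⟩⟩)
    rw [Finset.mem_filter, Finset.mem_range] at hq
    obtain ⟨hq1, hq2⟩ := hq
    have hT : shiftBy q (wordPow (wA P)) = (wA P).drop q ⊹ wordPow (wA P) := by
      conv_lhs => rw [← wordPow_eq hA]
      rw [shiftBy_append_of_le (by omega)]
    refine ⟨(wA P).take q, (wA P).drop q, (List.take_append_drop _ _).symm, ?_⟩
    intro M p y e hy
    have hyT := hshift (List.take_append_drop q (wA P)).symm e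
    rw [← hT] at hyT
    have hSy : wordPow S ≼ y ⊹ shiftBy q (wordPow (wA P)) := by
      rw [hyT]; exact st.le_shift_powA _
    constructor
    · refine hWB.trans ?_
      -- Suppose yz ≺ S⁻A^∞, whereas yT ≽ S^∞. As S⁻ and S differ only in the last digit, y is a
      -- prefix of 0P and z lies below the matching tail of S⁻A^∞. That tail is a shift of A^∞, so T
      -- is at most that tail by minimality, contradicting yT ≽ S^∞.
      rw [← seq_not_lt]
      intro hlt
      rw [← wordPow_eq st.S_ne_nil, st.S_eq] at hSy
      rw [seqB] at hlt
      rcases lt_or_ge (P.length + 1) y.length with hl | hl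
      · obtain ⟨y₁, y₂, hy₁, rfl⟩ : ∃ y₁ y₂ : Word, y₁.length = P.length + 2 ∧ y = y₁ ++ y₂ :=
          ⟨y.take (P.length + 2), _, by simp; omega, (List.take_append_drop _ _).symm⟩
        rw [append_wordAppend y₁] at hSy hlt
        have h1 : Below (wSm P) y₁ := by
          rcases below_of_le (by simp [hy₁]) hSy with h2 | ⟨h2, -⟩
          · exact (below_concat (false :: P)).trans h2
          · rw [← h2]; exact below_concat (false :: P)
        exact hlt.not_le (h1 _ _).le
      · obtain ⟨g₀, g, hg₀, hg⟩ : ∃ g₀ g : Word, g₀.length = y.length ∧ false :: P = g₀ ++ g :=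
          ⟨(false :: P).take y.length, _, by simp; omega, (List.take_append_drop _ _).symm⟩
        have e1 : wSm P = g₀ ++ (g ++ [false]) := by
          rw [← List.append_assoc, ← hg]
        have e2 : false :: P ++ [true] = g₀ ++ (g ++ [true]) := by
          rw [← List.append_assoc, ← hg]
        rw [e2, append_wordAppend] at hSy
        rw [e1, append_wordAppend] at hlt
        have h1 : y = g₀ ∧ z ≺ (g ++ [false]) ⊹ wordPow (wA P) := by
          rcases below_of_lt hg₀.symm hlt with h2 | h2
          · exfalso
            rcases below_of_le hg₀ hSy with h3 | ⟨h3, -⟩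
            · exact h2.asymm h3
            · rw [h3] at h2; exact Below.irrefl _ h2
          · exact h2
        obtain ⟨rfl, h2⟩ := h1
        -- the tail of `S⁻ L(S)^∞` is a shift of `L(S)^∞`
        have h3 : (g ++ [false]) ⊹ wordPow (wA P) = shiftBy y.length (wordPow (wA P)) := by
          cases y with
          | nil => exact absurd rfl hy
          | cons b y =>
            have e3 : P = y ++ g := (List.cons.inj hg).2
            have e4 : wA P = (true :: y) ++ (g ++ [false]) := by
              rw [wA]; conv_lhs => rw [e3]
              simp
            exact suffix_append_wordPow (p := true :: y) hA e4
        rw [h3] at h2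
        have h4 : shiftBy q (wordPow (wA P)) ≼ shiftBy y.length (wordPow (wA P)) :=
          hmin y.length (by
            rw [Finset.mem_filter, Finset.mem_range, st.fd.length]
            exact ⟨by omega, h2.le⟩)
        have h5 := hSy.trans (append_le_append_iff.2 h4)
        rw [← h3, append_le_append_iff] at h5
        exact h5.not_lt (below_concat g _ _)
    · refine (append_le_append_iff.2 hq2).trans_lt ?_
      rw [hyT]
      exact st.shift_powA_lt_c _
  -- Now z exceeds every shift of A^∞, so only the upper bound matters. Every suffix of A ends in 0
  -- where the corresponding shift of c has 1, so it is below c for any continuation.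
  · refine ⟨[], wA P, rfl, ?_⟩
    intro M p y e hy
    have h1 : wordPow (wA P) ≼ z := by
      rcases seq_le_total z (wordPow (wA P)) with h | h
      · exact absurd ⟨0, st.length_pos, by rwa [shiftBy_zero]⟩ hex
      · exact h
    have hyT := hshift (ρ' := wA P) rfl e
    rw [wordPow_eq hA] at hyT
    constructor
    · refine (hWB.trans st.seqB_lt_powS.le).trans (seqLE.trans ?_ (append_le_append_iff.2 h1))
      rw [hyT]
      exact st.le_shift_powA _
    · rcases exists_suffix_rep e with ⟨p', e1⟩ | ⟨p', s, t, e1, hs, rfl⟩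
      · exact absurd (List.append_eq_nil_iff.1 e1.symm).2 hy
      · rw [append_wordAppend]
        have := forall_suffix_minus (K := fun x => x ≺ c) (d := true :: P) (z := t ⊹ z) ?_ p' s e1 hs
        · exact this
        · intro p q e2
          refine st.minus_lt_c (j := S.length) (p := p) ?_ _
          rw [st.block_c, ← List.append_assoc, ← e2]

theorem exists_max_suffix (x : Seq) (u : Word) : ∃ r, (∃ p, u = p ++ block x 0 r) ∧
    ∀ r', (∃ p, u = p ++ block x 0 r') → r' ≤ r := by
  classical
  have h0 := Nat.findGreatest_spec (P := fun r => ∃ p, u = p ++ block x 0 r)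
    (Nat.zero_le u.length) ⟨u, by simp [block]⟩
  refine ⟨_, h0, fun r' hr' => Nat.le_findGreatest ?_ hr'⟩
  obtain ⟨t, ht⟩ := hr'
  have := congrArg List.length ht
  simp at this; omega

/-- Remove the longest suffix of u that is a prefix of w^∞ and continue with w^∞. By maximality the
lower bound for longer suffixes is decided inside u, and the upper bound persists because w^∞ is the
smallest tail allowed. -/
theorem exists_prolongation {y : Seq} {i : ℕ} (hw : SL w)
    (hadm : ∀ n, shiftBy n (wordPow w) ≺ a) (hy : y ∈ Surv a (wordPow w))
    (hu : block y i u.length = u) :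
    ∃ u₁ r, u = u₁ ++ block (wordPow w) 0 r ∧ u₁ ⊹ wordPow w ∈ Surv a (wordPow w) := by
  set W := wordPow w with hWdef
  obtain ⟨r, ⟨u₁, hu₁⟩, hmax⟩ := exists_max_suffix W u
  refine ⟨u₁, r, hu₁, ?_⟩
  have hy0 : shiftBy i y = u ⊹ shiftBy (i + u.length) y := by
    conv_rhs => rw [← hu]
    rw [length_block, block_append_shiftBy']
  set y' := shiftBy (i + u.length) y
  have hsuf : ∀ p s, u = p ++ s → W ≼ s ⊹ y' ∧ s ⊹ y' ≼ a := by
    intro p s e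
    have := hy (i + p.length)
    rwa [← shiftBy_shiftBy, hy0, e, shiftBy_append_append] at this
  refine forall_shift_append (K := fun t => W ≼ t ∧ t ≼ a) ?_
    fun n => ⟨hw.le_shiftBy n, (hadm n).le⟩
  intro p s e hs
  have e1 : u = p ++ (s ++ block W 0 r) := by rw [hu₁, e, List.append_assoc]
  have hW : W = block W 0 r ⊹ shiftBy r W := (block_append_shiftBy W r).symm
  constructor
  · have h1 := (hsuf _ _ e1).1
    conv_lhs at h1 => rw [← block_append_shiftBy W (s.length + r)]
    rcases below_of_le (by simp) h1 with h2 | ⟨h2, -⟩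
    · have h3 := (h2 (shiftBy (s.length + r) W) (shiftBy r W)).le
      rw [block_append_shiftBy, append_wordAppend, ← hW] at h3
      exact h3
    · exfalso
      have := hmax (s.length + r) ⟨p, by rw [e1, h2]⟩
      have := List.length_pos_iff.2 hs
      omega
  · refine seqLE.trans ?_ (hsuf _ _ e1).2
    rw [append_wordAppend, append_le_append_iff]
    exact (hsuf _ _ hu₁).1

/-- The dual of `exists_prolongation`: the danger is now c, so r is the length of the longest suffix
of u that is a prefix of c, and the new tail g is chosen below σ^r(c). Shorter suffixes that are
prefixes of c are harmless because shifts of c are at most c. -/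
theorem Setting.exists_good_prolongation (st : Setting S P U a c) (hw : SL w)
    (hadm : ∀ n, shiftBy n (wordPow w) ≺ a) (hWS : wordPow w ≼ wordPow S)
    (hno : NoWindow S c (wordPow w)) (hu : u ⊹ wordPow w ∈ Surv a (wordPow w)) :
    ∃ g, Good P c (wordPow w) (u ⊹ g) := by
  classical
  set W := wordPow w with hWdef
  have hsuf : ∀ p s, u = p ++ s → W ≼ s ⊹ W ∧ s ⊹ W ≺ c := by
    intro p s e
    have h1 := hu p.length
    have h2 := st.shift_ne_c hw hadm hno hu p.length
    rw [e, shiftBy_append_append] at h1 h2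
    exact ⟨h1.1, (h1.2.trans st.le_c).lt_of_ne h2⟩
  obtain ⟨r, ⟨p₀, hr⟩, hmax⟩ := exists_max_suffix c u
  have hWr : W ≺ shiftBy r c := by
    have h1 := (hsuf _ _ hr).2
    conv_rhs at h1 => rw [← block_append_shiftBy c r]
    rwa [append_lt_append_iff] at h1
  obtain ⟨g, hg, hgr⟩ := st.exists_good_lt hWS hno hWr (fun p y e =>
    (hsuf (p₀ ++ p) y (by rw [hr, e, List.append_assoc])).1)
  refine ⟨g, hg.append fun p y e hy => ⟨?_, ?_⟩⟩
  · refine (hsuf p y e).1.trans (append_le_append_iff.2 ?_)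
    have := (hg.1 0).1
    rwa [shiftBy_zero] at this
  · have h1 := (hsuf p y e).2
    rw [← block_append_shiftBy c y.length] at h1 ⊢
    rcases below_of_lt (by simp) h1 with h2 | ⟨h2, -⟩
    · exact h2 _ _
    · have hyr := hmax y.length ⟨p, by rw [← h2, e]⟩
      obtain ⟨t, ht⟩ : ∃ t, block c 0 r = t ++ y := by
        rcases List.append_eq_append_iff.1 (hr.symm.trans e) with ⟨t, -, e2⟩ | ⟨t, -, e2⟩
        · exact ⟨t, e2⟩
        · have := congrArg List.length e2
          simp at this
          have ht : t = [] := List.length_eq_zero_iff.1 (by omega)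
          subst ht
          exact ⟨[], by simpa using e2.symm⟩
      have h3 := suffix_block ht
      have h4 := st.shift_c_le t.length
      rw [← h3] at h4
      conv_rhs at h4 => rw [← block_append_shiftBy c y.length, ← h2]
      rw [append_le_append_iff] at h4
      rw [← h2, append_lt_append_iff]
      exact hgr.trans_le h4

theorem Good.exists_tail (h : Good P c W (u ⊹ z)) :
    ∃ u₃, u ⊹ z = (u ++ u₃) ⊹ wordPow (wA P) := by
  obtain ⟨m, i, e⟩ := h.2
  have hA : wA P ≠ [] := by simp
  obtain ⟨l, hl⟩ : ∃ l, (wA P).length = l + 1 := ⟨P.length + 1, by simp⟩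
  have h1 : shiftBy (u.length + (m + i * l + u.length * l)) (u ⊹ z) = wordPow (wA P) := by
    rw [show u.length + (m + i * l + u.length * l) = m + (i * l + u.length * (l + 1)) by ring,
      ← shiftBy_shiftBy, e, shiftBy_shiftBy,
      show i + (i * l + u.length * (l + 1)) = (i + u.length) * (wA P).length by rw [hl]; ring,
      shiftBy_mul_wordPow hA]
  rw [← shiftBy_shiftBy, shiftBy_length_append] at h1
  refine ⟨block z 0 (m + i * l + u.length * l), ?_⟩
  rw [append_wordAppend, ← h1, block_append_shiftBy]

/-- There are finitely many suffixes and each strict inequality is decided at finite depth, so A^∞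
may be replaced by a long power of A with any continuation. The assumption on W excludes equality in
the lower bounds. -/
theorem Good.exists_depth (h : Good P c W (u ⊹ wordPow (wA P)))
    (hW : ∀ s i, shiftBy s W ≠ shiftBy i (wordPow (wA P))) :
    ∃ M, ∀ p s x, u = p ++ s → (∀ i < M, x i = wordPow (wA P) i) →
      W ≺ s ⊹ x ∧ s ⊹ x ≺ c := by
  have h1 : ∀ n, ∃ M, ∀ p s x, p.length = n → u = p ++ s →
      (∀ i < M, x i = wordPow (wA P) i) → W ≺ s ⊹ x ∧ s ⊹ x ≺ c := by
    intro n
    by_cases hn : n ≤ u.length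
    · have h2 := h.1 n
      rw [shiftBy_append_of_le hn] at h2
      have h3 : W ≺ u.drop n ⊹ wordPow (wA P) := by
        refine h2.1.lt_of_ne fun e => ?_
        have := congrArg (shiftBy (u.drop n).length) e
        rw [shiftBy_length_append] at this
        exact hW _ 0 (this.trans (shiftBy_zero _).symm)
      obtain ⟨M₁, hM₁⟩ := h3.exists_depth
      obtain ⟨M₂, hM₂⟩ := h2.2.exists_depth
      refine ⟨max M₁ M₂, fun p s x hp e hx => ?_⟩
      have e2 : u.drop n = s := by rw [e, ← hp, List.drop_left]
      rw [e2] at hM₁ hM₂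
      refine ⟨hM₁ _ _ (fun _ _ => rfl) (append_agree fun i hi => hx i ?_),
        hM₂ _ _ (append_agree fun i hi => hx i ?_) (fun _ _ => rfl)⟩
      · exact lt_of_lt_of_le hi (le_max_left _ _)
      · exact lt_of_lt_of_le hi (le_max_right _ _)
    · refine ⟨0, fun p s x hp e => ?_⟩
      have := congrArg List.length e
      simp at this; omega
  choose f hf using h1
  refine ⟨(Finset.range (u.length + 1)).sup f, fun p s x e hx => hf p.length p s x rfl e ?_⟩
  intro i hi
  apply hx
  refine lt_of_lt_of_le hi (Finset.le_sup (f := f) ?_)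
  have := congrArg List.length e
  simp at this ⊢; omega

/-- The connecting word runs from u along w^∞, then through a good prolongation into A^∞, along a
long power of A, and through a bridge into z. -/
theorem Setting.isTransitive (st : Setting S P U a c) (hw : SL w)
    (hadm : ∀ n, shiftBy n (wordPow w) ≺ a) (hWB : wordPow w ≼ seqB P)
    (hno : NoWindow S c (wordPow w)) : IsTransitive (Surv a (wordPow w)) := by
  classical
  rintro u ⟨y, hy, i, hu⟩ z hz
  set W := wordPow w with hWdef
  have hWS : W ≺ wordPow S := hWB.trans_lt st.seqB_lt_powS
  obtain ⟨u₁, r, hu₁, hu₁W⟩ := exists_prolongation hw hadm hy hu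
  have hu₂W : repAppend w u.length W = W := repAppend_wordPow hw.1 _
  rw [repAppend_eq] at hu₂W
  -- The shortened word u₁ may be shorter than u; |u| copies of w ensure that u is a prefix again.
  set u₂ := u₁ ++ (List.replicate u.length w).flatten with hu₂
  have e₂ : u₂ ⊹ W = u₁ ⊹ W := by rw [hu₂, append_wordAppend, hu₂W]
  have hu₂l : u.length ≤ u₂.length := by
    have : u.length * 1 ≤ u.length * w.length :=
      Nat.mul_le_mul_left _ (List.length_pos_iff.2 hw.1)
    simp [hu₂]
    omega
  have hpre : u₂ = u ++ u₂.drop u.length := by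
    have h1 : u₁ ⊹ W = u ⊹ shiftBy r W := by
      conv_rhs => rw [hu₁]
      rw [append_wordAppend, block_append_shiftBy]
    rw [← e₂] at h1
    conv_lhs at h1 => rw [← List.take_append_drop u.length u₂, append_wordAppend]
    have h2 := (wordAppend_inj (by simp [hu₂l]) h1).1
    conv_lhs => rw [← List.take_append_drop u.length u₂, h2]
  rw [← e₂] at hu₁W
  obtain ⟨G, hG⟩ := st.exists_good_prolongation hw hadm hWS.le hno hu₁W
  obtain ⟨u₃, hu₃⟩ := hG.exists_tail
  rw [hu₃] at hG
  obtain ⟨M, hM⟩ := hG.exists_depth (fun s i h => by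
    have h1 := shiftBy_mul_wordPow hw.1 s
    have h2 : s * 1 ≤ s * w.length := Nat.mul_le_mul_left _ (List.length_pos_iff.2 hw.1)
    have h3 : shiftBy (s * w.length) W = shiftBy (i + (s * w.length - s)) (wordPow (wA P)) := by
      rw [← shiftBy_shiftBy, ← h, shiftBy_shiftBy]
      congr 1; omega
    have h4 := st.le_shift_powA (i + (s * w.length - s))
    rw [← h3, h1] at h4
    exact h4.not_lt hWS)
  obtain ⟨ρ, ρ', hρ, hbr⟩ := st.exists_bridge hWB z
  refine ⟨u₂.drop u.length ++ (u₃ ++ ((List.replicate M (wA P)).flatten ++ ρ)), ?_⟩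
  rw [← List.append_assoc, ← hpre, ← List.append_assoc, append_wordAppend]
  have hall : ∀ n, W ≼ shiftBy n ((u₂ ++ u₃) ⊹ ((List.replicate M (wA P)).flatten ++ ρ) ⊹ z) ∧
      shiftBy n ((u₂ ++ u₃) ⊹ ((List.replicate M (wA P)).flatten ++ ρ) ⊹ z) ≼ c ∧
      (shiftBy n ((u₂ ++ u₃) ⊹ ((List.replicate M (wA P)).flatten ++ ρ) ⊹ z) = c → c = a) := by
    refine forall_shift_append (K := fun t => W ≼ t ∧ t ≼ c ∧ (t = c → c = a)) ?_ ?_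
    · intro p s e _
      obtain ⟨h1, h2⟩ := hM p s (((List.replicate M (wA P)).flatten ++ ρ) ⊹ z) e (by
        intro i hi
        rw [append_wordAppend, ← repAppend_eq]
        exact repAppend_agree (by simp) _ _ _ hi)
      exact ⟨h1.le, h2.le, fun e => absurd e h2.ne⟩
    · refine forall_shift_append (K := fun t => W ≼ t ∧ t ≼ c ∧ (t = c → c = a)) ?_ ?_
      · intro p s e hs
        obtain ⟨h1, h2⟩ := hbr M p s e hs
        exact ⟨h1, h2.le, fun e => absurd e h2.ne⟩
      · intro n
        exact ⟨(hz n).1, (hz n).2.trans st.le_c, fun e => st.eq_a_of_le (e ▸ (hz n).2)⟩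
  exact fun n => ⟨(hall n).1, st.le_a (fun m => (hall m).2) n⟩

end transitive

open Filter Topology

/-! ### Counting words -/

section counting
variable {X Y Y' Z : Set Seq} {u u' : Word} {x : Seq} {m n k : ℕ}

/-- The prefixes of length `m` of the sequences in `X`. -/
def pref (X : Set Seq) (m : ℕ) : Set Word := (fun x => block x 0 m) '' X

/-- The number of prefixes of length `m`. -/
noncomputable def cnt (X : Set Seq) (m : ℕ) : ℕ := (pref X m).ncard

theorem finite_words (m : ℕ) : {w : Word | w.length = m}.Finite := List.finite_length_eq Bool m

theorem ncard_words (m : ℕ) : {w : Word | w.length = m}.ncard = 2 ^ m := by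
  have h := card_vector (α := Bool) m
  rw [Fintype.card_bool] at h
  rw [← h, ← Nat.card_eq_fintype_card]
  rfl

theorem pref_subset (X : Set Seq) (m : ℕ) : pref X m ⊆ {w : Word | w.length = m} := by
  rintro w ⟨x, -, rfl⟩
  simp

theorem finite_pref (X : Set Seq) (m : ℕ) : (pref X m).Finite := (finite_words m).subset (pref_subset X m)

theorem cnt_le_two_pow (X : Set Seq) (m : ℕ) : cnt X m ≤ 2 ^ m := by
  rw [← ncard_words]
  exact Set.ncard_le_ncard (pref_subset X m) (finite_words m)

theorem cnt_mono (h : X ⊆ Y) (m : ℕ) : cnt X m ≤ cnt Y m :=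
  Set.ncard_le_ncard (Set.image_mono h) (finite_pref Y m)

theorem cnt_pos (h : X.Nonempty) (m : ℕ) : 1 ≤ cnt X m :=
  (Set.ncard_pos (finite_pref X m)).2 (h.image _)

theorem cnt_le_add (X : Set Seq) (m n : ℕ) : cnt X m ≤ cnt X (m + n) := by
  have h : pref X m = (fun w : Word => w.take m) '' pref X (m + n) := by
    rw [pref, pref, Set.image_image]
    congr 1
    funext x
    rw [block_add, List.take_left' (by simp)]
  rw [cnt, h]
  exact Set.ncard_image_le (finite_pref _ _)

/-- Subsets of the sequence space that are mapped to themselves by the shift. -/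
def ShiftInv (X : Set Seq) : Prop := ∀ x ∈ X, ∀ n, shiftBy n x ∈ X

theorem language_eq (h : ShiftInv X) (m : ℕ) :
    {w ∈ language X | w.length = m} = pref X m := by
  ext w
  constructor
  · rintro ⟨⟨x, hx, j, e⟩, rfl⟩
    exact ⟨shiftBy j x, h x hx j, (block_eq_block_shiftBy _ _ _).symm.trans e⟩
  · rintro ⟨x, hx, rfl⟩
    exact ⟨⟨x, hx, 0, by simp⟩, by simp⟩

theorem ncard_image2_append_le {A B : Set Word} (hA : A.Finite) (hB : B.Finite) :
    (Set.image2 (fun a b : Word => a ++ b) A B).ncard ≤ A.ncard * B.ncard := by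
  rw [← Set.image_prod, ← Set.ncard_prod]
  exact Set.ncard_image_le (hA.prod hB)

theorem cnt_add_le (h : ShiftInv X) (m n : ℕ) : cnt X (m + n) ≤ cnt X m * cnt X n := by
  have h1 : pref X (m + n) ⊆ Set.image2 (fun a b : Word => a ++ b) (pref X m) (pref X n) := by
    rintro w ⟨x, hx, rfl⟩
    refine ⟨block x 0 m, ⟨x, hx, rfl⟩, block x m n, ⟨shiftBy m x, h x hx m, ?_⟩, ?_⟩
    · exact (block_eq_block_shiftBy x m n).symm
    · simp [block_add]
  exact (Set.ncard_le_ncard h1 ((finite_pref _ _).image2 _ (finite_pref _ _))).trans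
    (ncard_image2_append_le (finite_pref _ _) (finite_pref _ _))

theorem block_append_word (u : Word) (x : Seq) (h : u.length ≤ m) :
    block (u ⊹ x) 0 m = u ++ block x 0 (m - u.length) := by
  conv_lhs => rw [← Nat.add_sub_cancel' h]
  rw [block_add, block_wordAppend, zero_add, block_eq_block_shiftBy, shiftBy_length_append]

theorem cnt_le_of_split (h : ∀ x ∈ X, (∃ x' ∈ Y, x = u ⊹ x') ∨ ∃ x' ∈ Y', x = u' ⊹ x')
    (hu : u.length ≤ m) (hu' : u'.length ≤ m) :
    cnt X m ≤ cnt Y (m - u.length) + cnt Y' (m - u'.length) := by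
  have h1 : pref X m ⊆ (fun w : Word => u ++ w) '' pref Y (m - u.length) ∪
      (fun w : Word => u' ++ w) '' pref Y' (m - u'.length) := by
    rintro w ⟨x, hx, rfl⟩
    rcases h x hx with ⟨x', hx', rfl⟩ | ⟨x', hx', rfl⟩
    · exact Or.inl ⟨_, ⟨x', hx', rfl⟩, (block_append_word u x' hu).symm⟩
    · exact Or.inr ⟨_, ⟨x', hx', rfl⟩, (block_append_word u' x' hu').symm⟩
  refine (Set.ncard_le_ncard h1 (((finite_pref _ _).image _).union
    ((finite_pref _ _).image _))).trans ((Set.ncard_union_le _ _).trans ?_)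
  exact Nat.add_le_add (Set.ncard_image_le (finite_pref _ _)) (Set.ncard_image_le (finite_pref _ _))

theorem cnt_union_le (X Y : Set Seq) (m : ℕ) : cnt (X ∪ Y) m ≤ cnt X m + cnt Y m := by
  rw [cnt, pref, Set.image_union]
  exact Set.ncard_union_le _ _

theorem ncard_exists_lt_le (B : ℕ → Set Word) (m : ℕ) :
    {w | ∃ i < m, w ∈ B i}.ncard ≤ ∑ i ∈ Finset.range m, (B i).ncard := by
  induction m with
  | zero => simp
  | succ m ih =>
    have h : {w | ∃ i < m + 1, w ∈ B i} = {w | ∃ i < m, w ∈ B i} ∪ B m := by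
      ext w
      constructor
      · rintro ⟨i, hi, hw⟩
        rcases Nat.lt_succ_iff_lt_or_eq.1 hi with h | rfl
        · exact Or.inl ⟨i, h, hw⟩
        · exact Or.inr hw
      · rintro (⟨i, hi, hw⟩ | hw)
        · exact ⟨i, by omega, hw⟩
        · exact ⟨m, by omega, hw⟩
    rw [h, Finset.sum_range_succ]
    exact (Set.ncard_union_le _ _).trans (Nat.add_le_add_right ih _)

/-- Decomposing at the first position where the orbit enters `Y`. -/
theorem cnt_le_sum {A : ℕ → Set Word} (hA : ∀ i, (A i).Finite) (hY : Y.Nonempty)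
    (h : ∀ x ∈ X, ∃ i ≤ m, block x 0 i ∈ A i ∧ (i = m ∨ shiftBy i x ∈ Y)) :
    cnt X m ≤ ∑ i ∈ Finset.range (m + 1), (A i).ncard * cnt Y (m - i) := by
  have h1 : pref X m ⊆ {w | ∃ i < m + 1,
      w ∈ Set.image2 (fun a b : Word => a ++ b) (A i) (pref Y (m - i))} := by
    rintro w ⟨x, hx, rfl⟩
    obtain ⟨i, hi, h1, h2⟩ := h x hx
    refine ⟨i, by omega, block x 0 i, h1, ?_⟩
    rcases h2 with rfl | h2
    · obtain ⟨y, hy⟩ := hY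
      exact ⟨[], ⟨y, hy, by simp [block]⟩, by simp⟩
    · refine ⟨block x i (m - i), ⟨shiftBy i x, h2, (block_eq_block_shiftBy _ _ _).symm⟩, ?_⟩
      have := block_add x 0 i (m - i)
      rw [Nat.add_sub_cancel' hi, zero_add] at this
      exact this.symm
  have hfin : {w | ∃ i < m + 1,
      w ∈ Set.image2 (fun a b : Word => a ++ b) (A i) (pref Y (m - i))}.Finite := by
    have : {w | ∃ i < m + 1, w ∈ Set.image2 (fun a b : Word => a ++ b) (A i) (pref Y (m - i))} =
        ⋃ i ∈ Set.Iio (m + 1), Set.image2 (fun a b : Word => a ++ b) (A i) (pref Y (m - i)) := by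
      ext w; simp
    rw [this]
    exact (Set.finite_Iio _).biUnion fun i _ => (hA i).image2 _ (finite_pref _ _)
  refine (Set.ncard_le_ncard h1 hfin).trans ((ncard_exists_lt_le _ _).trans ?_)
  exact Finset.sum_le_sum fun i _ => ncard_image2_append_le (hA i) (finite_pref _ _)

/-! ### Words restricted by their blocks of a fixed length. -/

/-- The words of length `i` with a continuation all of whose blocks of length `k` starting before
position `i` belong to `p`. -/
def blockFree (p : Set Word) (k i : ℕ) : Set Word :=
  {w | ∃ x : Seq, w = block x 0 i ∧ ∀ i' < i, block x i' k ∈ p}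

theorem finite_blockFree (p : Set Word) (k i : ℕ) : (blockFree p k i).Finite :=
  (finite_words i).subset (by rintro w ⟨x, rfl, -⟩; simp)

/-- A block of length k repeats somewhere between l and l + 2^k. Closing the sequence up
periodically there creates no block of length k that did not already occur in x. -/
theorem exists_periodic_extension {p : Set Word} {l : ℕ}
    (h : ∀ i' < l + 2 ^ k, block x i' k ∈ p) :
    ∃ z : Seq, (∀ n, block z n k ∈ p) ∧ block z 0 l = block x 0 l := by
  obtain ⟨i, i', h1, h2, h3, h4⟩ := exists_block_repeat x l k
  obtain ⟨q, rfl⟩ : ∃ q, i' = i + q := ⟨i' - i, by omega⟩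
  have hb : block x i q ≠ [] := by
    intro e
    have := congrArg List.length e
    simp at this; omega
  set z := block x 0 i ⊹ wordPow (block x i q) with hz
  have hper : ∀ t, i ≤ t → z (t + q) = z t := by
    intro t ht
    have h5 := congrFun (shiftBy_length_wordPow hb) (t - i)
    rw [length_block, shiftBy] at h5
    rw [hz, wordAppend_ge (by simp; omega), wordAppend_ge (by simp; omega), length_block, ← h5]
    congr 1; omega
  have hag : ∀ t < i + q, z t = x t := by
    intro t ht
    have e : x = block x 0 i ⊹ block x i q ⊹ shiftBy (i + q) x := by
      rw [block_append_shiftBy', block_append_shiftBy]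
    have e2 : z = block x 0 i ⊹ block x i q ⊹ wordPow (block x i q) := by rw [wordPow_eq hb]
    conv_rhs => rw [e]
    rw [e2, ← append_wordAppend, ← append_wordAppend]
    exact wordAppend_lt_congr (by simp; omega)
  have hag2 : ∀ t < i + q + k, z t = x t := by
    intro t
    induction t using Nat.strong_induction_on with
    | _ t ih =>
      intro ht
      rcases lt_or_ge t (i + q) with h5 | h5
      · exact hag t h5
      · obtain ⟨r, rfl⟩ := Nat.exists_eq_add_of_le h5
        rw [← h4 r (by omega), ← ih (i + r) (by omega) (by omega), ← hper (i + r) (by omega)]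
        congr 1; omega
  have hred : ∀ n, ∃ n' < i + q, ∀ r, z (n + r) = z (n' + r) := by
    intro n
    induction n using Nat.strong_induction_on with
    | _ n ih =>
      rcases lt_or_ge n (i + q) with h5 | h5
      · exact ⟨n, h5, fun _ => rfl⟩
      · obtain ⟨n', h6, h7⟩ := ih (n - q) (by omega)
        refine ⟨n', h6, fun r => ?_⟩
        rw [← h7, ← hper (n - q + r) (by omega)]
        congr 1; omega
  refine ⟨z, fun n => ?_, block_congr fun t ht => hag t (by omega)⟩
  obtain ⟨n', h6, h7⟩ := hred n
  have : block z n k = block x n' k := by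
    rw [block_eq_block_shiftBy, block_eq_block_shiftBy x]
    refine block_congr fun r hr => ?_
    rw [shiftBy, shiftBy, h7, hag2 _ (by omega)]
  rw [this]
  exact h n' (by omega)

/-- All but the last 2^k digits extend to an element of Z; those last digits are arbitrary, whence
the constant. -/
theorem ncard_blockFree_le {p : Set Word} (hZ : ∀ z : Seq, (∀ n, block z n k ∈ p) → z ∈ Z)
    (hne : Z.Nonempty) (i : ℕ) : (blockFree p k i).ncard ≤ 2 ^ 2 ^ k * cnt Z i := by
  rcases lt_or_ge i (2 ^ k) with h | h
  · have h1 : (blockFree p k i).ncard ≤ 2 ^ i := by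
      rw [← ncard_words]
      exact Set.ncard_le_ncard (by rintro w ⟨x, rfl, -⟩; simp) (finite_words i)
    calc _ ≤ 2 ^ i := h1
      _ ≤ 2 ^ 2 ^ k * 1 := by rw [mul_one]; exact Nat.pow_le_pow_right (by omega) h.le
      _ ≤ _ := Nat.mul_le_mul_left _ (cnt_pos hne i)
  · obtain ⟨l, rfl⟩ : ∃ l, i = l + 2 ^ k := ⟨i - 2 ^ k, by omega⟩
    have h1 : blockFree p k (l + 2 ^ k) ⊆
        Set.image2 (fun a b : Word => a ++ b) (pref Z l) {w | w.length = 2 ^ k} := by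
      rintro w ⟨x, rfl, hx⟩
      obtain ⟨z, hz1, hz2⟩ := exists_periodic_extension hx
      refine ⟨block x 0 l, ⟨z, hZ z hz1, hz2⟩, block x l (2 ^ k), by simp, ?_⟩
      simp [block_add]
    have h2 := Set.ncard_le_ncard h1 ((finite_pref _ _).image2 _ (finite_words _))
    have h3 := ncard_image2_append_le (finite_pref Z l) (finite_words (2 ^ k))
    rw [ncard_words, mul_comm] at h3
    exact (h2.trans h3).trans (Nat.mul_le_mul_left _ (cnt_le_add Z l _))

end counting

/-! ### Entropy -/

section entropy
variable {X Y Z : Set Seq} {h h' : ℝ}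

/-- The growth rate of the number of prefixes. -/
def HasGrowth (X : Set Seq) (h : ℝ) : Prop :=
  Tendsto (fun m : ℕ => Real.log (cnt X m) / (m : ℝ)) atTop (𝓝 h)

theorem hasEntropy_iff (hX : ShiftInv X) : HasEntropy X h ↔ HasGrowth X h := by
  unfold HasEntropy HasGrowth
  simp only [language_eq hX, cnt]

theorem exists_hasGrowth (hX : ShiftInv X) (hne : X.Nonempty) : ∃ h, HasGrowth X h := by
  have hpos : ∀ m, (1 : ℝ) ≤ cnt X m := fun m => by exact_mod_cast cnt_pos hne m
  have hsub : Subadditive fun m => Real.log (cnt X m) := by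
    intro m n
    rw [← Real.log_mul (by linarith [hpos m]) (by linarith [hpos n])]
    apply Real.log_le_log (by linarith [hpos (m + n)])
    exact_mod_cast cnt_add_le hX m n
  refine ⟨hsub.lim, hsub.tendsto_lim ⟨0, ?_⟩⟩
  rintro _ ⟨m, rfl⟩
  exact div_nonneg (Real.log_nonneg (hpos m)) (Nat.cast_nonneg m)

theorem HasGrowth.nonneg (hX : HasGrowth X h) : 0 ≤ h := by
  refine ge_of_tendsto' hX fun m => ?_
  refine div_nonneg ?_ (Nat.cast_nonneg m)
  rcases Nat.eq_zero_or_pos (cnt X m) with h0 | h0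
  · simp [h0]
  · exact Real.log_nonneg (by exact_mod_cast h0)

theorem log_cnt_div_le (hne : X.Nonempty) (hXY : X ⊆ Y) (m : ℕ) :
    Real.log (cnt X m) / (m : ℝ) ≤ Real.log (cnt Y m) / (m : ℝ) := by
  refine div_le_div_of_nonneg_right (Real.log_le_log ?_ ?_) (Nat.cast_nonneg m)
  · exact_mod_cast cnt_pos hne m
  · exact_mod_cast cnt_mono hXY m

theorem HasGrowth.mono (hne : X.Nonempty) (hXY : X ⊆ Y) (hX : HasGrowth X h)
    (hY : HasGrowth Y h') : h ≤ h' :=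
  le_of_tendsto_of_tendsto' hX hY (log_cnt_div_le hne hXY)

theorem HasGrowth.squeeze (hne : X.Nonempty) (hXY : X ⊆ Y) (hYZ : Y ⊆ Z) (hX : HasGrowth X h)
    (hZ : HasGrowth Z h) : HasGrowth Y h :=
  tendsto_of_tendsto_of_tendsto_of_le_of_le hX hZ (log_cnt_div_le hne hXY)
    (log_cnt_div_le (hne.mono hXY) hYZ)

theorem HasGrowth.exists_bound {θ : ℝ} (hX : HasGrowth X h) (hne : X.Nonempty) (hθ : h < θ) :
    ∃ K : ℝ, 0 < K ∧ ∀ m, (cnt X m : ℝ) ≤ K * Real.exp θ ^ m := by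
  have hθ0 : 0 < θ := hX.nonneg.trans_lt hθ
  have he : 1 ≤ Real.exp θ := Real.one_le_exp hθ0.le
  obtain ⟨N, hN⟩ := eventually_atTop.1 (hX.eventually (gt_mem_nhds hθ))
  refine ⟨2 ^ (N + 1), by positivity, fun m => ?_⟩
  rcases le_or_gt m N with hm | hm
  · calc (cnt X m : ℝ) ≤ 2 ^ m := by exact_mod_cast cnt_le_two_pow X m
      _ ≤ 2 ^ (N + 1) := pow_le_pow_right₀ (by norm_num) (by omega)
      _ ≤ 2 ^ (N + 1) * Real.exp θ ^ m :=
        le_mul_of_one_le_right (by positivity) (one_le_pow₀ he)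
  · have h1 := hN m hm.le
    have hm0 : (0 : ℝ) < m := by exact_mod_cast (by omega : 0 < m)
    rw [div_lt_iff₀ hm0] at h1
    have hpos : (0 : ℝ) < cnt X m := by exact_mod_cast cnt_pos hne m
    rw [Real.log_lt_iff_lt_exp hpos, mul_comm, Real.exp_nat_mul] at h1
    exact h1.le.trans (le_mul_of_one_le_left (by positivity) (one_le_pow₀ (by norm_num)))

theorem HasGrowth.le_of_bound {K θ : ℝ} (hX : HasGrowth X h) (hne : X.Nonempty) (hK : 0 < K)
    (hb : ∀ m : ℕ, (cnt X m : ℝ) ≤ K * (m + 1) * Real.exp θ ^ m) : h ≤ θ := by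
  have h1 : Tendsto (fun m : ℕ => Real.log K / (m : ℝ) + Real.log (m + 1) / (m : ℝ) + θ) atTop
      (𝓝 (0 + 0 + θ)) := by
    refine (Tendsto.add ?_ ?_).add tendsto_const_nhds
    · exact tendsto_const_nhds.div_atTop tendsto_natCast_atTop_atTop
    · have h2 : Tendsto (fun m : ℕ => Real.log (m + 1) / ((m : ℝ) + 1)) atTop (𝓝 0) := by
        have h3 := (Real.isLittleO_log_id_atTop.tendsto_div_nhds_zero).comp
          ((tendsto_natCast_atTop_atTop (R := ℝ)).comp (tendsto_add_atTop_nat 1))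
        refine h3.congr fun m => ?_
        simp
      have h4 : Tendsto (fun m : ℕ => ((m : ℝ) + 1) / m) atTop (𝓝 1) := by
        have h5 : Tendsto (fun m : ℕ => 1 + 1 / (m : ℝ)) atTop (𝓝 (1 + 0)) :=
          tendsto_const_nhds.add tendsto_one_div_atTop_nhds_zero_nat
        rw [add_zero] at h5
        refine h5.congr' ?_
        filter_upwards [eventually_gt_atTop 0] with m hm
        have : (m : ℝ) ≠ 0 := by exact_mod_cast hm.ne'
        field_simp
      have h6 := h2.mul h4
      rw [zero_mul] at h6
      refine h6.congr fun m => ?_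
      have : (m : ℝ) + 1 ≠ 0 := by positivity
      field_simp
  rw [zero_add, zero_add] at h1
  refine le_of_tendsto_of_tendsto hX h1 ?_
  filter_upwards [eventually_gt_atTop 0] with m hm
  have hm0 : (0 : ℝ) < m := by exact_mod_cast hm
  have hpos : (0 : ℝ) < cnt X m := by exact_mod_cast cnt_pos hne m
  have h2 := Real.log_le_log hpos (hb m)
  rw [Real.log_mul (by positivity) (by positivity), Real.log_mul (by positivity) (by positivity),
    Real.log_pow, Real.log_exp] at h2
  rw [← add_div, div_add' _ _ _ hm0.ne']
  refine div_le_div_of_nonneg_right ?_ hm0.le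
  linarith

/-- The lower bound makes ξ^(-1) at most e^θ for every θ > h', so each term of the convolution is at
most a constant times e^(θm). The number m + 1 of terms does not affect the growth rate. -/
theorem HasGrowth.le_of_sum_bound {K κ ξ : ℝ} (hX : HasGrowth X h) (hZ : HasGrowth Z h')
    (hneX : X.Nonempty) (hneZ : Z.Nonempty) (hξ : 0 < ξ) (hκ : 0 < κ) (hK : 0 < K)
    (hlow : ∀ m, κ ≤ cnt Z m * ξ ^ m)
    (hup : ∀ m, (cnt X m : ℝ) ≤ K * ∑ i ∈ Finset.range (m + 1), cnt Z i * (ξ⁻¹) ^ (m - i)) :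
    h ≤ h' := by
  refine le_of_forall_gt_imp_ge_of_dense fun θ hθ => ?_
  obtain ⟨B, hB, hb⟩ := hZ.exists_bound hneZ hθ
  have h1 : ξ⁻¹ ≤ Real.exp θ := by
    by_contra hcon
    push Not at hcon
    have h2 : Real.exp θ * ξ < 1 := by
      rwa [lt_inv_comm₀ (Real.exp_pos _) hξ, ← one_div, lt_div_iff₀' (Real.exp_pos _)] at hcon
    obtain ⟨m, hm⟩ := exists_pow_lt_of_lt_one (div_pos hκ hB) h2
    have h3 := (hlow m).trans (mul_le_mul_of_nonneg_right (hb m) (pow_nonneg hξ.le m))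
    rw [mul_assoc, ← mul_pow] at h3
    rw [lt_div_iff₀' hB] at hm
    linarith
  refine hX.le_of_bound (K := K * B) hneX (by positivity) fun m => (hup m).trans ?_
  rw [mul_assoc, mul_assoc]
  refine mul_le_mul_of_nonneg_left ?_ hK.le
  have h2 : ∀ i ∈ Finset.range (m + 1), (cnt Z i : ℝ) * (ξ⁻¹) ^ (m - i) ≤ B * Real.exp θ ^ m := by
    intro i hi
    have hi' : i ≤ m := by simpa [Nat.lt_succ_iff] using hi
    calc (cnt Z i : ℝ) * (ξ⁻¹) ^ (m - i) ≤ B * Real.exp θ ^ i * Real.exp θ ^ (m - i) := by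
          gcongr
          exact hb i
      _ = B * Real.exp θ ^ m := by rw [mul_assoc, ← pow_add, Nat.add_sub_cancel' hi']
  refine (Finset.sum_le_sum h2).trans (le_of_eq ?_)
  rw [Finset.sum_const, Finset.card_range, nsmul_eq_mul]
  push_cast
  ring

end entropy

/-! ### Growth of two-generator systems -/

section growth

theorem exists_root {j n : ℕ} (hj : 1 ≤ j) (hn : 1 ≤ n) :
    ∃ ξ : ℝ, 0 < ξ ∧ ξ ≤ 1 ∧ ξ ^ j + ξ ^ n = 1 := by
  have hcont : ContinuousOn (fun x : ℝ => x ^ j + x ^ n) (Set.Icc 0 1) := by fun_prop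
  have h := intermediate_value_Icc (zero_le_one' ℝ) hcont
  have h0 : (0 : ℝ) ^ j = 0 := zero_pow (by omega)
  have h0' : (0 : ℝ) ^ n = 0 := zero_pow (by omega)
  obtain ⟨ξ, hξ, e⟩ := h (show (1 : ℝ) ∈ _ by simp only [h0, h0', one_pow]; norm_num)
  refine ⟨ξ, lt_of_le_of_ne hξ.1 ?_, hξ.2, e⟩
  rintro rfl
  simp only [h0, h0'] at e
  norm_num at e

/-- The two counts obey the bounds Kξ^(n-m) and Kξ^(j-m): their sum is Kξ^(-m) by the equation for
ξ, so the recursion reproduces them. The constant K takes care of the initial lengths. -/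
theorem growth_upper {j n : ℕ} {ξ : ℝ} (hj : 1 ≤ j) (hn : 1 ≤ n) (hξ : 0 < ξ) (hξ1 : ξ ≤ 1)
    (hroot : ξ ^ j + ξ ^ n = 1) {p r : ℕ → ℕ} (hp2 : ∀ m, p m ≤ 2 ^ m) (hr2 : ∀ m, r m ≤ 2 ^ m)
    (hp : ∀ m, n ≤ m → p m ≤ p (m - n) + r (m - n))
    (hr : ∀ m, j ≤ m → r m ≤ r (m - j) + p (m - j)) (m : ℕ) :
    ((p m : ℝ) + r m) * ξ ^ m ≤ 2 ^ (n + j) / ξ ^ (n + j) := by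
  set K : ℝ := 2 ^ (n + j) / ξ ^ (n + j) with hK
  have hK0 : 0 < K := by positivity
  have key : ∀ m, (p m : ℝ) * ξ ^ m ≤ K * ξ ^ n ∧ (r m : ℝ) * ξ ^ m ≤ K * ξ ^ j := by
    intro m
    induction m using Nat.strong_induction_on with
    | _ m ih =>
      have small : ∀ (q : ℕ → ℕ) (l l' : ℕ), l + l' = n + j → q m ≤ 2 ^ m → m < l →
          (q m : ℝ) * ξ ^ m ≤ K * ξ ^ l := by
        intro q l l' hl hq hm
        have h1 : (q m : ℝ) ≤ 2 ^ m := by exact_mod_cast hq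
        have h2 : (2 : ℝ) ^ m ≤ 2 ^ (n + j) := pow_le_pow_right₀ (by norm_num) (by omega)
        have h3 : ξ ^ m ≤ 1 := pow_le_one₀ hξ.le hξ1
        have h4 : (2 : ℝ) ^ (n + j) ≤ K * ξ ^ l := by
          rw [hK, ← hl, pow_add ξ, div_mul_eq_mul_div, mul_comm (ξ ^ l),
            mul_div_mul_right _ _ (by positivity), le_div_iff₀ (by positivity)]
          exact mul_le_of_le_one_right (by positivity) (pow_le_one₀ hξ.le hξ1)
        calc (q m : ℝ) * ξ ^ m ≤ 2 ^ (n + j) * 1 :=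
              mul_le_mul (h1.trans h2) h3 (by positivity) (by positivity)
          _ ≤ K * ξ ^ l := by rw [mul_one]; exact h4
      have big : ∀ (q : ℕ → ℕ) (l : ℕ), 1 ≤ l → l ≤ m → q m ≤ p (m - l) + r (m - l) →
          (q m : ℝ) * ξ ^ m ≤ K * ξ ^ l := by
        intro q l hl hlm hq
        have h1 : (q m : ℝ) ≤ p (m - l) + r (m - l) := by exact_mod_cast hq
        obtain ⟨h2, h3⟩ := ih (m - l) (by omega)
        calc (q m : ℝ) * ξ ^ m ≤ (p (m - l) + r (m - l)) * ξ ^ m := by gcongr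
          _ = (p (m - l) * ξ ^ (m - l) + r (m - l) * ξ ^ (m - l)) * ξ ^ l := by
              rw [← add_mul, mul_assoc, ← pow_add, Nat.sub_add_cancel hlm]
          _ ≤ (K * ξ ^ n + K * ξ ^ j) * ξ ^ l := by gcongr
          _ = K * ξ ^ l := by rw [← mul_add, add_comm (ξ ^ n), hroot, mul_one]
      constructor
      · rcases lt_or_ge m n with h | h
        · exact small p n j rfl (hp2 m) h
        · exact big p n hn h (hp m h)
      · rcases lt_or_ge m j with h | h
        · exact small r j n (add_comm _ _) (hr2 m) h
        · exact big r j hj h (by rw [add_comm]; exact hr m h)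
  obtain ⟨h1, h2⟩ := key m
  calc ((p m : ℝ) + r m) * ξ ^ m = p m * ξ ^ m + r m * ξ ^ m := add_mul _ _ _
    _ ≤ K * ξ ^ n + K * ξ ^ j := add_le_add h1 h2
    _ = K := by rw [← mul_add, add_comm (ξ ^ n), hroot, mul_one]

variable {T₁ T₂ : Word} {x y : Seq}

/-! ### Free concatenation of two words. -/

/-- The sequences obtained from `T₂^∞` by prepending the words `T₁` and `T₂`. -/
inductive FreeSeq (T₁ T₂ : Word) : Seq → Prop
  | base : FreeSeq T₁ T₂ (wordPow T₂)
  | left {x : Seq} : FreeSeq T₁ T₂ x → FreeSeq T₁ T₂ (T₁ ⊹ x)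
  | right {x : Seq} : FreeSeq T₁ T₂ x → FreeSeq T₁ T₂ (T₂ ⊹ x)

theorem below_append_comm (h₁ : T₁ ≠ []) (h₂ : T₂ ≠ []) (h : wordPow T₁ ≺ wordPow T₂) :
    Below (T₁ ++ T₂) (T₂ ++ T₁) := by
  have hq : T₁ ⊹ wordPow T₂ ≼ wordPow T₂ := append_le_of_ge h₁ h.le seqLE.rfl
  have hne : T₁ ⊹ wordPow T₂ ≠ wordPow T₂ := fun e => h.ne (eq_wordPow h₁ e.symm).symm
  have e1 : (T₁ ++ T₂) ⊹ wordPow T₂ = T₁ ⊹ wordPow T₂ := by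
    rw [append_wordAppend, wordPow_eq h₂]
  have e2 : (T₂ ++ T₁) ⊹ wordPow T₂ = T₂ ⊹ T₁ ⊹ wordPow T₂ := append_wordAppend _ _ _
  rcases below_trichotomy (u := T₁ ++ T₂) (v := T₂ ++ T₁) (by simp [add_comm]) with h1 | h1 | h1
  · exact h1
  · exfalso
    rw [← h1, e1] at e2
    exact hne (eq_wordPow h₂ e2)
  · exfalso
    have h3 := h1 (wordPow T₂) (wordPow T₂)
    rw [e1, e2] at h3
    exact hne (hq.antisymm (wordPow_le_of_append_le h₂ h3.le))

theorem FreeSeq.bounds (h₁ : T₁ ≠ []) (h₂ : T₂ ≠ []) (h : wordPow T₁ ≺ wordPow T₂)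
    (hx : FreeSeq T₁ T₂ x) : wordPow T₁ ≼ x ∧ x ≼ wordPow T₂ := by
  induction hx with
  | base => exact ⟨h.le, seqLE.rfl⟩
  | left _ ih => exact ⟨le_append_of_le h₁ seqLE.rfl ih.1, append_le_of_ge h₁ h.le ih.2⟩
  | right _ ih => exact ⟨le_append_of_le h₂ h.le ih.1, append_le_of_ge h₂ seqLE.rfl ih.2⟩

/-- Free sequences lie between T₁^∞ and T₂^∞. Hence the first |T₁| + |T₂| digits are at most T₁T₂
after a start T₁ and at least T₂T₁ after a start T₂, and these two words differ; so no prefix of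
length m is counted twice. -/
theorem cnt_freeSeq_ge (h₁ : T₁ ≠ []) (h₂ : T₂ ≠ []) (h : wordPow T₁ ≺ wordPow T₂) {m : ℕ}
    (hm : T₁.length + T₂.length ≤ m) :
    cnt {x | FreeSeq T₁ T₂ x} (m - T₁.length) + cnt {x | FreeSeq T₁ T₂ x} (m - T₂.length) ≤
      cnt {x | FreeSeq T₁ T₂ x} m := by
  set F := {x | FreeSeq T₁ T₂ x}
  have hinj : ∀ u : Word, Function.Injective fun w : Word => u ++ w :=
    fun u _ _ e => List.append_cancel_left e
  have hdisj : Disjoint ((fun w : Word => T₁ ++ w) '' pref F (m - T₁.length))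
      ((fun w : Word => T₂ ++ w) '' pref F (m - T₂.length)) := by
    rw [Set.disjoint_left]
    rintro w ⟨-, ⟨x, hx, rfl⟩, rfl⟩ ⟨-, ⟨y, hy, rfl⟩, e⟩
    simp only at e
    rw [← block_append_word _ _ (by omega), ← block_append_word _ _ (by omega)] at e
    have hb := below_append_comm h₁ h₂ h
    have e2 := eq_of_block_eq e
    have hx' := (append_le_append_iff (u := T₁)).2 (FreeSeq.bounds h₁ h₂ h hx).2
    have hy' := (append_le_append_iff (u := T₂)).2 (FreeSeq.bounds h₁ h₂ h hy).1
    rw [← wordPow_eq h₂, ← append_wordAppend] at hx'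
    rw [← wordPow_eq h₁, ← append_wordAppend] at hy'
    obtain ⟨a, x', hal, ea⟩ := exists_eq_append (T₁ ⊹ x) (T₁ ++ T₂).length
    obtain ⟨b, y', hbl, eb⟩ := exists_eq_append (T₂ ⊹ y) (T₂ ++ T₁).length
    have hab : a = b := by
      have h3 : block (T₁ ⊹ x) 0 (T₁ ++ T₂).length = block (T₂ ⊹ y) 0 (T₂ ++ T₁).length := by
        rw [show (T₂ ++ T₁).length = (T₁ ++ T₂).length by simp [add_comm]]
        exact block_congr fun i hi => (e2 i (by simp at hi; omega)).symm
      rw [ea, eb] at h3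
      conv_lhs at h3 => rw [← hal, block_wordAppend]
      conv_rhs at h3 => rw [← hbl, block_wordAppend]
      exact h3
    rw [ea] at hx'
    rw [eb] at hy'
    subst hab
    rcases below_of_le hal hx' with h3 | ⟨h3, -⟩ <;>
      rcases below_of_le hbl.symm hy' with h4 | ⟨h4, -⟩
    · exact (hb.trans h4).asymm h3
    · rw [h4] at hb; exact hb.asymm h3
    · rw [h3] at h4; exact hb.asymm h4
    · rw [h4, h3] at hb; exact Below.irrefl _ hb
  have hsub : (fun w : Word => T₁ ++ w) '' pref F (m - T₁.length) ∪
      (fun w : Word => T₂ ++ w) '' pref F (m - T₂.length) ⊆ pref F m := by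
    rintro w (⟨-, ⟨x, hx, rfl⟩, rfl⟩ | ⟨-, ⟨x, hx, rfl⟩, rfl⟩)
    · exact ⟨T₁ ⊹ x, FreeSeq.left hx, block_append_word _ _ (by omega)⟩
    · exact ⟨T₂ ⊹ x, FreeSeq.right hx, block_append_word _ _ (by omega)⟩
  have h5 := Set.ncard_le_ncard hsub (finite_pref _ _)
  rw [Set.ncard_union_eq hdisj ((finite_pref _ _).image _) ((finite_pref _ _).image _),
    Set.ncard_image_of_injective _ (hinj _), Set.ncard_image_of_injective _ (hinj _)] at h5
  exact h5

theorem growth_lower {ξ : ℝ} (h₁ : T₁ ≠ []) (h₂ : T₂ ≠ []) (h : wordPow T₁ ≺ wordPow T₂)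
    (hξ : 0 < ξ) (hξ1 : ξ ≤ 1) (hsum : 1 ≤ ξ ^ T₁.length + ξ ^ T₂.length) (m : ℕ) :
    ξ ^ (T₁.length + T₂.length) ≤ cnt {x | FreeSeq T₁ T₂ x} m * ξ ^ m := by
  have hl₁ : 1 ≤ T₁.length := List.length_pos_iff.2 h₁
  have hl₂ : 1 ≤ T₂.length := List.length_pos_iff.2 h₂
  induction m using Nat.strong_induction_on with
  | _ m ih =>
    rcases lt_or_ge m (T₁.length + T₂.length) with hm | hm
    · have h1 : (1 : ℝ) ≤ cnt {x | FreeSeq T₁ T₂ x} m := by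
        exact_mod_cast cnt_pos ⟨_, FreeSeq.base⟩ m
      exact (pow_le_pow_of_le_one hξ.le hξ1 hm.le).trans
        (le_mul_of_one_le_left (by positivity) h1)
    · have h1 := cnt_freeSeq_ge h₁ h₂ h hm
      set f := cnt {x | FreeSeq T₁ T₂ x}
      set κ := ξ ^ (T₁.length + T₂.length)
      have h1' : (f (m - T₁.length) : ℝ) + f (m - T₂.length) ≤ f m := by exact_mod_cast h1
      have i1 := ih (m - T₁.length) (by omega)
      have i2 := ih (m - T₂.length) (by omega)
      have hκ : 0 ≤ κ := by positivity
      calc κ ≤ κ * (ξ ^ T₁.length + ξ ^ T₂.length) := le_mul_of_one_le_right hκ hsum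
        _ = κ * ξ ^ T₁.length + κ * ξ ^ T₂.length := mul_add _ _ _
        _ ≤ f (m - T₁.length) * ξ ^ (m - T₁.length) * ξ ^ T₁.length +
            f (m - T₂.length) * ξ ^ (m - T₂.length) * ξ ^ T₂.length := by gcongr
        _ = (f (m - T₁.length) + f (m - T₂.length)) * ξ ^ m := by
            rw [mul_assoc, mul_assoc, ← pow_add, ← pow_add, Nat.sub_add_cancel (by omega),
              Nat.sub_add_cancel (by omega), add_mul]
        _ ≤ f m * ξ ^ m := by gcongr

end growth

/-! ### Sequences bounded below by the left endpoints -/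

section above
variable {S P U C C' v v' : Word} {a c x Q : Seq} {j j' n n' k k' s : ℕ}

theorem IsCut.lt (h : IsCut c s k j) (h' : IsCut c s k' j') (hk : k' < k) : j' < j := by
  cases h with
  | first => have := h'.one_le; omega
  | next h1 h2 =>
    have h3 := (h1.mono h' (by omega)).1
    have := h2.2.1.1
    omega

theorem E_lt_E (h : block c 0 j = C ++ [true]) (h' : block c 0 j' = C' ++ [true]) (hlt : j' < j) :
    wordPow (C' ++ [false]) ≺ wordPow (C ++ [false]) := by
  obtain ⟨m, rfl⟩ := Nat.exists_eq_add_of_le hlt.le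
  rw [block_add, h'] at h
  obtain ⟨w, b, h1⟩ : ∃ w b, block c (0 + j') m = w ++ [b] := by
    rcases List.eq_nil_or_concat' (block c (0 + j') m) with h1 | ⟨w, b, h1⟩
    · have := congrArg List.length h1
      simp at this; omega
    · exact ⟨w, b, h1⟩
  rw [h1, ← List.append_assoc] at h
  have e : C = (C' ++ [true]) ++ w := (List.append_inj' h.symm rfl).1
  rw [← wordPow_eq (w := C' ++ [false]) (by simp), ← wordPow_eq (w := C ++ [false]) (by simp), e,
    List.append_assoc, append_wordAppend (C' ++ [true])]
  exact below_concat C' _ _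

/-- `Q` is at most the left endpoints belonging to all cuts before the `k`-th. -/
def Above (S : Word) (c : Seq) (k : ℕ) (Q : Seq) : Prop :=
  ∀ k' j' n' C' v', k' < k → IsCut c S.length k' j' → IsReturn c j' n' →
    RetData S c j' n' C' v' → Q ≼ leftEnd C' v'

theorem Above.mono (h : Above S c k Q) (hk : k' ≤ k) : Above S c k' Q :=
  fun k₁ j₁ n₁ C₁ v₁ h1 => h k₁ j₁ n₁ C₁ v₁ (by omega)

theorem Above.low (h : Above S c k Q) (st : Setting S P U a c) : Low c S.length k Q := by
  intro k' j' n' hk h1 h2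
  obtain ⟨C', v', rd⟩ := st.retData h1 h2
  rw [rd.block_v]
  exact (h _ _ _ _ _ hk h1 h2 rd).trans (leftEnd_lt_powV C' v').le

theorem block_next (rd : RetData S c j n C v) {C₁ : Word} (h : block c 0 (j + n) = C₁ ++ [true]) :
    C₁ = (C ++ [true]) ++ v := by
  rw [block_add, zero_add, rd.block_C, rd.block_v, ← List.append_assoc] at h
  exact (List.append_inj' h.symm rfl).1

theorem Setting.first_block (st : Setting S P U a c) (h : block c 0 S.length = C ++ [true]) :
    C = true :: P := by
  rw [st.block_c] at h
  exact (List.append_inj' h.symm rfl).1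

/-- Lower bounds for the suffixes of `C₁⁻ = C v⁻` at a cut after the cut with `c = C…`. -/
theorem Setting.le_suffix_next (st : Setting S P U a c) (hS : Q ≼ wordPow S)
    (hc : IsCut c S.length k j) (hr : IsReturn c j n) (rd : RetData S c j n C v)
    (hQ : Above S c (k + 1) Q) (hx : wordPow (C ++ [false]) ≼ x) {p q : Word}
    (e : (C ++ [true]) ++ v = p ++ q) : Q ≼ (q ++ [false]) ⊹ x := by
  have hv : ∀ p q, v = p ++ q → Q ≼ (q ++ [false]) ⊹ x := by
    intro p q e
    refine (hQ _ _ _ _ _ (Nat.lt_succ_self _) hc hr rd).trans ?_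
    exact (st.minus_le_suffix rd.block_C rd.D_eq rd.sl e).trans (append_le_append_iff.2 hx)
  rcases List.append_eq_append_iff.1 e with ⟨t, e1, e2⟩ | ⟨t, e1, e2⟩
  · exact hv _ _ e2
  · rw [e2, List.append_assoc, append_wordAppend]
    exact st.le_suffix_cut hc hS ((hQ.mono (Nat.le_succ _)).low st) (rd.block_C.trans e1)
      (hv [] v rfl)

theorem Setting.le_shift_E (st : Setting S P U a c) (hS : Q ≼ wordPow S)
    (hc : IsCut c S.length k j) (hC : block c 0 j = C ++ [true]) (hQ : Above S c k Q) (i : ℕ) :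
    Q ≼ shiftBy i (wordPow (C ++ [false])) := by
  cases hc with
  | first =>
    rw [st.first_block hC]
    exact hS.trans (st.le_shift_powA i)
  | next h1 h2 =>
    obtain ⟨C₀, v, rd⟩ := st.retData h1 h2
    have hlt := E_lt_E hC rd.block_C (by have := h2.2.1.1; omega)
    refine forall_shift_wordPow (K := fun t => Q ≼ t) (by simp) ?_ i
    refine forall_suffix_minus (K := fun t => Q ≼ t) fun p q e => ?_
    rw [block_next rd hC] at e
    exact st.le_suffix_next hS h1 h2 rd hQ hlt.le e

/-- If an earlier left endpoint X' lay strictly below v1^∞, it would begin with v0 or v1. After v0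
its tail would be ≽ (C0)^∞, but its shifts are ≼ (C'0)^∞ ≺ (C0)^∞. After v1 its tail is ≽ X' or ≽
v1^∞, and either gives X' ≽ v1^∞. -/
theorem Setting.above_powV (st : Setting S P U a c) (hc : IsCut c S.length k j)
    (rd : RetData S c j n C v)
    (hlt : ∀ k' j' n' C' v', k' < k → IsCut c S.length k' j' → IsReturn c j' n' →
      RetData S c j' n' C' v' → leftEnd C v ≺ leftEnd C' v') :
    Above S c k (wordPow (v ++ [true])) := by
  have key : ∀ l ≤ k, Above S c l (wordPow (v ++ [true])) := by
    intro l
    induction l with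
    | zero => intro _ k' j' n' C' v' h; omega
    | succ l ih =>
      intro hl k' j' n' C' v' hk' hc' hr' rd'
      have hab : Above S c k' (wordPow (v ++ [true])) := (ih (by omega)).mono (by omega)
      have hE := st.le_shift_E (st.powV_lt_powS rd).le hc' rd'.block_C hab
      rw [← seq_not_lt]
      intro hcon
      have h1 := hlt _ _ _ _ _ (by omega : k' < k) hc' hr' rd'
      have h2 := hcon.le
      rw [← wordPow_eq (w := v ++ [true]) (by simp)] at h2
      rcases between h1.le h2 with ⟨x', e, h3⟩ | ⟨x', e, h3⟩
      · have h4 := st.shift_leftEnd_le rd' (v ++ [false]).length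
        rw [e, shiftBy_length_append] at h4
        exact (h3.trans h4).not_lt (E_lt_E rd.block_C rd'.block_C (hc.lt hc' (by omega)))
      · have h4 : leftEnd C' v' ≼ x' ∨ wordPow (v ++ [true]) ≼ x' := by
          have h5 := forall_shift_minus_append
            (K := fun t => leftEnd C' v' ≼ t ∨ wordPow (v ++ [true]) ≼ t)
            (fun p q e => Or.inl (st.minus_le_suffix rd'.block_C rd'.D_eq rd'.sl e))
            (fun i => Or.inr (hE i)) (v ++ [true]).length
          rw [← leftEnd, e, shiftBy_length_append] at h5
          rw [e]
          exact h5
        rcases h4 with h4 | h4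
        · have h5 : (v ++ [true]) ⊹ leftEnd C' v' ≼ leftEnd C' v' := by
            conv_rhs => rw [e]
            rw [append_le_append_iff]; exact h4
          exact hcon.not_le (wordPow_le_of_append_le (by simp) h5)
        · apply hcon.not_le
          rw [e, ← wordPow_eq (w := v ++ [true]) (by simp), append_le_append_iff]
          exact h4
  exact key k le_rfl

theorem wordPow_le_of_forall_ge {w : Word} (hw : w ≠ [])
    (h : ∀ n, w ⊹ zeroSeq ≼ shiftBy n x) (n : ℕ) : wordPow w ≼ shiftBy n x := by
  refine le_coinduction (P := fun y => ∃ n, y = shiftBy n x) ?_ _ ⟨n, rfl⟩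
  rintro y ⟨n, rfl⟩
  obtain ⟨u, x', hu, e⟩ := exists_eq_append (shiftBy n x) w.length
  have h1 := h n
  rw [e] at h1
  rcases below_of_le hu.symm h1 with h2 | ⟨h2, -⟩
  · left
    rw [e, ← wordPow_eq hw]
    exact (h2 _ _).le
  · right
    refine ⟨w, x', hw, by rw [e, h2], ⟨n + u.length, ?_⟩,
      fun r hr => le_append_of_le hw seqLE.rfl hr⟩
    rw [← shiftBy_shiftBy, e, shiftBy_length_append]

/-! ### Upper bound for the number of words -/

theorem shiftInv_surv (a y : Seq) : ShiftInv (Surv a y) := fun _ hx n => Surv.shiftBy hx n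

/-- Blocks that are at least `v` and less than `C`. -/
def midBlocks (v C : Word) : Set Word :=
  {w | (∀ y, (v ++ [true]) ⊹ zeroSeq ≼ w ⊹ y) ∧ ∀ y, w ⊹ y ≺ (C ++ [true]) ⊹ zeroSeq}

theorem block_mem_midBlocks {i l : ℕ} (h1 : (v ++ [true]) ⊹ zeroSeq ≼ shiftBy i x)
    (h2 : shiftBy i x ≺ (C ++ [true]) ⊹ zeroSeq) (hv : v.length + 1 ≤ l) (hC : C.length + 1 ≤ l) :
    block x i l ∈ midBlocks v C := by
  rw [← block_append_shiftBy' x i l] at h1 h2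
  have hl : (block x i l).length = l := length_block _ _ _
  generalize block x i l = w at h1 h2 hl
  constructor
  · intro y
    rw [← List.take_append_drop (v.length + 1) w, append_wordAppend (w.take _)] at h1 ⊢
    rcases below_of_le (by simp; omega) h1 with h3 | ⟨h3, -⟩
    · exact (h3 _ _).le
    · rw [← h3, append_le_append_iff]; exact zeroSeq_le _
  · intro y
    rw [← List.take_append_drop (C.length + 1) w, append_wordAppend (w.take _)] at h2 ⊢
    rcases below_of_lt (by simp; omega) h2 with h3 | ⟨-, h3⟩
    · exact h3 _ _
    · exact absurd h3 (zeroSeq_le _).not_lt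

theorem mem_surv_of_midBlocks {l : ℕ} (h : ∀ i, block x i l ∈ midBlocks v C) :
    x ∈ Surv (wordPow (C ++ [false])) (wordPow (v ++ [true])) := by
  have h1 : ∀ i, (v ++ [true]) ⊹ zeroSeq ≼ shiftBy i x := fun i => by
    rw [← block_append_shiftBy' x i l]; exact (h i).1 _
  have h2 : ∀ i, shiftBy i x ≺ (C ++ [true]) ⊹ zeroSeq := fun i => by
    rw [← block_append_shiftBy' x i l]; exact (h i).2 _
  exact fun i => ⟨wordPow_le_of_forall_ge (by simp) h1 i, le_wordPow_of_forall_lt h2 i⟩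

theorem Setting.leftEnd_mem (st : Setting S P U a c) (hc : IsCut c S.length k j)
    (rd : RetData S c j n C v) (hQ : Above S c k (wordPow (v ++ [true]))) :
    leftEnd C v ∈ Surv a (leftEnd C v) := by
  intro i
  refine ⟨?_, ((st.shift_leftEnd_le rd i).trans_lt (st.E_lt_a rd)).le⟩
  refine forall_shift_minus_append (K := fun t => leftEnd C v ≼ t) ?_ ?_ i
  · exact fun p q e => st.minus_le_suffix rd.block_C rd.D_eq rd.sl e
  · exact fun i => (leftEnd_lt_powV C v).le.trans
      (st.le_shift_E (st.powV_lt_powS rd).le hc rd.block_C hQ i)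

theorem Setting.powS_mem_mid (st : Setting S P U a c) (hc : IsCut c S.length k j)
    (rd : RetData S c j n C v) :
    wordPow S ∈ Surv (wordPow (C ++ [false])) (wordPow (v ++ [true])) := fun i =>
  ⟨(st.powV_lt_powS rd).le.trans (st.fd.sl.le_shiftBy i),
    (st.shift_powS_le i).trans (st.powA_le_E (st.cut_le_first hc).1 rd.block_C)⟩

/-- Decomposition at the moment of entering the trap: before it the blocks are those of the middle
subshift, and after it the two-state recursion of `split_low` and `split_high` bounds the count
through `growth_upper`. -/
theorem Setting.cnt_upper (st : Setting S P U a c) (hc : IsCut c S.length k j)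
    (rd : RetData S c j n C v) (hQ : Above S c k (wordPow (v ++ [true]))) {ξ : ℝ}
    (hξ : 0 < ξ) (hξ1 : ξ ≤ 1) (hroot : ξ ^ j + ξ ^ n = 1) :
    ∃ K : ℝ, 0 < K ∧ ∀ m, (cnt (Surv a (leftEnd C v)) m : ℝ) ≤ K * ∑ i ∈ Finset.range (m + 1),
      cnt (Surv (wordPow (C ++ [false])) (wordPow (v ++ [true]))) i * (ξ⁻¹) ^ (m - i) := by
  classical
  set X := Surv a (leftEnd C v)
  set Z := Surv (wordPow (C ++ [false])) (wordPow (v ++ [true]))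
  set Lo : Set Seq := {x | x ∈ X ∧ x ≼ shiftBy j c} with hLo
  set Hi : Set Seq := {x | x ∈ X ∧ wordPow (C ++ [false]) ≼ x} with hHi
  have hX0 : ∀ x ∈ X, leftEnd C v ≼ x ∧ x ≼ c := by
    intro x hx
    have := hx 0
    rw [shiftBy_zero] at this
    exact ⟨this.1, this.2.trans st.le_c⟩
  have hXt : ∀ (y : Word) (x' : Seq), y ⊹ x' ∈ X → x' ∈ X := by
    intro y x' hx
    have := Surv.shiftBy hx y.length
    rwa [shiftBy_length_append] at this
  have hj := rd.length_C
  have hn := rd.length_v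
  have hLoRec : ∀ m, n ≤ m → cnt Lo m ≤ cnt Lo (m - n) + cnt Hi (m - n) := by
    intro m hm
    have h1 := cnt_le_of_split (X := Lo) (Y := Hi) (Y' := Lo) (u := v ++ [false])
      (u' := v ++ [true]) (m := m) (by
        rintro x ⟨hx, hxD⟩
        rcases rd.split_low (hX0 x hx).1 hxD with ⟨x', e, h⟩ | ⟨x', e, h⟩
        · exact Or.inl ⟨x', ⟨hXt _ _ (e ▸ hx), h⟩, e⟩
        · exact Or.inr ⟨x', ⟨hXt _ _ (e ▸ hx), h⟩, e⟩) (by simp; omega) (by simp; omega)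
    rw [show (v ++ [false]).length = n by simp [hn], show (v ++ [true]).length = n by simp [hn],
      add_comm] at h1
    exact h1
  have hHiRec : ∀ m, j ≤ m → cnt Hi m ≤ cnt Hi (m - j) + cnt Lo (m - j) := by
    intro m hm
    have h1 := cnt_le_of_split (X := Hi) (Y := Hi) (Y' := Lo) (u := C ++ [false])
      (u' := C ++ [true]) (m := m) (by
        rintro x ⟨hx, hxE⟩
        rcases rd.split_high hxE (hX0 x hx).2 with ⟨x', e, h⟩ | ⟨x', e, h⟩
        · exact Or.inl ⟨x', ⟨hXt _ _ (e ▸ hx), h⟩, e⟩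
        · exact Or.inr ⟨x', ⟨hXt _ _ (e ▸ hx), h⟩, e⟩) (by simp; omega) (by simp; omega)
    rw [show (C ++ [false]).length = j by simp [hj], show (C ++ [true]).length = j by simp [hj]]
      at h1
    exact h1
  have hgrow := growth_upper (by omega) (by omega) hξ hξ1 hroot (cnt_le_two_pow Lo)
    (cnt_le_two_pow Hi) hLoRec hHiRec
  set K₀ : ℝ := 2 ^ (n + j) / ξ ^ (n + j)
  have hneY : (Lo ∪ Hi).Nonempty := by
    refine ⟨leftEnd C v, Or.inl ⟨st.leftEnd_mem hc rd hQ, ?_⟩⟩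
    rw [rd.D_eq, leftEnd]
    exact (below_concat v _ _).le
  have hneZ : Z.Nonempty := ⟨_, st.powS_mem_mid hc rd⟩
  refine ⟨2 ^ 2 ^ (j + n) * K₀, by positivity, fun m => ?_⟩
  have h1 := cnt_le_sum (X := X) (Y := Lo ∪ Hi) (m := m)
    (A := blockFree (midBlocks v C) (j + n)) (finite_blockFree _ _) hneY (by
      intro x hx
      have hmid : ∀ i, (∀ i' < i, (v ++ [true]) ⊹ zeroSeq ≼ shiftBy i' x ∧
          shiftBy i' x ≺ (C ++ [true]) ⊹ zeroSeq) →
          block x 0 i ∈ blockFree (midBlocks v C) (j + n) i := fun i h =>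
        ⟨x, rfl, fun i' hi' => block_mem_midBlocks (h i' hi').1 (h i' hi').2 (by omega) (by omega)⟩
      -- The first shift outside [v10^∞, C10^∞) is either ≼ D or ≽ (C0)^∞, hence trapped.
      by_cases hbad : ∃ i ≤ m, ¬ ((v ++ [true]) ⊹ zeroSeq ≼ shiftBy i x ∧
          shiftBy i x ≺ (C ++ [true]) ⊹ zeroSeq)
      · obtain ⟨hi, hb⟩ := Nat.find_spec hbad
        refine ⟨Nat.find hbad, hi, hmid _ fun i' hi' => ?_, Or.inr ?_⟩
        · have := Nat.find_min hbad hi'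
          by_contra hcon
          exact this ⟨by omega, hcon⟩
        · generalize Nat.find hbad = i at hb
          rcases seq_le_or_lt ((v ++ [true]) ⊹ zeroSeq) (shiftBy i x) with g | g
          · right
            refine ⟨Surv.shiftBy hx i, ?_⟩
            have g2 := seq_not_lt.1 fun g2 => hb ⟨g, g2⟩
            refine seqLE.trans ?_ g2
            rw [← wordPow_eq (w := C ++ [false]) (by simp)]
            exact (below_concat C _ _).le
          · left
            refine ⟨Surv.shiftBy hx i, g.le.trans ?_⟩
            rw [rd.D_eq, append_le_append_iff]
            exact zeroSeq_le _
      · push Not at hbad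
        exact ⟨m, le_rfl, hmid _ fun i' hi' => ⟨(hbad i' hi'.le).1, (hbad i' hi'.le).2⟩, Or.inl rfl⟩)
  have h2 : (cnt X m : ℝ) ≤ ∑ i ∈ Finset.range (m + 1),
      ((blockFree (midBlocks v C) (j + n) i).ncard : ℝ) * cnt (Lo ∪ Hi) (m - i) := by
    exact_mod_cast h1
  refine h2.trans ?_
  rw [Finset.mul_sum]
  refine Finset.sum_le_sum fun i _ => ?_
  have h3 : ((blockFree (midBlocks v C) (j + n) i).ncard : ℝ) ≤ 2 ^ 2 ^ (j + n) * cnt Z i := by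
    exact_mod_cast ncard_blockFree_le (fun z hz => mem_surv_of_midBlocks hz) hneZ i
  have h4 : (cnt (Lo ∪ Hi) (m - i) : ℝ) ≤ K₀ * (ξ⁻¹) ^ (m - i) := by
    have h5 : (cnt (Lo ∪ Hi) (m - i) : ℝ) ≤ cnt Lo (m - i) + cnt Hi (m - i) := by
      exact_mod_cast cnt_union_le Lo Hi (m - i)
    rw [inv_pow, ← div_eq_mul_inv, le_div_iff₀ (by positivity)]
    exact (mul_le_mul_of_nonneg_right h5 (by positivity)).trans (hgrow _)
  calc _ ≤ (2 ^ 2 ^ (j + n) * (cnt Z i : ℝ)) * (K₀ * (ξ⁻¹) ^ (m - i)) :=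
        mul_le_mul h3 h4 (by positivity) (by positivity)
    _ = _ := by ring

end above

/-! ### Two freely concatenable words -/

section free
variable {S P U C C₀ v v₀ T₁ T₂ : Word} {a c x Q E M : Seq} {j n k j₀ n₀ k₀ : ℕ}

theorem freeSeq_mem_surv (h₁ : T₁ ≠ []) (h₂ : T₂ ≠ []) (h : wordPow T₁ ≺ wordPow T₂)
    (hQ : Q ≼ wordPow T₂)
    (H₁ : ∀ x, wordPow T₁ ≼ x → x ≼ wordPow T₂ → Q ≼ x → ∀ p y, T₁ = p ++ y → y ≠ [] →
      Q ≼ y ⊹ x ∧ y ⊹ x ≼ E)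
    (H₂ : ∀ x, wordPow T₁ ≼ x → x ≼ wordPow T₂ → Q ≼ x → ∀ p y, T₂ = p ++ y → y ≠ [] →
      Q ≼ y ⊹ x ∧ y ⊹ x ≼ E) (hx : FreeSeq T₁ T₂ x) : x ∈ Surv E Q := by
  induction hx with
  | base =>
    exact forall_shift_wordPow (K := fun t => Q ≼ t ∧ t ≼ E) h₂ (H₂ _ h.le seqLE.rfl hQ)
  | left hx ih =>
    have hb := hx.bounds h₁ h₂ h
    have hQx := (ih 0).1
    rw [shiftBy_zero] at hQx
    exact forall_shift_append (K := fun t => Q ≼ t ∧ t ≼ E) (H₁ _ hb.1 hb.2 hQx) ih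
  | right hx ih =>
    have hb := hx.bounds h₁ h₂ h
    have hQx := (ih 0).1
    rw [shiftBy_zero] at hQx
    exact forall_shift_append (K := fun t => Q ≼ t ∧ t ≼ E) (H₂ _ hb.1 hb.2 hQx) ih

theorem wordPow_concat_eq (C : Word) :
    wordPow (C ++ [false]) = C ⊹ [false] ⊹ wordPow (C ++ [false]) := by
  conv_lhs => rw [← wordPow_eq (w := C ++ [false]) (by simp), append_wordAppend]

/-- After the first cut, the words `C₀⁻` and `C⁻` of two successive cuts are free. -/
theorem Setting.free_successive (st : Setting S P U a c) (hc₀ : IsCut c S.length k₀ j₀)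
    (hr₀ : IsReturn c j₀ n₀) (rd₀ : RetData S c j₀ n₀ C₀ v₀)
    (hC : block c 0 (j₀ + n₀) = C ++ [true]) (hS : Q ≼ wordPow S) (hQ : Above S c (k₀ + 1) Q)
    (hx : FreeSeq (C₀ ++ [false]) (C ++ [false]) x) : x ∈ Surv (wordPow (C ++ [false])) Q := by
  have hlt := E_lt_E hC rd₀.block_C (by have := hr₀.2.1.1; omega)
  have hCe := block_next rd₀ hC
  have hQ₀ : Above S c k₀ Q := hQ.mono (Nat.le_succ _)
  have hE₀ := st.le_shift_E hS hc₀ rd₀.block_C hQ₀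
  have hQE : Q ≼ wordPow (C ++ [false]) := by
    have := hE₀ 0
    rw [shiftBy_zero] at this
    exact this.trans hlt.le
  have hEC₀ : wordPow (C ++ [false]) = (C₀ ++ [true]) ⊹ (v₀ ++ [false]) ⊹ wordPow (C ++ [false]) := by
    conv_lhs => rw [← wordPow_eq (w := C ++ [false]) (by simp)]
    rw [← append_wordAppend]
    congr 1
    rw [hCe, List.append_assoc]
  refine freeSeq_mem_surv (by simp) (by simp) hlt hQE ?_ ?_ hx
  · intro x hx1 _ _
    refine forall_suffix_minus (K := fun t => Q ≼ t ∧ t ≼ _) fun p q e => ⟨?_, ?_⟩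
    · refine seqLE.trans ?_ (append_le_append_iff.2 hx1)
      rw [suffix_append_wordPow (p := p) (by simp) (by rw [e, List.append_assoc])]
      exact hE₀ _
    · conv_rhs => rw [hEC₀]
      by_cases hp : p = []
      · subst hp
        rw [List.nil_append] at e
        rw [e]
        exact (below_concat q _ _).le
      · rw [append_wordAppend C₀]
        exact (st.suffix_below rd₀.block_C e hp _ _).le
  · intro x hx1 hx2 _
    refine forall_suffix_minus (K := fun t => Q ≼ t ∧ t ≼ _) fun p q e => ⟨?_, ?_⟩
    · exact st.le_suffix_next hS hc₀ hr₀ rd₀ hQ hx1 (hCe ▸ e)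
    · by_cases hp : p = []
      · subst hp
        rw [List.nil_append] at e
        rw [← e]
        conv_rhs => rw [← wordPow_eq (w := C ++ [false]) (by simp)]
        exact append_le_append_iff.2 hx2
      · conv_rhs => rw [wordPow_concat_eq]
        exact (st.suffix_below hC e hp _ _).le

/-- Suffixes of the return word, continued by something below all shifts of `(C⁻)^∞`. -/
theorem Setting.suffix_return_le (st : Setting S P U a c) (rd : RetData S c j n C v)
    (hns : ∀ p, v ++ [true] ≠ p ++ (C ++ [true]))
    (hM : ∀ i, M ≼ shiftBy i (wordPow (C ++ [false]))) (hx : x ≼ M) :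
    ∀ q p, v ++ [true] = p ++ q → q ⊹ x ≼ wordPow (C ++ [false]) := by
  intro q
  induction hl : q.length using Nat.strong_induction_on generalizing q with
  | _ l ih =>
  subst hl
  intro p e
  have h1 : q ⊹ shiftBy (j + n) c ≼ c := by
    have h2 := st.shift_c_le (j + p.length)
    rwa [← shiftBy_shiftBy, rd.D_eq, e, shiftBy_append_append] at h2
  rcases le_or_gt q.length C.length with hq | hq
  · conv_rhs at h1 => rw [rd.c_eq, ← List.take_append_drop q.length C, append_wordAppend,
      append_wordAppend]
    have hE : wordPow (C ++ [false]) = C.take q.length ⊹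
        shiftBy q.length (wordPow (C ++ [false])) := by
      have h2 := wordPow_concat_eq C
      conv_rhs at h2 => rw [← List.take_append_drop q.length C, append_wordAppend]
      have h3 := congrArg (shiftBy (C.take q.length).length) h2
      rw [shiftBy_length_append, List.length_take, min_eq_left hq, List.take_append_drop] at h3
      rw [h3]
      rw [List.take_append_drop] at h2
      exact h2
    rw [hE]
    rcases below_of_le (by simp [hq]) h1 with h2 | ⟨h2, -⟩
    · exact (h2 _ _).le
    · rw [← h2, append_le_append_iff]
      exact hx.trans (hM _)
  · obtain ⟨q₁, q₂, hq₁, rfl⟩ : ∃ q₁ q₂ : Word, q₁.length = C.length + 1 ∧ q = q₁ ++ q₂ :=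
      ⟨q.take (C.length + 1), _, by simp; omega, (List.take_append_drop _ _).symm⟩
    rw [append_wordAppend] at h1 ⊢
    conv_rhs at h1 => rw [rd.c_eq]
    have h2 : Below q₁ (C ++ [true]) := by
      rcases below_of_le (by simp [hq₁]) h1 with h3 | ⟨h3, h4⟩
      · exact h3
      · exfalso
        by_cases hq₂ : q₂ = []
        · subst hq₂
          exact hns p (by rw [e, h3, List.append_nil])
        · have hb := rd.sl.2 (p ++ q₁) q₂ (by rw [e, List.append_assoc]) (by
            intro h0
            rw [(List.append_eq_nil_iff.1 h0).2] at hq₁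
            simp at hq₁) hq₂
          have h5 := hb (shiftBy (j + n) c) (shiftBy (j + n) c)
          rw [← rd.D_eq] at h5
          exact h4.not_lt h5
    conv_rhs => rw [← wordPow_eq (w := C ++ [false]) (by simp)]
    rcases below_concat_true (by simp [hq₁]) h2 with h3 | h3
    · exact (h3 _ _).le
    · rw [h3, append_le_append_iff]
      exact ih q₂.length (by simp; omega) q₂ rfl (p ++ q₁) (by rw [e, List.append_assoc])

theorem Setting.suffix_return_bounds (st : Setting S P U a c) (rd : RetData S c j n C v)
    (hns : ∀ p, v ++ [true] ≠ p ++ (C ++ [true]))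
    (hM : ∀ i, M ≼ shiftBy i (wordPow (C ++ [false]))) (hx : x ≼ M)
    (hQx : wordPow (v ++ [true]) ≼ x) (p y : Word) (e : v ++ [true] = p ++ y) (hy : y ≠ []) :
    wordPow (v ++ [true]) ≼ y ⊹ x ∧ y ⊹ x ≼ wordPow (C ++ [false]) :=
  ⟨rd.sl.le_suffix_append seqLE.rfl hQx e hy, st.suffix_return_le rd hns hM hx y p e⟩

theorem Setting.free_first (st : Setting S P U a c) (rd : RetData S c S.length n C v)
    (hns : ∀ p, v ++ [true] ≠ p ++ (C ++ [true])) (hx : FreeSeq (v ++ [true]) S x) :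
    x ∈ Surv (wordPow (C ++ [false])) (wordPow (v ++ [true])) := by
  have hCe := st.first_block rd.block_C
  have hlt := st.powV_lt_powS rd
  refine freeSeq_mem_surv (by simp) st.S_ne_nil hlt hlt.le ?_ ?_ hx
  · intro x _ hx2 hx3
    refine st.suffix_return_bounds rd hns (fun i => ?_) hx2 hx3
    rw [hCe]; exact st.le_shift_powA i
  · intro x _ hx2 hx3 p y e hy
    refine ⟨st.fd.sl.le_suffix_append hlt.le hx3 e hy, (append_le_append_iff.2 hx2).trans ?_⟩
    rw [suffix_append_wordPow st.S_ne_nil e, hCe]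
    exact st.shift_powS_le _

theorem powMin_eq (v₀ C₀ : Word) : wordPow ((v₀ ++ [false]) ++ (C₀ ++ [true])) =
    (v₀ ++ [false]) ⊹ wordPow ((C₀ ++ [true] ++ v₀) ++ [false]) := by
  rw [← wordPow_append_comm (by simp), List.append_assoc (C₀ ++ [true])]

/-- The word `v₀⁻C₀` gives the smallest shift of `(C⁻)^∞`, where `C = C₀v₀`. -/
theorem Setting.powMin_le_shift (st : Setting S P U a c) (hc₀ : IsCut c S.length k₀ j₀)
    (rd₀ : RetData S c j₀ n₀ C₀ v₀) (hC : block c 0 (j₀ + n₀) = C ++ [true]) (i : ℕ) :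
    wordPow ((v₀ ++ [false]) ++ (C₀ ++ [true])) ≼ shiftBy i (wordPow (C ++ [false])) := by
  have hCe := block_next rd₀ hC
  have hmin := powMin_eq v₀ C₀
  rw [← hCe] at hmin
  have hlt : wordPow ((v₀ ++ [false]) ++ (C₀ ++ [true])) ≺ wordPow (v₀ ++ [true]) := by
    rw [hmin, ← wordPow_eq (w := v₀ ++ [true]) (by simp)]
    exact below_concat v₀ _ _
  have hv : ∀ p q, v₀ = p ++ q → wordPow ((v₀ ++ [false]) ++ (C₀ ++ [true])) ≼
      (q ++ [false]) ⊹ wordPow (C ++ [false]) := by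
    intro p q e
    rw [hmin]
    refine rd₀.sl.minus_le_suffix (fun f p e => ?_) e
    exact st.suffix_E_le hC (p := C₀ ++ [true] ++ p) (by rw [hCe, e]; simp)
  refine forall_shift_wordPow (K := fun t => _ ≼ t) (by simp) ?_ i
  refine forall_suffix_minus (K := fun t => _ ≼ t) fun p q e => ?_
  rw [hCe] at e
  rcases List.append_eq_append_iff.1 e with ⟨t, e1, e2⟩ | ⟨t, e1, e2⟩
  · exact hv _ _ e2
  · rw [e2, List.append_assoc t, append_wordAppend t]
    exact st.le_suffix_cut hc₀ (hlt.le.trans (st.powV_lt_powS rd₀).le)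
      ((st.low_powV hc₀ rd₀).anti hlt.le) (rd₀.block_C.trans e1) (hv [] v₀ rfl)

/-- The second word v₀0C₀1 is the rotation of C0 = C₀1v₀0 whose power is the smallest shift of
(C0)^∞. Tails at most this power fit after every prefix of (C0)^∞, which yields the upper bounds. -/
theorem Setting.free_later (st : Setting S P U a c) (hc₀ : IsCut c S.length k₀ j₀)
    (hr₀ : IsReturn c j₀ n₀) (rd₀ : RetData S c j₀ n₀ C₀ v₀) (rd : RetData S c (j₀ + n₀) n C v)
    (hQ : Above S c (k₀ + 1) (wordPow (v ++ [true])))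
    (hns : ∀ p, v ++ [true] ≠ p ++ (C ++ [true])) :
    wordPow (v ++ [true]) ≺ wordPow ((v₀ ++ [false]) ++ (C₀ ++ [true])) ∧
    ∀ x, FreeSeq (v ++ [true]) ((v₀ ++ [false]) ++ (C₀ ++ [true])) x →
      x ∈ Surv (wordPow (C ++ [false])) (wordPow (v ++ [true])) := by
  have hCe := block_next rd₀ rd.block_C
  have hmin := powMin_eq v₀ C₀
  rw [← hCe] at hmin
  have hE := E_lt_E rd.block_C rd₀.block_C (by have := hr₀.2.1.1; omega)
  have hS := (st.powV_lt_powS rd).le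
  have hlt : wordPow (v ++ [true]) ≺ wordPow ((v₀ ++ [false]) ++ (C₀ ++ [true])) := by
    refine (hQ _ _ _ _ _ (Nat.lt_succ_self _) hc₀ hr₀ rd₀).trans_lt ?_
    rw [hmin, leftEnd, append_lt_append_iff]
    exact hE
  refine ⟨hlt, fun x hx => freeSeq_mem_surv (by simp) (by simp) hlt hlt.le ?_ ?_ hx⟩
  · intro x _ hx2 hx3
    exact st.suffix_return_bounds rd hns (st.powMin_le_shift hc₀ rd₀ rd.block_C) hx2 hx3
  · intro x _ hx2 hx3 p y e hy
    constructor
    · have hC₀ : ∀ p y, C₀ ++ [true] = p ++ y → wordPow (v ++ [true]) ≼ y ⊹ x := fun p y e =>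
        st.le_suffix_cut hc₀ hS ((hQ.mono (Nat.le_succ _)).low st) (rd₀.block_C.trans e) hx3
      rcases List.append_eq_append_iff.1 e with ⟨t, e1, e2⟩ | ⟨t, e1, e2⟩
      · exact hC₀ _ _ e2
      · by_cases ht : t = []
        · subst ht
          exact hC₀ [] y (by simpa using e2.symm)
        · rw [e2, append_wordAppend]
          refine forall_suffix_minus (K := fun t => wordPow (v ++ [true]) ≼ t) (fun p q e3 => ?_)
            p t e1 ht
          refine st.le_suffix_next hS hc₀ hr₀ rd₀ hQ (p := C₀ ++ [true] ++ p) ?_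
            (by rw [e3]; simp)
          rw [← wordPow_eq (w := C₀ ++ [false]) (by simp)]
          exact (below_concat C₀ _ _).le
    · refine (append_le_append_iff.2 hx2).trans ?_
      rw [suffix_append_wordPow (by simp) e, hmin]
      have h1 : (v₀ ++ [false]) ⊹ wordPow (C ++ [false]) =
          shiftBy (C₀ ++ [true]).length (wordPow (C ++ [false])) :=
        suffix_append_wordPow (by simp) (by rw [hCe, List.append_assoc])
      rw [h1, shiftBy_shiftBy]
      exact st.shift_E_le rd.block_C _

/-! ### The words U S^N approximating S⁻ L(S)^∞. -/

/-- The words `U S^N`. -/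
def wordUS (U S : Word) : ℕ → Word
  | 0 => U
  | N + 1 => wordUS U S N ++ S

theorem Setting.wordUS_SL (st : Setting S P U a c) (N : ℕ) :
    SL (wordUS U S N) ∧ wordPow (wordUS U S N) ≺ wordPow S := by
  induction N with
  | zero => exact ⟨st.fd.slU, st.fd.ltU⟩
  | succ N ih =>
    have h := append_SL ih.1 st.fd.sl ih.2
    exact ⟨h.1, h.2.wordPow_lt h.1.1 st.S_ne_nil⟩

theorem Setting.wordUS_append (st : Setting S P U a c) (N : ℕ) :
    wordUS U S N ⊹ wordPow S = seqB P := by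
  induction N with
  | zero => exact st.seqB_eq.symm
  | succ N ih => rw [wordUS, append_wordAppend, wordPow_eq st.S_ne_nil, ih]

theorem Setting.length_wordUS (st : Setting S P U a c) (N : ℕ) : N ≤ (wordUS U S N).length := by
  have := st.length_pos
  induction N with
  | zero => omega
  | succ N ih => rw [wordUS, List.length_append]; omega

theorem Setting.powV_lt_seqB (st : Setting S P U a c) (rd : RetData S c j n C v) :
    wordPow (v ++ [true]) ≺ seqB P := by
  refine (st.powV_le_seqB rd).lt_of_ne fun e => ?_
  have h1 := shiftBy_mul_wordPow (w := v ++ [true]) (by simp) U.length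
  have h2 : U.length * 1 ≤ U.length * (v ++ [true]).length :=
    Nat.mul_le_mul_left _ (by simp)
  conv_lhs at h1 => rw [e, st.seqB_eq]
  rw [shiftBy_append_of_ge (by omega)] at h1
  have h3 := st.fd.sl.le_shiftBy (U.length * (v ++ [true]).length - U.length)
  rw [h1] at h3
  exact h3.not_lt (st.powV_lt_powS rd)

/-- When v1 = t1P1, the word v1 itself would violate the upper bound A^∞. It is replaced by T = US^N
with the least N such that T^∞ ≽ v1^∞. If T were longer than v1, comparing v1^∞ with S⁻A^∞ =
US^(N-1)S^∞ would put the tail of v1^∞ after t, which begins with 1P1, below A^∞. -/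
theorem Setting.free_first_of_suffix (st : Setting S P U a c) (rd : RetData S c S.length n C v)
    {t : Word} (ht : v ++ [true] = t ++ (C ++ [true])) :
    ∃ T, T ≠ [] ∧ T.length ≤ n ∧ wordPow T ≺ wordPow S ∧ ∀ x, FreeSeq T S x →
      x ∈ Surv (wordPow (C ++ [false])) (wordPow (v ++ [true])) := by
  classical
  have hCe := st.first_block rd.block_C
  have hlt := st.powV_lt_powS rd
  have hex : ∃ N, wordPow (v ++ [true]) ≼ wordPow (wordUS U S N) := by
    obtain ⟨N, hN⟩ := (st.powV_lt_seqB rd).exists_depth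
    refine ⟨N, (hN _ _ (fun _ _ => rfl) fun i hi => ?_).le⟩
    have hl := st.length_wordUS N
    rw [← wordPow_eq (st.wordUS_SL N).1.1, ← st.wordUS_append N]
    exact wordAppend_lt_congr (by omega)
  have hN := Nat.find_spec hex
  have hNmin : ∀ N' < Nat.find hex, wordPow (wordUS U S N') ≺ wordPow (v ++ [true]) :=
    fun N' h => seq_not_le.1 (Nat.find_min hex h)
  generalize Nat.find hex = N at hN hNmin
  obtain ⟨hsl, hltS⟩ := st.wordUS_SL N
  refine ⟨wordUS U S N, hsl.1, ?_, hltS, fun x hx =>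
    freeSeq_mem_surv hsl.1 st.S_ne_nil hltS hlt.le ?_ ?_ hx⟩
  · have hvn : n = t.length + S.length := by
      have h1 := congrArg List.length ht
      have h2 := rd.length_v
      have h3 := rd.length_C
      simp at h1
      omega
    cases N with
    | zero =>
      have := st.fd.ltLen
      simp only [wordUS]
      omega
    | succ N =>
      rw [wordUS, List.length_append]
      by_contra hcon
      have htl : t.length ≤ (wordUS U S N).length := by omega
      have h1 := hNmin N (Nat.lt_succ_self _)
      rw [← wordPow_eq (st.wordUS_SL N).1.1] at h1
      have h2 := st.powV_le_seqB rd
      rw [← st.wordUS_append N] at h2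
      obtain ⟨w, r, hw, e⟩ := exists_eq_append (wordPow (v ++ [true])) (wordUS U S N).length
      rw [e] at h1 h2
      have h3 : w = wordUS U S N ∧ r ≼ wordPow S := by
        rcases below_of_le hw h2 with h3 | h3
        · exfalso
          rcases below_of_lt hw.symm h1 with h4 | ⟨h4, -⟩
          · exact h3.asymm h4
          · rw [h4] at h3; exact Below.irrefl _ h3
        · exact h3
      obtain ⟨rfl, hr⟩ := h3
      have h4 : shiftBy t.length (wordPow (v ++ [true])) = wAp P ⊹ wordPow (v ++ [true]) := by
        rw [← suffix_append_wordPow (by simp) ht, hCe]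
      have h5 : shiftBy t.length (wordPow (v ++ [true])) ≼ shiftBy t.length (seqB P) := by
        rw [e, ← st.wordUS_append N, shiftBy_append_of_le htl, shiftBy_append_of_le htl,
          append_le_append_iff]
        exact hr
      have h6 := h5.trans (st.shift_seqB_le _)
      rw [h4, ← wordPow_eq (w := wA P) (by simp)] at h6
      exact h6.not_lt (below_concat (true :: P) _ _)
  · intro x _ hx2 hx3 p y e hy
    refine ⟨hsl.le_suffix_append hN hx3 e hy, (append_le_append_iff.2 hx2).trans ?_⟩
    have h1 := st.shift_seqB_le p.length
    rw [← st.wordUS_append N, e, shiftBy_append_append] at h1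
    rw [hCe]
    exact h1
  · intro x _ hx2 hx3 p y e hy
    refine ⟨st.fd.sl.le_suffix_append hlt.le hx3 e hy, (append_le_append_iff.2 hx2).trans ?_⟩
    rw [suffix_append_wordPow st.S_ne_nil e, hCe]
    exact st.shift_powS_le _

/-- There are two free words inside the middle subshift whose lengths are at most those of `C` and
`v`, in some order. -/
theorem Setting.exists_free_pair (st : Setting S P U a c) (hc : IsCut c S.length k j)
    (rd : RetData S c j n C v) (hQ : Above S c k (wordPow (v ++ [true]))) :
    ∃ T₁ T₂, T₁ ≠ [] ∧ T₂ ≠ [] ∧ wordPow T₁ ≺ wordPow T₂ ∧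
      ((T₁.length ≤ j ∧ T₂.length ≤ n) ∨ (T₁.length ≤ n ∧ T₂.length ≤ j)) ∧
      ∀ x, FreeSeq T₁ T₂ x → x ∈ Surv (wordPow (C ++ [false])) (wordPow (v ++ [true])) := by
  have hn := rd.length_v
  by_cases hns : ∀ p, v ++ [true] ≠ p ++ (C ++ [true])
  · cases hc with
    | first =>
      exact ⟨_, _, by simp, st.S_ne_nil, st.powV_lt_powS rd, Or.inr ⟨by simp [hn], le_rfl⟩,
        fun x hx => st.free_first rd hns hx⟩
    | next h1 h2 =>
      obtain ⟨C₀, v₀, rd₀⟩ := st.retData h1 h2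
      obtain ⟨h3, h4⟩ := st.free_later h1 h2 rd₀ rd hQ hns
      refine ⟨_, _, by simp, by simp, h3, Or.inr ⟨by simp [hn], ?_⟩, h4⟩
      have := rd₀.length_C
      have := rd₀.length_v
      simp
      omega
  · push Not at hns
    obtain ⟨t, ht⟩ := hns
    have hjn : j ≤ n := by
      have h1 := congrArg List.length ht
      have h2 := rd.length_C
      simp at h1
      omega
    cases hc with
    | first =>
      obtain ⟨T, h1, h2, h3, h4⟩ := st.free_first_of_suffix rd ht
      exact ⟨T, S, h1, st.S_ne_nil, h3, Or.inr ⟨h2, le_rfl⟩, h4⟩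
    | next h1 h2 =>
      obtain ⟨C₀, v₀, rd₀⟩ := st.retData h1 h2
      refine ⟨C₀ ++ [false], C ++ [false], by simp, by simp,
        E_lt_E rd.block_C rd₀.block_C (by have := h2.2.1.1; omega), Or.inl ⟨?_, ?_⟩, fun x hx =>
        st.free_successive h1 h2 rd₀ rd.block_C (st.powV_lt_powS rd).le hQ hx⟩
      · have := rd₀.length_C
        simp
        omega
      · have := rd.length_C
        simp
        omega

theorem Setting.growth_le (st : Setting S P U a c) (hc : IsCut c S.length k j)
    (rd : RetData S c j n C v) (hQ : Above S c k (wordPow (v ++ [true]))) {h h' : ℝ}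
    (hX : HasGrowth (Surv a (leftEnd C v)) h)
    (hZ : HasGrowth (Surv (wordPow (C ++ [false])) (wordPow (v ++ [true]))) h') : h ≤ h' := by
  have hj := rd.length_C
  have hn := rd.length_v
  obtain ⟨ξ, hξ, hξ1, hroot⟩ := exists_root (j := j) (n := n) (by omega) (by omega)
  obtain ⟨K, hK, hup⟩ := st.cnt_upper hc rd hQ hξ hξ1 hroot
  obtain ⟨T₁, T₂, h₁, h₂, hlt, hlen, hfree⟩ := st.exists_free_pair hc rd hQ
  -- Shorter words only increase the powers of ξ ≤ 1, so the sum is at least ξ^j + ξ^n.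
  have hsum : 1 ≤ ξ ^ T₁.length + ξ ^ T₂.length := by
    rcases hlen with ⟨g1, g2⟩ | ⟨g1, g2⟩
    · have e1 := pow_le_pow_of_le_one hξ.le hξ1 g1
      have e2 := pow_le_pow_of_le_one hξ.le hξ1 g2
      linarith
    · have e1 := pow_le_pow_of_le_one hξ.le hξ1 g1
      have e2 := pow_le_pow_of_le_one hξ.le hξ1 g2
      linarith
  refine hX.le_of_sum_bound hZ ⟨_, st.leftEnd_mem hc rd hQ⟩ ⟨_, st.powS_mem_mid hc rd⟩ hξ
    (pow_pos hξ (T₁.length + T₂.length)) hK (fun m => ?_) hup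
  refine (growth_lower h₁ h₂ hlt hξ hξ1 hsum m).trans ?_
  refine mul_le_mul_of_nonneg_right ?_ (by positivity)
  exact_mod_cast cnt_mono (fun x hx => hfree x hx) m

end free

/-! ### Constancy of the entropy -/

section constancy
variable {S P U C v u : Word} {c : Seq} {β : ℝ} {j n k : ℕ}

/-- The middle subshift lies above the star of the return word. -/
theorem surv_subset_star (h1 : 1 < β) (h2 : β < 2) {E : Seq} (hE : E ≺ quasiGreedy β)
    (hv : SL v) (hu : IsStar β v u) : Surv E (wordPow v) ⊆ Surv (quasiGreedy β) (wordPow u) := by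
  intro z hz
  suffices h : ∀ n, wordPow u ≼ shiftBy n z from fun n => ⟨h n, (hz n).2.trans hE.le⟩
  -- The star is compared with the infimum Y of the orbit of z, which is shift-minimal and
  -- admissible: it is the power of a β-Lyndon word or is approached from below by such powers above
  -- v^∞.
  obtain ⟨Y, hY1, hY2⟩ := exists_lexInf (Set.range fun n => shiftBy n z) ⟨_, 0, rfl⟩
  suffices h : wordPow u ≼ Y from fun n => h.trans (hY1 _ ⟨n, rfl⟩)
  have hmin : ∀ n, Y ≼ shiftBy n Y := by
    intro n
    refine le_of_approx fun N => ?_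
    obtain ⟨t, ⟨i, rfl⟩, hag⟩ := hY2 (n + N)
    refine ⟨shiftBy n (shiftBy i z), hY1 _ ⟨i + n, (shiftBy_shiftBy _ _ _).symm⟩,
      fun r hr => hag _ (by omega)⟩
  have hup : ∀ n, shiftBy n Y ≼ E := by
    intro n
    refine approx_le fun N => ?_
    obtain ⟨t, ⟨i, rfl⟩, hag⟩ := hY2 (n + N)
    refine ⟨shiftBy n (shiftBy i z), ?_, fun r hr => hag _ (by omega)⟩
    rw [shiftBy_shiftBy]; exact (hz _).2
  have hvY : wordPow v ≼ Y := by
    refine le_of_approx fun N => ?_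
    obtain ⟨t, ⟨i, rfl⟩, hag⟩ := hY2 N
    exact ⟨shiftBy i z, (hz i).1, hag⟩
  have hadm : Adm β Y := fun n => (hup n).trans_lt hE
  by_cases hlt : ∀ n, 1 ≤ n → Y ≺ shiftBy n Y
  · have hvY' : wordPow v ≺ Y := by
      refine hvY.lt_of_ne fun e => ?_
      have h3 := shiftBy_length_wordPow hv.1
      rw [e] at h3
      exact (hlt _ (List.length_pos_iff.2 hv.1)).ne h3.symm
    obtain ⟨N, hN⟩ := hvY'.exists_depth
    obtain ⟨L, hL, hsl⟩ := exists_SL_initial hlt (N + 1)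
    obtain ⟨h3, h4⟩ := adm_wordPow_block (fun n => (hadm n).le) (by omega : 1 ≤ L) hlt
    have h5 : wordPow v ≺ wordPow (block Y 0 L) := by
      refine hN _ _ (fun _ _ => rfl) fun i hi => ?_
      rw [← wordPow_eq hsl.1]
      conv_rhs => rw [← block_append_shiftBy Y L]
      exact wordAppend_lt_congr (by simp; omega)
    exact (hu.2 _ ((isBetaLyndon_iff h1 h2).2 ⟨hsl, h4⟩) h5.le).trans h3.le
  · push Not at hlt
    obtain ⟨m, hm, hm2⟩ := hlt
    have hper : shiftBy m Y = Y := (seq_not_lt.1 hm2).antisymm (hmin m)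
    obtain ⟨y, hy, e⟩ := exists_SL_of_periodic hmin ⟨m, hm, hper⟩
    rw [e] at hadm hvY ⊢
    exact hu.2 _ ((isBetaLyndon_iff h1 h2).2 ⟨hy, hadm⟩) hvY

theorem Setting.star_le_powS (st : Setting S P U (quasiGreedy β) c) (h1 : 1 < β) (h2 : β < 2)
    (hv : wordPow v ≼ wordPow S) (hu : IsStar β v u) : wordPow u ≼ wordPow S :=
  hu.2 S ((isBetaLyndon_iff h1 h2).2 ⟨st.fd.sl, st.adm_powS⟩) hv

/-- If some earlier left endpoint lies at or below the present one, the window is contained in the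
earlier one, since return words and their stars decrease, and the entropy is inherited. Otherwise
the middle subshift sits between the two ends and has the entropy of the larger one. -/
theorem Setting.exists_growth (st : Setting S P U (quasiGreedy β) c) (h1 : 1 < β) (h2 : β < 2)
    (k : ℕ) : ∀ j n C v u, IsCut c S.length k j → IsReturn c j n → RetData S c j n C v →
      IsStar β (v ++ [true]) u →
      ∃ h, HasGrowth (Surv (quasiGreedy β) (leftEnd C v)) h ∧
        HasGrowth (Surv (quasiGreedy β) (wordPow u)) h := by
  induction k using Nat.strong_induction_on with
  | _ k ih =>
  intro j n C v u hc hr rd hu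
  have hvS := (st.powV_lt_powS rd).le
  have huS := st.star_le_powS h1 h2 hvS hu
  have hXu : leftEnd C v ≼ wordPow u := (leftEnd_lt_powV C v).le.trans hu.1.2
  have hne : ∀ {Y}, Y ≼ wordPow S → (Surv (quasiGreedy β) Y).Nonempty :=
    fun hY => ⟨_, st.powS_mem hY⟩
  by_cases hex : ∃ k' j' n' C' v', k' < k ∧ IsCut c S.length k' j' ∧ IsReturn c j' n' ∧
      RetData S c j' n' C' v' ∧ leftEnd C' v' ≼ leftEnd C v
  · obtain ⟨k', j', n', C', v', hk, hc', hr', rd', hle⟩ := hex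
    have hvS' := (st.powV_lt_powS rd').le
    obtain ⟨u', hu'⟩ := st.exists_star h1 h2 rd'.sl hvS'
    obtain ⟨h, hX, hU⟩ := ih k' hk j' n' C' v' u' hc' hr' rd' hu'
    have huu : wordPow u ≼ wordPow u' :=
      hu.2 u' hu'.1.1 ((powV_anti rd rd' (hc.mono hc' hk.le).2).trans hu'.1.2)
    have hne' := hne (st.star_le_powS h1 h2 hvS' hu')
    exact ⟨h, HasGrowth.squeeze hne' (Surv.mono (hXu.trans huu)) (Surv.mono hle) hU hX,
      HasGrowth.squeeze hne' (Surv.mono huu) (Surv.mono (hle.trans hXu)) hU hX⟩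
  · have hQ : Above S c k (wordPow (v ++ [true])) := by
      refine st.above_powV hc rd fun k' j' n' C' v' hk hc' hr' rd' => ?_
      rw [← seq_not_le]
      exact fun hle => hex ⟨k', j', n', C', v', hk, hc', hr', rd', hle⟩
    obtain ⟨h, hX⟩ := exists_hasGrowth (shiftInv_surv _ _) (hne (hXu.trans huS))
    have hneZ : (Surv (wordPow (C ++ [false])) (wordPow (v ++ [true]))).Nonempty :=
      ⟨_, st.powS_mem_mid hc rd⟩
    obtain ⟨h', hZ⟩ := exists_hasGrowth (shiftInv_surv _ _) hneZ
    have hZu := surv_subset_star h1 h2 (st.E_lt_a rd) rd.sl hu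
    have hle := st.growth_le hc rd hQ hX hZ
    have hge := HasGrowth.mono hneZ (hZu.trans (Surv.mono hXu)) hZ hX
    have e : h' = h := le_antisymm hge hle
    subst e
    exact ⟨h', hX, HasGrowth.squeeze hneZ hZu (Surv.mono hXu) hZ hX⟩

end constancy

/-! ### Windows -/

section windows
variable {S P U C v u w : Word} {c : Seq} {β : ℝ} {j n k : ℕ}

theorem Setting.adm_leftEnd (st : Setting S P U (quasiGreedy β) c) (rd : RetData S c j n C v) :
    Adm β (leftEnd C v) := fun i => (st.shift_leftEnd_le rd i).trans_lt (st.E_lt_a rd)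

theorem RetData.window_eq (rd : RetData S c j n C v) (u : Word) [Decidable
    (IsBetaLyndon β (v ++ [true]) ∧ shiftBy j c = wordPow (v ++ [true]))] :
    window β c j (block c j n) u =
      if IsBetaLyndon β (v ++ [true]) ∧ shiftBy j c = wordPow (v ++ [true]) then
        Set.Icc (proj β (leftEnd C v)) (proj β (wordPow u))
      else Set.Ico (proj β (leftEnd C v)) (proj β (wordPow u)) := by
  rw [window, rd.block_v, rd.block_C, wordMinus_concat, wordMinus_concat, leftEnd]
  split_ifs <;> rfl

/-- No power of a β-Lyndon word lies in [v1^∞, (v1)^*^∞) by minimality of the star, so for such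
points the star can be replaced by v1^∞. The closed endpoint matters only when v1 is β-Lyndon, hence
its own star up to the power. -/
theorem Setting.mem_window_iff (st : Setting S P U (quasiGreedy β) c) (h1 : 1 < β) (h2 : β < 2)
    (rd : RetData S c j n C v) (hu : IsStar β (v ++ [true]) u) (hw : SL w)
    (ha : Adm β (wordPow w)) :
    proj β (wordPow w) ∈ window β c j (block c j n) u ↔ leftEnd C v ≼ wordPow w ∧
      (wordPow w ≺ wordPow (v ++ [true]) ∨
        (wordPow w = wordPow (v ++ [true]) ∧ shiftBy j c = wordPow (v ++ [true]))) := by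
  classical
  have hX := st.adm_leftEnd rd
  have hua := ((isBetaLyndon_iff h1 h2).1 hu.1.1).2
  rw [rd.window_eq u]
  split_ifs with hcond
  · rw [Set.mem_Icc, hX.proj_le_proj_iff h1 h2.le ha, ha.proj_le_proj_iff h1 h2.le hua]
    refine and_congr_right fun _ => ⟨fun h => ?_, ?_⟩
    · rcases (h.trans (hu.2 _ hcond.1 seqLE.rfl)).lt_or_eq with h3 | h3
      · exact Or.inl h3
      · exact Or.inr ⟨h3, hcond.2⟩
    · rintro (h | ⟨h, -⟩)
      · exact h.le.trans hu.1.2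
      · rw [h]; exact hu.1.2
  · rw [Set.mem_Ico, hX.proj_le_proj_iff h1 h2.le ha, ha.proj_lt_proj_iff h1 h2.le hua]
    refine and_congr_right fun _ => ⟨fun h => Or.inl ?_, ?_⟩
    · rw [← seq_not_le]
      exact fun hle => h.not_le (hu.2 w ((isBetaLyndon_iff h1 h2).2 ⟨hw, ha⟩) hle)
    · rintro (h | ⟨h, h'⟩)
      · exact h.trans_le hu.1.2
      · exact absurd ⟨(isBetaLyndon_iff h1 h2).2 ⟨rd.sl, h ▸ ha⟩, h'⟩ hcond

theorem proj_append_zero_le (h1 : 1 < β) (hw : w ≠ []) :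
    proj β (w ⊹ zeroSeq) ≤ proj β (wordPow w) := by
  have h := proj_sub h1 w.length (x := wordPow w) (y := w ⊹ zeroSeq) (fun i hi => by
    rw [← wordPow_eq hw]; exact wordAppend_lt_congr hi)
  have h0 : proj β zeroSeq = 0 := by simp [proj, zeroSeq]
  rw [shiftBy_length_append, h0, sub_zero] at h
  have h3 : 0 ≤ proj β (shiftBy w.length (wordPow w)) / β ^ w.length :=
    div_nonneg (proj_nonneg h1 _) (pow_nonneg (by linarith) _)
  linarith

end windows

end BetaHole

/-! ### Assembly of the transitivity criterion and the constancy of entropy. -/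

theorem theorem8p2 (S : Word) (hS : IsFarey S) (βl βs : ℝ) (hbasic : IsBasicInterval S βl βs)
    (β : ℝ) (hβ : β ∈ Set.Ioo βl βs) :
    (∀ tL tR : ℝ, IsBetaLyndonInterval β tL tR →
      Set.Icc tL tR ⊆ Set.Icc 0 (criticalValue β) →
      (IsTransitive (survivorShift β tR) ↔ ∀ I ∈ windows S β, tR ∉ I)) ∧
    (∀ I ∈ windows S β, ∃ h : ℝ, ∀ t ∈ I, HasEntropy (survivorShift β t) h) := by
  classical
  obtain ⟨h1, h2, P, U, st⟩ := setting_of_basic hS hbasic hβ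
  constructor
  · rintro tL tR ⟨w, hw, rfl, rfl⟩ hsub
    obtain ⟨hsl, hadm⟩ := (isBetaLyndon_iff h1 h2).1 hw
    -- Only t_R ≤ τ(β) is extracted from the inclusion; it becomes w^∞ ≼ S⁻A^∞, the condition under
    -- which A^∞ can be connected to every survivor.
    have hτ := (hsub ⟨proj_append_zero_le h1 hsl.1, le_rfl⟩).2.trans (st.criticalValue_le h1 h2)
    rw [hadm.proj_le_proj_iff h1 h2.le st.adm_seqB] at hτ
    have hshift : survivorShift β (proj β (wordPow w)) = Surv (quasiGreedy β) (wordPow w) := by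
      rw [survivorShift, hadm.greedy_proj h1 h2.le]
      rfl
    rw [hshift]
    constructor
    · rintro htr I ⟨k, j, n, u, hc, hr, hu, rfl⟩ hmem
      obtain ⟨C, v, rd⟩ := st.retData hc hr
      rw [rd.block_v] at hu
      obtain ⟨h3, h4⟩ := (st.mem_window_iff h1 h2 rd hu hsl hadm).1 hmem
      exact st.not_isTransitive hc rd hsl hadm h3 h4 htr
    · intro hno
      refine st.isTransitive hsl hadm hτ ?_
      intro k j n C v hc hr rd hX
      obtain ⟨u, hu⟩ := st.exists_star h1 h2 rd.sl (st.powV_lt_powS rd).le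
      have hnot := hno _ ⟨k, j, n, u, hc, hr, by rw [rd.block_v]; exact hu, rfl⟩
      rw [st.mem_window_iff h1 h2 rd hu hsl hadm] at hnot
      exact ⟨fun h => hnot ⟨hX, Or.inl h⟩, fun h => hnot ⟨hX, Or.inr h⟩⟩
  · rintro I ⟨k, j, n, u, hc, hr, hu, rfl⟩
    obtain ⟨C, v, rd⟩ := st.retData hc hr
    rw [rd.block_v] at hu
    obtain ⟨h, hX, hU⟩ := st.exists_growth h1 h2 k j n C v u hc hr rd hu
    have hXa := st.adm_leftEnd rd
    have hua := ((isBetaLyndon_iff h1 h2).1 hu.1.1).2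
    refine ⟨h, fun t ht => ?_⟩
    have ht' : t ∈ Set.Icc (proj β (leftEnd C v)) (proj β (wordPow u)) := by
      rw [rd.window_eq u] at ht
      split_ifs at ht
      · exact ht
      · exact Set.Ico_subset_Icc_self ht
    have ht01 : t ∈ Set.Ico (0 : ℝ) 1 :=
      ⟨(proj_nonneg h1 _).trans ht'.1, ht'.2.trans_lt (hua.proj_lt_one h1 h2.le)⟩
    have hga := adm_greedy h1 h2.le ht01
    have hgt := proj_greedy h1 h2.le ht01
    have hle1 := ht'.1
    have hle2 := ht'.2
    rw [← hgt, hXa.proj_le_proj_iff h1 h2.le hga] at hle1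
    rw [← hgt, hga.proj_le_proj_iff h1 h2.le hua] at hle2
    have huS := st.star_le_powS h1 h2 (st.powV_lt_powS rd).le hu
    have hsh : ShiftInv (survivorShift β t) := shiftInv_surv _ _
    rw [hasEntropy_iff hsh]
    exact HasGrowth.squeeze ⟨_, st.powS_mem huS⟩ (Surv.mono hle2) (Surv.mono hle1) hU hX
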